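/- Words are nonempty and finite, over a finite alphabet $A$; a word is viewed as the structure of its positions, with unary label predicates $P_a$ ($a\in A$), equality, and possibly further predicates. Let $\mathcal F$ be one of the fragments $\mathrm{FO}(=)$ (first-order logic with the predicates $P_a$ and $=$ only), $\mathrm{FO}^2(<)$ (first-order logic with $P_a$, $=$, $<$ and only two, reusable, variables), $\Sigma_n(<)$ (prenex first-order formulas with $P_a$, $=$, $<$, starting with an existential block and having at most $n-1$ quantifier alternations) or $\mathcal B\Sigma_n(<)$ (Boolean combinations of $\Sigma_n(<)$ and $\Pi_n(<)$ formulas), where $n\ge 1$. Let $\mathcal F^+$ be the same fragment with the additional predicates $+1$ (successor), $\min$ and $\max$ (first and last position). A language $L$ is $\mathcal F$-separable from $L'$ if there is a language $K$, definable by a sentence of $\mathcal F$, with $L\subseteq K$ and $K\cap L'=\emptyset$; likewise for $\mathcal F^+$. Let $\alpha:A^+\to S$ be a surjective morphism into a finite semigroup, and let $E(S)$ be the set of idempotents of $S$. Let $\mathbb A$ be the finite alphabet that is the disjoint union of $E(S)\times S\times E(S)$, $S\times E(S)$, $E(S)\times S$ and $S$. A word of $\mathbb A^+$ is well-formed if it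 is a single letter $s\in S$ or of the form $(s_0,f_0)(e_1,s_1,f_1)\cdots(e_n,s_n,f_n)(e_{n+1},s_{n+1})$ with $n\ge 0$, $(s_0,f_0)\in S\times E(S)$, $(e_i,s_i,f_i)\in E(S)\times S\times E(S)$, $(e_{n+1},s_{n+1})\in E(S)\times S$ and $f_i=e_{i+1}$ for $0\le i\le n$. Let $\beta:\mathbb A^+\to S$ be the morphism with $\beta(s)=s$, $\beta((s,e))=se$, $\beta((e,s))=es$, $\beta((e,s,f))=esf$. For $L\subseteq A^+$ recognized by $\alpha$ (that is, $L=\alpha^{-1}(P)$ for some $P\subseteq S$), let $\mathbb L$ be the set of well-formed words $w\in\mathbb A^+$ with $\beta(w)\in\alpha(L)$. **Theorem.** (1) Let $L,L'\subseteq A^+$ be recognized by $\alpha$, with associated languages $\mathbb L,\mathbb L'\subseteq\mathbb A^+$. Then $L$ is $\mathcal F^+$-separable from $L'$ if and only if $\mathbb L$ is $\mathcal F$-separable from $\mathbb L'$. (2) $\mathcal F^+$-separability of regular languages effectively reduces to $\mathcal F$-separability: there is a computable function, the same for all the fragments $\mathcal F$, that maps each pair of finite automata over a common finite alphabet to a pair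 of finite automata over a common finite alphabet, such that the languages of nonempty words accepted by the first pair are $\mathcal F^+$-separable (first from second) if and only if those accepted by the second pair are $\mathcal F$-separable (first from second). -/

import Mathlib

namespace PlusOne

universe u v

/-! ## Nonempty words

`A⁺` is `FreeSemigroup A`, the type of nonempty finite words over `A`. -/

/-- The (nonempty) list of letters of a word of `A⁺`. -/
def letters {A : Type u} (w : FreeSemigroup A) : List A := w.head :: w.tail

/-! ## First-order formulas over words

The variables are named by the elements of a type `V`, and the same variable may be quantified
several times. This is what is needed to speak of formulas with two reusable variables. -/

/-- Atomic formulas: `P_a(x)`, `x = y`, `x < y`, `y = x + 1`, `min(x)`, `max(x)`. -/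
inductive Atom (A : Type u) (V : Type v) : Type (max u v)
  | label (a : A) (x : V) : Atom A V
  | eq (x y : V) : Atom A V
  | lt (x y : V) : Atom A V
  | succ (x y : V) : Atom A V
  | isMin (x : V) : Atom A V
  | isMax (x : V) : Atom A V

/-- First-order formulas. -/
inductive Formula (A : Type u) (V : Type v) : Type (max u v)
  | falsum : Formula A V
  | atom (t : Atom A V) : Formula A V
  | neg (φ : Formula A V) : Formula A V
  | and (φ ψ : Formula A V) : Formula A V
  | or (φ ψ : Formula A V) : Formula A V
  | ex (x : V) (φ : Formula A V) : Formula A V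
  | all (x : V) (φ : Formula A V) : Formula A V

namespace Atom

variable {A : Type u} {V : Type v}

/-- The variables of an atomic formula. -/
def vars : Atom A V → Set V
  | label _ x => {x}
  | eq x y => {x, y}
  | lt x y => {x, y}
  | succ x y => {x, y}
  | isMin x => {x}
  | isMax x => {x}

/-- The atomic formulas of a signature: the label predicates and equality are always available,
`<` is available if `order = true`, and `+1`, `min`, `max` are available if `enriched = true`. -/
def InSignature (order enriched : Bool) : Atom A V → Prop
  | label _ _ => True
  | eq _ _ => True
  | lt _ _ => order = true
  | succ _ _ => enriched = true
  | isMin _ => enriched = true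
  | isMax _ => enriched = true

/-- Truth of an atomic formula in a word, whose positions are `0, …, |w| - 1`. -/
def Sat (w : FreeSemigroup A) (ν : V → Fin (letters w).length) : Atom A V → Prop
  | label a x => (letters w).get (ν x) = a
  | eq x y => ν x = ν y
  | lt x y => ν x < ν y
  | succ x y => (ν y : ℕ) = (ν x : ℕ) + 1
  | isMin x => (ν x : ℕ) = 0
  | isMax x => (ν x : ℕ) + 1 = (letters w).length

end Atom

namespace Formula

variable {A : Type u} {V : Type v}

/-- The free variables of a formula. -/
def freeVars : Formula A V → Set V
  | falsum => ∅
  | atom t => t.vars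
  | neg φ => φ.freeVars
  | and φ ψ => φ.freeVars ∪ ψ.freeVars
  | or φ ψ => φ.freeVars ∪ ψ.freeVars
  | ex x φ => φ.freeVars \ {x}
  | all x φ => φ.freeVars \ {x}

/-- A sentence is a formula without free variables. -/
def IsSentence (φ : Formula A V) : Prop := φ.freeVars = ∅

/-- Only predicates of the given signature occur in the formula. -/
def InSignature (order enriched : Bool) : Formula A V → Prop
  | falsum => True
  | atom t => t.InSignature order enriched
  | neg φ => φ.InSignature order enriched
  | and φ ψ => φ.InSignature order enriched ∧ ψ.InSignature order enriched
  | or φ ψ => φ.InSignature order enriched ∧ ψ.InSignature order enriched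
  | ex _ φ => φ.InSignature order enriched
  | all _ φ => φ.InSignature order enriched

/-- Quantifier-free formulas. -/
def IsQF : Formula A V → Prop
  | falsum => True
  | atom _ => True
  | neg φ => φ.IsQF
  | and φ ψ => φ.IsQF ∧ ψ.IsQF
  | or φ ψ => φ.IsQF ∧ ψ.IsQF
  | ex _ _ => False
  | all _ _ => False

/-- `IsPrenex b n φ`: the formula `φ` is prenex and its quantifier prefix consists of at most `n`
alternating blocks (possibly empty), the first of which is existential if `b = true` and universal
if `b = false`. For `n ≥ 1` there are thus at most `n - 1` alternations. -/
inductive IsPrenex : Bool → ℕ → Formula A V → Prop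
  | qf {b : Bool} {n : ℕ} {φ : Formula A V} : φ.IsQF → IsPrenex b n φ
  | ex {n : ℕ} {x : V} {φ : Formula A V} :
      IsPrenex true (n + 1) φ → IsPrenex true (n + 1) (ex x φ)
  | all {n : ℕ} {x : V} {φ : Formula A V} :
      IsPrenex false (n + 1) φ → IsPrenex false (n + 1) (all x φ)
  | switch {b : Bool} {n : ℕ} {φ : Formula A V} :
      IsPrenex (!b) n φ → IsPrenex b (n + 1) φ

/-- `Σₙ` formulas (in prenex normal form). -/
def IsSigma (n : ℕ) (φ : Formula A V) : Prop := IsPrenex true n φ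

/-- `Πₙ` formulas (in prenex normal form). -/
def IsPi (n : ℕ) (φ : Formula A V) : Prop := IsPrenex false n φ

/-- `BΣₙ` formulas: Boolean combinations of `Σₙ` and `Πₙ` formulas. -/
inductive IsBSigma (n : ℕ) : Formula A V → Prop
  | sigma {φ : Formula A V} : φ.IsSigma n → IsBSigma n φ
  | pi {φ : Formula A V} : φ.IsPi n → IsBSigma n φ
  | neg {φ : Formula A V} : IsBSigma n φ → IsBSigma n (neg φ)
  | and {φ ψ : Formula A V} : IsBSigma n φ → IsBSigma n ψ → IsBSigma n (and φ ψ)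
  | or {φ ψ : Formula A V} : IsBSigma n φ → IsBSigma n ψ → IsBSigma n (or φ ψ)

/-- Truth of a formula in a word under a valuation of the variables by positions. -/
def Sat [DecidableEq V] (w : FreeSemigroup A) :
    Formula A V → (V → Fin (letters w).length) → Prop
  | falsum, _ => False
  | atom t, ν => t.Sat w ν
  | neg φ, ν => ¬ φ.Sat w ν
  | and φ ψ, ν => φ.Sat w ν ∧ ψ.Sat w ν
  | or φ ψ, ν => φ.Sat w ν ∨ ψ.Sat w ν
  | ex x φ, ν => ∃ i, φ.Sat w (Function.update ν x i)
  | all x φ, ν => ∀ i, φ.Sat w (Function.update ν x i)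

/-- The language defined by a sentence (whose truth does not depend on the valuation). -/
def language [DecidableEq V] (φ : Formula A V) : Set (FreeSemigroup A) :=
  {w | ∀ ν, φ.Sat w ν}

end Formula

/-! ## The logical fragments -/

/-- The fragments `FO(=)`, `FO²(<)`, `Σₙ(<)` and `BΣₙ(<)` (with `n ≥ 1`). -/
inductive Fragment : Type
  | foEq : Fragment
  | fo2 : Fragment
  | sigma (n : ℕ) (hn : 1 ≤ n) : Fragment
  | bsigma (n : ℕ) (hn : 1 ≤ n) : Fragment

/-- The class of languages over `A` that are definable in the fragment `F` (if `enriched = false`)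
or in its enrichment `F⁺` with `+1`, `min` and `max` (if `enriched = true`). The fragment
`FO²(<)` uses the two variables of `Fin 2`, the other ones use countably many variables. -/
def Fragment.definable (F : Fragment) (enriched : Bool) (A : Type u) :
    Set (Set (FreeSemigroup A)) :=
  match F with
  | .foEq => {K | ∃ φ : Formula A ℕ,
      φ.IsSentence ∧ φ.InSignature false enriched ∧ K = φ.language}
  | .fo2 => {K | ∃ φ : Formula A (Fin 2),
      φ.IsSentence ∧ φ.InSignature true enriched ∧ K = φ.language}
  | .sigma n _ => {K | ∃ φ : Formula A ℕ,
      φ.IsSentence ∧ φ.InSignature true enriched ∧ φ.IsSigma n ∧ K = φ.language}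
  | .bsigma n _ => {K | ∃ φ : Formula A ℕ,
      φ.IsSentence ∧ φ.InSignature true enriched ∧ φ.IsBSigma n ∧ K = φ.language}

/-! ## Separation and recognition -/

/-- `L` is `C`-separable from `L'`: some `K` in the class `C` contains `L` and avoids `L'`. -/
def Separable {W : Type u} (C : Set (Set W)) (L L' : Set W) : Prop :=
  ∃ K ∈ C, L ⊆ K ∧ K ∩ L' = ∅

/-- `L` is recognized by the morphism `α`. -/
def Recognizes {A : Type u} {S : Type v} [Semigroup S] (α : FreeSemigroup A →ₙ* S)
    (L : Set (FreeSemigroup A)) : Prop :=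
  ∃ P : Set S, L = α ⁻¹' P

/-! ## Well-formed words -/

/-- The set `E(S)` of idempotents of `S`. -/
abbrev Idem (S : Type v) [Semigroup S] : Type v := {e : S // IsIdempotentElem e}

/-- The alphabet of well-formed words, the disjoint union of `S × E(S)`, `E(S) × S × E(S)`,
`E(S) × S` and `S`. -/
inductive WFLetter (S : Type v) [Semigroup S] : Type v
  | first (s : S) (f : Idem S) : WFLetter S
  | middle (e : Idem S) (s : S) (f : Idem S) : WFLetter S
  | last (e : Idem S) (s : S) : WFLetter S
  | single (s : S) : WFLetter S

section WellFormed

variable {S : Type v} [Semigroup S]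

/-- `WFTail f l`: the sequence `l` is of the form `(e₁,s₁,f₁) ⋯ (eₙ,sₙ,fₙ) (eₙ₊₁,sₙ₊₁)` with
`n ≥ 0`, `e₁ = f` and `eᵢ₊₁ = fᵢ` for `1 ≤ i ≤ n`. -/
def WFTail : Idem S → List (WFLetter S) → Prop
  | f, [.last e _] => e = f
  | f, .middle e _ g :: l => e = f ∧ WFTail g l
  | _, _ => False

/-- Well-formed words: the single letters of `S`, and the words
`(s₀,f₀) (e₁,s₁,f₁) ⋯ (eₙ,sₙ,fₙ) (eₙ₊₁,sₙ₊₁)` with `n ≥ 0` and `fᵢ = eᵢ₊₁` for `0 ≤ i ≤ n`. -/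
def WellFormed (w : FreeSemigroup (WFLetter S)) : Prop :=
  (∃ s, w = FreeSemigroup.of (.single s)) ∨
    ∃ s f l, letters w = .first s f :: l ∧ WFTail f l

/-- The values in `S` of the letters. -/
def WFLetter.value : WFLetter S → S
  | .first s f => s * f
  | .middle e s f => e * s * f
  | .last e s => e * s
  | .single s => s

/-- The morphism `β` from words over the alphabet of well-formed words to `S`. -/
def beta : FreeSemigroup (WFLetter S) →ₙ* S := FreeSemigroup.lift WFLetter.value

/-- The language of well-formed words associated with `L` (and `α`). -/
def assoc {A : Type u} (α : FreeSemigroup A →ₙ* S) (L : Set (FreeSemigroup A)) :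
    Set (FreeSemigroup (WFLetter S)) :=
  {w | WellFormed w ∧ beta w ∈ α '' L}

end WellFormed

/-! ## Separation as an algorithmic problem

Regular languages are given by finite automata. -/

/-- A finite nondeterministic automaton with states in `ℕ`: the list of its transitions
`(p, a, q)`, the list of its initial states and the list of its final states. -/
abbrev NFACode : Type := List (ℕ × ℕ × ℕ) × List ℕ × List ℕ

/-- The automaton over the alphabet `Fin k` that is described by a code. -/
def NFACode.toNFA (k : ℕ) (M : NFACode) : NFA (Fin k) ℕ where
  step p a := {q | (p, (a : ℕ), q) ∈ M.1}
  start := {q | q ∈ M.2.1}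
  accept := {q | q ∈ M.2.2}

/-- The language of nonempty words over the alphabet `Fin k` accepted by the automaton. -/
def NFACode.language (k : ℕ) (M : NFACode) : Set (FreeSemigroup (Fin k)) :=
  {w | letters w ∈ (M.toNFA k).accepts}

/-- An instance of the separation problem: the size `k` of an alphabet, and two automata over
the alphabet `Fin k`. -/
abbrev SepInstance : Type := ℕ × NFACode × NFACode

/-- The separation problem for the fragment `F` (if `enriched = false`) or `F⁺` (if
`enriched = true`). -/
def SepProblem (F : Fragment) (enriched : Bool) (I : SepInstance) : Prop :=
  Separable (F.definable enriched (Fin I.1)) (I.2.1.language I.1) (I.2.2.language I.1)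

end PlusOne

/-! Part (1) rests on two translations between words and well-formed words. Each is a first-order
interpretation along which definability is pulled back, fragment by fragment.

From F⁺ over `A` to F over well-formed words: fix a word `u s` of value `s` for each `s` in `S`. A
well-formed word `w` is turned into a labelled linear order, in which a letter `(e, s, f)` becomes
`ω*` copies of `u e`, then `u s`, then `ω` copies of `u f`. Consecutive letters share their
idempotent, so between their central words lie `ω + ω*` copies of one single word. In `k` rounds of
the Ehrenfeucht-Fraïssé game this order is indistinguishable from a finite word with sufficiently
many copies, and the `α`-value of that word is `beta w` because the repeated elements are idempotent
(`exists_expanded_word`). The infinite order makes `+1`, `min` and `max` superfluous over `w`: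
successive elements always stem from the same letter of `w`, and the two ends are visible from the
letters alone (`expansion_basic`). Elements are named by a position of `w` and an offset. There are
infinitely many offsets, but since the alphabet is finite a formula gives rise to only finitely many
relations, so quantifying over offsets is a finite disjunction.

From F over well-formed words to F⁺ over `A`: a word is cut after each prefix whose last `|S| + 2`
letters (or all its letters, if there are fewer) have a value `x` with `x * e = x` for some
idempotent `e`. The segments between cuts, decorated with these idempotents, form a well-formed word
of the same value (`exists_compressed_word`). By the pigeonhole principle cuts are never far apart,
so cuts and segments depend on windows of bounded length. Such windows are described with `+1`,
`min` and `max` both existentially and universally, hence without extra alternation and with two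
variables (`segmentation_basic`).

The common tool is `Interpretation.transfer`, stated for pairs of dual classes of relations
(`Logic`) so as to treat all the fragments at once; `Interpretation.exists_definable` combines it
with the games.

For part (2), part (1) is applied to the transition semigroup of the two automata. This semigroup is
not computed: its elements are represented by words of bounded length, and idempotents by `N!`-th
powers of words, where `N` bounds the size of the semigroup with a unit adjoined. An automaton over
coded letters simulates the given one and checks that codes of idempotents match. Decoding, and a
choice of one code per letter, are letter-to-letter maps, and definability in F is preserved by
inverse images under these (`separable_simulate_iff`). -/

namespace PlusOne

open Set

/-! ## Satisfaction in labelled linear orders -/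

section SatOn

universe u v w

variable {A : Type u} {V : Type v} {X : Type w} [LinearOrder X]

/-- Truth of an atomic formula in the labelled linear order induced on `s`. -/
def Atom.SatOn (l : X → A) (s : Set X) (ν : V → X) : Atom A V → Prop
  | .label a x => l (ν x) = a
  | .eq x y => ν x = ν y
  | .lt x y => ν x < ν y
  | .succ x y => ν x < ν y ∧ ∀ z ∈ s, ¬ (ν x < z ∧ z < ν y)
  | .isMin x => ∀ z ∈ s, ν x ≤ z
  | .isMax x => ∀ z ∈ s, z ≤ ν x

/-- Truth of a formula in the labelled linear order induced on `s`. -/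
def Formula.SatOn [DecidableEq V] (l : X → A) (s : Set X) : Formula A V → (V → X) → Prop
  | .falsum, _ => False
  | .atom t, ν => t.SatOn l s ν
  | .neg φ, ν => ¬ φ.SatOn l s ν
  | .and φ ψ, ν => φ.SatOn l s ν ∧ ψ.SatOn l s ν
  | .or φ ψ, ν => φ.SatOn l s ν ∨ ψ.SatOn l s ν
  | .ex x φ, ν => ∃ i ∈ s, φ.SatOn l s (Function.update ν x i)
  | .all x φ, ν => ∀ i ∈ s, φ.SatOn l s (Function.update ν x i)

theorem letters_length_pos (w : FreeSemigroup A) : 0 < (letters w).length := by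
  simp [letters]

instance (w : FreeSemigroup A) : NeZero (letters w).length := ⟨(letters_length_pos w).ne'⟩

/-- `SatOn` expresses `+1`, `min` and `max` through the order alone, so that it also makes sense in
infinite orders. On the positions of a word this agrees with arithmetic. -/
theorem Atom.sat_iff_satOn (w : FreeSemigroup A) (ν : V → Fin (letters w).length)
    (t : Atom A V) : t.Sat w ν ↔ t.SatOn (letters w).get univ ν := by
  cases t with
  | label a x => rfl
  | eq x y => rfl
  | lt x y => rfl
  | succ x y =>
    simp only [Atom.Sat, Atom.SatOn, mem_univ, true_implies]
    constructor
    · intro h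
      refine ⟨by rw [Fin.lt_def]; omega, fun z hz => ?_⟩
      simp only [Fin.lt_def] at hz; omega
    · rintro ⟨h1, h2⟩
      have := h2 ⟨ν x + 1, by have := (ν y).2; simp only [Fin.lt_def] at h1; omega⟩
      simp only [Fin.lt_def] at this h1
      omega
  | isMin x =>
    simp only [Atom.Sat, Atom.SatOn, mem_univ, true_implies]
    constructor
    · intro h z; rw [Fin.le_def]; omega
    · intro h
      have := h ⟨0, letters_length_pos w⟩
      rw [Fin.le_def] at this
      exact Nat.le_zero.1 this
  | isMax x =>
    simp only [Atom.Sat, Atom.SatOn, mem_univ, true_implies]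
    constructor
    · intro h z; rw [Fin.le_def]; omega
    · intro h
      have h0 := letters_length_pos w
      have := h ⟨(letters w).length - 1, by omega⟩
      rw [Fin.le_def] at this
      have := (ν x).2
      simp only at *
      omega

theorem Formula.sat_iff_satOn [DecidableEq V] (w : FreeSemigroup A) (φ : Formula A V)
    (ν : V → Fin (letters w).length) : φ.Sat w ν ↔ φ.SatOn (letters w).get univ ν := by
  induction φ generalizing ν with
  | falsum => rfl
  | atom t => exact t.sat_iff_satOn w ν
  | neg φ ih => simp only [Formula.Sat, Formula.SatOn, ih]
  | and φ ψ ih ih' => simp only [Formula.Sat, Formula.SatOn, ih, ih']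
  | or φ ψ ih ih' => simp only [Formula.Sat, Formula.SatOn, ih, ih']
  | ex x φ ih => simp only [Formula.Sat, Formula.SatOn, ih, mem_univ, true_and]
  | all x φ ih => simp only [Formula.Sat, Formula.SatOn, ih, mem_univ, true_implies]

theorem Atom.satOn_congr (l : X → A) (s : Set X) (t : Atom A V) {ν ν' : V → X}
    (h : ∀ x ∈ t.vars, ν x = ν' x) : t.SatOn l s ν ↔ t.SatOn l s ν' := by
  cases t <;> simp_all [Atom.SatOn, Atom.vars]

theorem Formula.satOn_congr [DecidableEq V] (l : X → A) (s : Set X) (φ : Formula A V)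
    {ν ν' : V → X} (h : ∀ x ∈ φ.freeVars, ν x = ν' x) : φ.SatOn l s ν ↔ φ.SatOn l s ν' := by
  have upd : ∀ (φ : Formula A V) (x : V) (i : X) {ν ν' : V → X},
      (∀ y ∈ φ.freeVars \ {x}, ν y = ν' y) →
      ∀ y ∈ φ.freeVars, Function.update ν x i y = Function.update ν' x i y := by
    intro φ x i ν ν' h y hy
    by_cases hyx : y = x
    · subst hyx; simp
    · simp [hyx, h y ⟨hy, hyx⟩]
  induction φ generalizing ν ν' with
  | falsum => rfl
  | atom t => exact t.satOn_congr l s h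
  | neg φ ih => simp only [Formula.SatOn, ih h]
  | and φ ψ ih ih' =>
    simp only [Formula.SatOn, ih fun x hx => h x (Or.inl hx), ih' fun x hx => h x (Or.inr hx)]
  | or φ ψ ih ih' =>
    simp only [Formula.SatOn, ih fun x hx => h x (Or.inl hx), ih' fun x hx => h x (Or.inr hx)]
  | ex x φ ih => exact exists_congr fun i => and_congr_right fun _ => ih (upd φ x i h)
  | all x φ ih => exact forall_congr' fun i => imp_congr_right fun _ => ih (upd φ x i h)

theorem Formula.IsSentence.satOn_iff [DecidableEq V] {φ : Formula A V} (hφ : φ.IsSentence)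
    (l : X → A) (s : Set X) (ν ν' : V → X) : φ.SatOn l s ν ↔ φ.SatOn l s ν' :=
  φ.satOn_congr l s fun x hx => by rw [IsSentence] at hφ; simp [hφ] at hx

theorem Formula.sat_congr [DecidableEq V] (w : FreeSemigroup A) (φ : Formula A V)
    {ν ν' : V → Fin (letters w).length} (h : ∀ x ∈ φ.freeVars, ν x = ν' x) :
    φ.Sat w ν ↔ φ.Sat w ν' := by
  rw [φ.sat_iff_satOn, φ.sat_iff_satOn, φ.satOn_congr _ _ h]

theorem Formula.IsSentence.sat_iff [DecidableEq V] {φ : Formula A V} (hφ : φ.IsSentence)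
    (w : FreeSemigroup A) (ν ν' : V → Fin (letters w).length) : φ.Sat w ν ↔ φ.Sat w ν' :=
  φ.sat_congr w fun x hx => by rw [IsSentence] at hφ; simp [hφ] at hx

theorem Formula.IsSentence.mem_language [DecidableEq V] {φ : Formula A V} (hφ : φ.IsSentence)
    {w : FreeSemigroup A} (ν : V → Fin (letters w).length) : w ∈ φ.language ↔ φ.Sat w ν :=
  ⟨fun h => h ν, fun h ν' => (hφ.sat_iff w ν ν').1 h⟩

theorem Formula.freeVars_finite (φ : Formula A V) : φ.freeVars.Finite := by
  induction φ with
  | falsum => exact finite_empty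
  | atom t => cases t <;> simp [Formula.freeVars, Atom.vars]
  | neg φ ih => exact ih
  | and φ ψ ih ih' => exact ih.union ih'
  | or φ ψ ih ih' => exact ih.union ih'
  | ex x φ ih => exact ih.sdiff
  | all x φ ih => exact ih.sdiff

/-- Existential closure of a formula, within a class closed under existential quantification. -/
theorem Formula.exists_closure [DecidableEq V] {C : Set (Formula A V)}
    (hC : ∀ φ ∈ C, ∀ x, Formula.ex x φ ∈ C) {φ : Formula A V} (hφ : φ ∈ C) :
    ∃ ψ ∈ C, ψ.IsSentence ∧ ∀ w : FreeSemigroup A, (∃ ν, ψ.Sat w ν) ↔ ∃ ν, φ.Sat w ν := by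
  induction h : φ.freeVars.ncard generalizing φ with
  | zero =>
    exact ⟨φ, hφ, (ncard_eq_zero φ.freeVars_finite).1 h, fun w => Iff.rfl⟩
  | succ n ih =>
    obtain ⟨x, hx⟩ : φ.freeVars.Nonempty := by
      rw [nonempty_iff_ne_empty]; intro h0; simp [h0] at h
    obtain ⟨ψ, h1, h2, h3⟩ := ih (hC φ hφ x) (by
      rw [Formula.freeVars, ncard_sdiff_singleton_of_mem hx, h]; rfl)
    refine ⟨ψ, h1, h2, fun w => (h3 w).trans ⟨?_, ?_⟩⟩
    · rintro ⟨ν, i, hi⟩; exact ⟨_, hi⟩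
    · rintro ⟨ν, hν⟩; exact ⟨ν, ν x, by rwa [Function.update_eq_self]⟩

end SatOn

/-! ## Renaming of variables and prenex forms -/

section Prenex

universe u v

variable {A : Type u} {V : Type v}

/-- Renaming of all the variables, free and bound, of an atomic formula. -/
def Atom.rename (σ : V → V) : Atom A V → Atom A V
  | .label a x => .label a (σ x)
  | .eq x y => .eq (σ x) (σ y)
  | .lt x y => .lt (σ x) (σ y)
  | .succ x y => .succ (σ x) (σ y)
  | .isMin x => .isMin (σ x)
  | .isMax x => .isMax (σ x)

/-- Renaming of all the variables, free and bound, of a formula. -/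
def Formula.rename (σ : V → V) : Formula A V → Formula A V
  | .falsum => .falsum
  | .atom t => .atom (t.rename σ)
  | .neg φ => .neg (φ.rename σ)
  | .and φ ψ => .and (φ.rename σ) (ψ.rename σ)
  | .or φ ψ => .or (φ.rename σ) (ψ.rename σ)
  | .ex x φ => .ex (σ x) (φ.rename σ)
  | .all x φ => .all (σ x) (φ.rename σ)

/-- Bound variables are renamed along with free ones; this is harmless because a permutation keeps
distinct variables distinct. -/
theorem Formula.sat_rename [DecidableEq V] (σ : Equiv.Perm V) (w : FreeSemigroup A)
    (φ : Formula A V) (ν : V → Fin (letters w).length) :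
    (φ.rename σ).Sat w ν ↔ φ.Sat w (ν ∘ σ) := by
  induction φ generalizing ν with
  | falsum => rfl
  | atom t => cases t <;> rfl
  | neg φ ih => simp only [Formula.rename, Formula.Sat, ih]
  | and φ ψ ih ih' => simp only [Formula.rename, Formula.Sat, ih, ih']
  | or φ ψ ih ih' => simp only [Formula.rename, Formula.Sat, ih, ih']
  | ex x φ ih =>
    simp only [Formula.rename, Formula.Sat, ih,
      Function.update_comp_eq_of_injective _ σ.injective]
  | all x φ ih =>
    simp only [Formula.rename, Formula.Sat, ih,
      Function.update_comp_eq_of_injective _ σ.injective]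

theorem Formula.rename_rename (σ τ : V → V) (φ : Formula A V) :
    (φ.rename σ).rename τ = φ.rename (τ ∘ σ) := by
  induction φ with
  | atom t => cases t <;> rfl
  | _ => simp_all [Formula.rename]

theorem Formula.rename_id (φ : Formula A V) : φ.rename id = φ := by
  induction φ with
  | atom t => cases t <;> rfl
  | _ => simp_all [Formula.rename]

theorem Formula.InSignature.rename {order en : Bool} (σ : V → V) {φ : Formula A V}
    (h : φ.InSignature order en) : (φ.rename σ).InSignature order en := by
  induction φ with
  | atom t => cases t <;> exact h
  | _ => simp_all [Formula.rename, Formula.InSignature]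

theorem Formula.IsQF.rename (σ : V → V) {φ : Formula A V} (h : φ.IsQF) : (φ.rename σ).IsQF := by
  induction φ with
  | _ => simp_all [Formula.rename, Formula.IsQF]

theorem Formula.IsPrenex.rename (σ : V → V) {b : Bool} {n : ℕ} {φ : Formula A V}
    (h : φ.IsPrenex b n) : (φ.rename σ).IsPrenex b n := by
  induction h with
  | qf h => exact .qf (h.rename σ)
  | ex _ ih => exact .ex ih
  | all _ ih => exact .all ih
  | switch _ ih => exact .switch ih

theorem Formula.sat_rename_swap [DecidableEq V] {w : FreeSemigroup A} {φ : Formula A V} {x y : V}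
    (hy : y ∉ φ.freeVars) (ν : V → Fin (letters w).length) (i : Fin (letters w).length) :
    (φ.rename (Equiv.swap x y)).Sat w (Function.update ν y i) ↔
      φ.Sat w (Function.update ν x i) := by
  rw [Formula.sat_rename]
  refine φ.sat_congr w fun z hz => ?_
  by_cases hzx : z = x
  · subst hzx; simp
  · have hzy : z ≠ y := fun h => hy (h ▸ hz)
    simp [Equiv.swap_apply_of_ne_of_ne hzx hzy, hzx, hzy]

/-- Formulas over a signature that are prenex, with `n` blocks of quantifiers. -/
def prenexClass (A : Type u) (order en : Bool) (b : Bool) (n : ℕ) : Set (Formula A ℕ) :=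
  {φ | φ.InSignature order en ∧ φ.IsPrenex b n}

/-- Equivalence to a disjunction within a class of formulas. -/
def HasOr [DecidableEq V] (C : Set (Formula A V)) (φ ψ : Formula A V) : Prop :=
  ∃ χ ∈ C, ∀ (w : FreeSemigroup A) ν, χ.Sat w ν ↔ φ.Sat w ν ∨ ψ.Sat w ν

theorem HasOr.symm [DecidableEq V] {C : Set (Formula A V)} {φ ψ : Formula A V}
    (h : HasOr C φ ψ) : HasOr C ψ φ := by
  obtain ⟨χ, h1, h2⟩ := h
  exact ⟨χ, h1, fun w ν => (h2 w ν).trans or_comm⟩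

variable {order en : Bool}

theorem prenexClass_switch {b : Bool} {n : ℕ} {φ : Formula A ℕ}
    (h : φ ∈ prenexClass A order en (!b) n) : φ ∈ prenexClass A order en b (n + 1) :=
  ⟨h.1, .switch h.2⟩

theorem exists_fresh (φ ψ : Formula A ℕ) : ∃ y, y ∉ φ.freeVars ∧ y ∉ ψ.freeVars := by
  obtain ⟨y, hy⟩ := (φ.freeVars_finite.union ψ.freeVars_finite).exists_notMem
  exact ⟨y, fun h => hy (.inl h), fun h => hy (.inr h)⟩

theorem sat_update_of_notMem [DecidableEq V] {w : FreeSemigroup A} {ψ : Formula A V} {y : V}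
    (hy : y ∉ ψ.freeVars) (ν : V → Fin (letters w).length) (i : Fin (letters w).length) :
    ψ.Sat w (Function.update ν y i) ↔ ψ.Sat w ν :=
  ψ.sat_congr w fun z hz => by
    rw [Function.update_of_ne]; rintro rfl; exact hy hz

/-- The bound variable is swapped with one that is fresh for both formulas, after which the
quantifier can be moved in front of the disjunction. The swap changes the body, whence the
hypothesis on all renamings. -/
theorem HasOr.ex {n : ℕ} {φ ψ : Formula A ℕ} (x : ℕ)
    (h : ∀ σ : Equiv.Perm ℕ, HasOr (prenexClass A order en true (n + 1)) (φ.rename σ) ψ) :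
    HasOr (prenexClass A order en true (n + 1)) (.ex x φ) ψ := by
  obtain ⟨y, hy, hy'⟩ := exists_fresh φ ψ
  obtain ⟨χ, h1, h2⟩ := h (Equiv.swap x y)
  refine ⟨.ex y χ, ⟨h1.1, .ex h1.2⟩, fun w ν => ?_⟩
  simp only [Formula.Sat, h2, Formula.sat_rename_swap hy, sat_update_of_notMem hy']
  rw [exists_or]
  -- The second disjunct does not depend on the quantified position, and a word has at least one
  -- position.
  exact or_congr_right ⟨fun ⟨_, h⟩ => h, fun h => ⟨0, h⟩⟩

theorem HasOr.all {n : ℕ} {φ ψ : Formula A ℕ} (x : ℕ)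
    (h : ∀ σ : Equiv.Perm ℕ, HasOr (prenexClass A order en false (n + 1)) (φ.rename σ) ψ) :
    HasOr (prenexClass A order en false (n + 1)) (.all x φ) ψ := by
  obtain ⟨y, hy, hy'⟩ := exists_fresh φ ψ
  obtain ⟨χ, h1, h2⟩ := h (Equiv.swap x y)
  refine ⟨.all y χ, ⟨h1.1, .all h1.2⟩, fun w ν => ?_⟩
  simp only [Formula.Sat, h2, Formula.sat_rename_swap hy, sat_update_of_notMem hy']
  rw [forall_or_right]

theorem HasOr.switch {b : Bool} {n : ℕ} {φ ψ : Formula A ℕ}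
    (h : HasOr (prenexClass A order en (!b) n) φ ψ) :
    HasOr (prenexClass A order en b (n + 1)) φ ψ := by
  obtain ⟨χ, h1, h2⟩ := h
  exact ⟨χ, prenexClass_switch h1, h2⟩

theorem Formula.rename_perm_rename (σ τ : Equiv.Perm V) (φ : Formula A V) :
    (φ.rename σ).rename τ = φ.rename (σ.trans τ) := by
  rw [rename_rename]; rfl

theorem hasOr_of_qf {b : Bool} {n : ℕ} {φ ψ : Formula A ℕ} (hφ : φ.InSignature order en)
    (hφ' : φ.IsQF) (hψ : ψ.InSignature order en) (hψ' : ψ.IsPrenex b n) :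
    HasOr (prenexClass A order en b n) φ ψ := by
  -- Closing the claim under renamings of `ψ` makes the induction on its prefix compatible with
  -- `HasOr.ex` and `HasOr.all`.
  suffices h : ∀ σ : Equiv.Perm ℕ, HasOr (prenexClass A order en b n) (ψ.rename σ) φ by
    have := h 1
    rw [show ((1 : Equiv.Perm ℕ) : ℕ → ℕ) = id from rfl, Formula.rename_id] at this
    exact this.symm
  induction hψ' with
  | qf h =>
    exact fun σ => ⟨.or (Formula.rename σ _) φ, ⟨⟨hψ.rename σ, hφ⟩, .qf ⟨h.rename σ, hφ'⟩⟩,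
      fun w ν => Iff.rfl⟩
  | ex _ ih =>
    exact fun σ => HasOr.ex _ fun τ => by rw [Formula.rename_perm_rename]; exact ih hψ _
  | all _ ih =>
    exact fun σ => HasOr.all _ fun τ => by rw [Formula.rename_perm_rename]; exact ih hψ _
  | switch _ ih => exact fun σ => (ih hψ σ).switch

/-- The leading block of `ψ` is pulled out until what remains lies in the dual class with one block
less, where `h` applies. -/
theorem hasOr_succ {b : Bool} {n : ℕ} {φ ψ : Formula A ℕ}
    (h : ∀ ψ ∈ prenexClass A order en (!b) n, HasOr (prenexClass A order en (!b) n) φ ψ)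
    (hψ : ψ.InSignature order en) (hψ' : ψ.IsPrenex b (n + 1)) :
    HasOr (prenexClass A order en b (n + 1)) φ ψ := by
  suffices h : ∀ σ : Equiv.Perm ℕ, HasOr (prenexClass A order en b (n + 1)) (ψ.rename σ) φ by
    have := h 1
    rw [show ((1 : Equiv.Perm ℕ) : ℕ → ℕ) = id from rfl, Formula.rename_id] at this
    exact this.symm
  generalize hm : n + 1 = m at hψ'
  induction hψ' with
  | qf h' =>
    intro σ; subst hm
    exact (h _ ⟨hψ.rename σ, .qf (h'.rename σ)⟩).symm.switch
  | ex _ ih =>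
    intro σ; cases hm
    exact HasOr.ex _ fun τ => by rw [Formula.rename_perm_rename]; exact ih h hψ rfl _
  | all _ ih =>
    intro σ; cases hm
    exact HasOr.all _ fun τ => by rw [Formula.rename_perm_rename]; exact ih h hψ rfl _
  | switch h' _ =>
    intro σ; cases hm
    exact (h _ ⟨hψ.rename σ, h'.rename σ⟩).symm.switch

/-- The leading blocks of both formulas are extracted, and thereby merged, before descending to the
dual class. So the disjunction has no more blocks than its members. -/
theorem prenexClass_hasOr {b : Bool} {n : ℕ} {φ ψ : Formula A ℕ}
    (hφ : φ ∈ prenexClass A order en b n) (hψ : ψ ∈ prenexClass A order en b n) :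
    HasOr (prenexClass A order en b n) φ ψ := by
  obtain ⟨hφ, hφ'⟩ := hφ
  suffices h : ∀ σ : Equiv.Perm ℕ, ∀ ψ ∈ prenexClass A order en b n,
      HasOr (prenexClass A order en b n) (φ.rename σ) ψ by
    have := h 1 ψ hψ
    rwa [show ((1 : Equiv.Perm ℕ) : ℕ → ℕ) = id from rfl, Formula.rename_id] at this
  clear hψ ψ
  induction hφ' with
  | qf h => exact fun σ ψ hψ => hasOr_of_qf (hφ.rename σ) (h.rename σ) hψ.1 hψ.2
  | ex _ ih =>
    exact fun σ ψ hψ => HasOr.ex _ fun τ => by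
      rw [Formula.rename_perm_rename]; exact ih hφ _ ψ hψ
  | all _ ih =>
    exact fun σ ψ hψ => HasOr.all _ fun τ => by
      rw [Formula.rename_perm_rename]; exact ih hφ _ ψ hψ
  | switch _ ih =>
    exact fun σ ψ hψ => hasOr_succ (ih hφ σ) hψ.1 hψ.2

theorem prenexClass_neg {b : Bool} {n : ℕ} {φ : Formula A ℕ}
    (hφ : φ ∈ prenexClass A order en b n) :
    ∃ ψ ∈ prenexClass A order en (!b) n, ∀ (w : FreeSemigroup A) ν, ψ.Sat w ν ↔ ¬ φ.Sat w ν := by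
  obtain ⟨hφ, hφ'⟩ := hφ
  induction hφ' with
  | @qf _ _ φ h => exact ⟨.neg φ, ⟨hφ, .qf h⟩, fun w ν => Iff.rfl⟩
  | @ex _ x _ _ ih =>
    obtain ⟨ψ, h1, h2⟩ := ih hφ
    exact ⟨.all x ψ, ⟨h1.1, .all h1.2⟩, fun w ν => by simp [Formula.Sat, h2]⟩
  | @all _ x _ _ ih =>
    obtain ⟨ψ, h1, h2⟩ := ih hφ
    exact ⟨.ex x ψ, ⟨h1.1, .ex h1.2⟩, fun w ν => by simp [Formula.Sat, h2]⟩
  | switch _ ih =>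
    obtain ⟨ψ, h1, h2⟩ := ih hφ
    exact ⟨ψ, prenexClass_switch h1, h2⟩

end Prenex

end PlusOne

/-! ### Transfer of definability along interpretations with infinitely many parameters. -/

namespace PlusOne

open Set

/-! ## Classes of definable relations -/

section Logic

universe u v

variable {B : Type u} {V : Type v}

/-- Relations between a word of `Ω` and a valuation of the variables in it. -/
abbrev Rel (Ω : Set (FreeSemigroup B)) (V : Type v) : Type (max u v) :=
  ∀ w : Ω, (V → Fin (letters w.1).length) → Prop

variable {Ω : Set (FreeSemigroup B)}

/-- Existential quantification of a relation. -/
def exRel [DecidableEq V] (x : V) (R : Rel Ω V) : Rel Ω V := fun w ν => ∃ i, R w (Function.update ν x i)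

/-- The relation defined by a formula. -/
def Formula.rel [DecidableEq V] (Ω : Set (FreeSemigroup B)) (φ : Formula B V) : Rel Ω V := fun w ν => φ.Sat w.1 ν

/-- The relations definable in a class of formulas. -/
def definableRel [DecidableEq V] (Ω : Set (FreeSemigroup B)) (C : Set (Formula B V)) : Set (Rel Ω V) :=
  {R | ∃ φ ∈ C, φ.rel Ω = R}

/-- A pair of dual classes of relations that contain the atomic ones and are closed under finite
Boolean operations, the class `D true` being also closed under existential quantification. -/
structure Logic [DecidableEq V] (order en : Bool) (D : Bool → Set (Rel Ω V)) : Prop where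
  atom : ∀ b (t : Atom B V), t.InSignature order en → (Formula.atom t).rel Ω ∈ D b
  bot : ∀ b, ⊥ ∈ D b
  sup : ∀ {b R R'}, R ∈ D b → R' ∈ D b → R ⊔ R' ∈ D b
  compl : ∀ {b R}, R ∈ D b → Rᶜ ∈ D (!b)
  ex : ∀ {R} x, R ∈ D true → exRel x R ∈ D true

namespace Logic

variable [DecidableEq V] {order en : Bool} {D : Bool → Set (Rel Ω V)}

theorem compl' (hD : Logic order en D) {b : Bool} {R : Rel Ω V} (h : R ∈ D (!b)) : Rᶜ ∈ D b := by
  have := hD.compl h; rwa [Bool.not_not] at this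

theorem inf (hD : Logic order en D) {b : Bool} {R R' : Rel Ω V} (h : R ∈ D b) (h' : R' ∈ D b) :
    R ⊓ R' ∈ D b := by
  rw [show R ⊓ R' = (Rᶜ ⊔ R'ᶜ)ᶜ by simp]
  exact hD.compl' (hD.sup (hD.compl h) (hD.compl h'))

theorem top (hD : Logic order en D) (b : Bool) : ⊤ ∈ D b := by
  rw [← compl_bot]; exact hD.compl' (hD.bot _)

theorem sSup (hD : Logic order en D) {b : Bool} {Q : Set (Rel Ω V)} (hQ : Q.Finite)
    (h : Q ⊆ D b) : sSup Q ∈ D b := by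
  induction Q, hQ using Set.Finite.induction_on with
  | empty => rw [sSup_empty]; exact hD.bot b
  | insert _ _ ih =>
    rw [sSup_insert]
    exact hD.sup (h (mem_insert _ _)) (ih fun x hx => h (mem_insert_of_mem _ hx))

theorem iSup (hD : Logic order en D) {ι : Type*} [Finite ι] {b : Bool} {F : ι → Rel Ω V}
    (h : ∀ i, F i ∈ D b) : iSup F ∈ D b :=
  hD.sSup (finite_range F) (range_subset_iff.2 h)

end Logic

/-- Without a restriction on the quantifier prefix the two dual classes coincide. This covers both
`FO(=)` and `FO²(<)`. -/
theorem logic_fo [DecidableEq V] (Ω : Set (FreeSemigroup B)) (order en : Bool) :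
    Logic order en fun _ => definableRel Ω {φ : Formula B V | φ.InSignature order en} where
  atom _ t ht := ⟨.atom t, ht, rfl⟩
  bot _ := ⟨.falsum, trivial, rfl⟩
  sup := by
    rintro - - - ⟨φ, h, rfl⟩ ⟨ψ, h', rfl⟩
    exact ⟨.or φ ψ, ⟨h, h'⟩, rfl⟩
  compl := by
    rintro - - ⟨φ, h, rfl⟩
    exact ⟨.neg φ, h, rfl⟩
  ex := by
    rintro - x ⟨φ, h, rfl⟩
    exact ⟨.ex x φ, h, rfl⟩

/-- Up to equivalence, `D true` is `Σₙ` and `D false` is `Πₙ`. The bound `1 ≤ n` leaves room for the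
block in which an existential quantifier is absorbed. -/
theorem logic_prenex (Ω : Set (FreeSemigroup B)) (order en : Bool) {n : ℕ} (hn : 1 ≤ n) :
    Logic order en fun b => definableRel Ω (prenexClass B order en b n) where
  atom _ t ht := ⟨.atom t, ⟨ht, .qf trivial⟩, rfl⟩
  bot _ := ⟨.falsum, ⟨trivial, .qf trivial⟩, rfl⟩
  sup := by
    rintro b - - ⟨φ, h, rfl⟩ ⟨ψ, h', rfl⟩
    obtain ⟨χ, h1, h2⟩ := prenexClass_hasOr h h'
    exact ⟨χ, h1, by ext w ν; exact h2 w.1 ν⟩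
  compl := by
    rintro b - ⟨φ, h, rfl⟩
    obtain ⟨χ, h1, h2⟩ := prenexClass_neg h
    exact ⟨χ, h1, by ext w ν; exact h2 w.1 ν⟩
  ex := by
    rintro - x ⟨φ, h, rfl⟩
    obtain ⟨n, rfl⟩ : ∃ m, n = m + 1 := ⟨n - 1, by omega⟩
    exact ⟨.ex x φ, ⟨h.1, .ex h.2⟩, rfl⟩

theorem definableRel_prenex_switch {order en b : Bool} {n : ℕ} {R : Rel Ω ℕ}
    (h : R ∈ definableRel Ω (prenexClass B order en (!b) n)) :
    R ∈ definableRel Ω (prenexClass B order en b (n + 1)) := by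
  obtain ⟨φ, h1, h2⟩ := h
  exact ⟨φ, prenexClass_switch h1, h2⟩

/-! ## Families with finitely many members -/

/-- A family of relations in `D` that takes finitely many values. -/
def FinFamily (D : Set (Rel Ω V)) {ι : Type*} (F : ι → Rel Ω V) : Prop :=
  (range F).Finite ∧ ∀ i, F i ∈ D

namespace FinFamily

variable {ι : Type*} {order en : Bool} {D : Bool → Set (Rel Ω V)}

theorem mono {D D' : Set (Rel Ω V)} (h : D ⊆ D') {F : ι → Rel Ω V} (hF : FinFamily D F) :
    FinFamily D' F :=
  ⟨hF.1, fun i => h (hF.2 i)⟩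

theorem comp {D : Set (Rel Ω V)} {κ : Type*} (g : κ → ι) {F : ι → Rel Ω V} (hF : FinFamily D F) :
    FinFamily D (F ∘ g) :=
  ⟨hF.1.subset (range_comp_subset_range g F), fun i => hF.2 (g i)⟩

theorem compl [DecidableEq V] (hD : Logic order en D) {b : Bool} {F : ι → Rel Ω V} (hF : FinFamily (D b) F) :
    FinFamily (D (!b)) fun i => (F i)ᶜ := by
  refine ⟨?_, fun i => hD.compl (hF.2 i)⟩
  rw [show (fun i => (F i)ᶜ) = (fun R => Rᶜ) ∘ F from rfl, range_comp]
  exact hF.1.image _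

theorem sup [DecidableEq V] (hD : Logic order en D) {b : Bool} {F G : ι → Rel Ω V} (hF : FinFamily (D b) F)
    (hG : FinFamily (D b) G) : FinFamily (D b) fun i => F i ⊔ G i := by
  refine ⟨(hF.1.image2 (· ⊔ ·) hG.1).subset ?_, fun i => hD.sup (hF.2 i) (hG.2 i)⟩
  rintro - ⟨i, rfl⟩
  exact ⟨_, ⟨i, rfl⟩, _, ⟨i, rfl⟩, rfl⟩

theorem inf [DecidableEq V] (hD : Logic order en D) {b : Bool} {F G : ι → Rel Ω V} (hF : FinFamily (D b) F)
    (hG : FinFamily (D b) G) : FinFamily (D b) fun i => F i ⊓ G i := by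
  refine ⟨(hF.1.image2 (· ⊓ ·) hG.1).subset ?_, fun i => hD.inf (hF.2 i) (hG.2 i)⟩
  rintro - ⟨i, rfl⟩
  exact ⟨_, ⟨i, rfl⟩, _, ⟨i, rfl⟩, rfl⟩

/-- The supremum may run over infinitely many parameters, but it only depends on the set of values
taken. This is a subset of one fixed finite set, and there are finitely many such subsets. -/
theorem ex_iSup [DecidableEq V] (hD : Logic order en D) {P : Type*} {F : ι → P → Rel Ω V} (x : V)
    (hF : FinFamily (D true) fun i : ι × P => F i.1 i.2) :
    FinFamily (D true) fun i => exRel x (⨆ p, F i p) := by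
  have hsub : ∀ i, range (F i) ⊆ range fun i : ι × P => F i.1 i.2 := by
    rintro i - ⟨p, rfl⟩
    exact ⟨(i, p), rfl⟩
  refine ⟨(hF.1.finite_subsets.image fun Q => exRel x (sSup Q)).subset ?_, fun i => ?_⟩
  · rintro - ⟨i, rfl⟩
    exact ⟨range (F i), hsub i, rfl⟩
  · exact hD.ex x (hD.sSup (hF.1.subset (hsub i)) (range_subset_iff.2 fun p => hF.2 (i, p)))

theorem const {D : Set (Rel Ω V)} {R : Rel Ω V} (h : R ∈ D) : FinFamily D fun _ : ι => R :=
  ⟨(finite_singleton R).subset (by rintro - ⟨i, rfl⟩; rfl), fun _ => h⟩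

end FinFamily

end Logic

/-! ## Interpretations -/

section Interpretation

universe u v w

variable {B : Type u} {A : Type v} {X : Type w} [LinearOrder X] {P : Type}

/-- An interpretation assigns to each word `w` of `Ω` a labelled linear order, whose elements are
named by the pairs of a position of `w` and a parameter that satisfy a guard. -/
structure Interpretation (Ω : Set (FreeSemigroup B)) (A : Type v) (X : Type w)
    [LinearOrder X] (P : Type) where
  /-- The labelling. -/
  label : Ω → X → A
  /-- The set of positions. -/
  carrier : Ω → Set X
  /-- The element named by a position and a parameter. -/
  point : ℕ → P → X
  /-- The guard. -/
  guard : ∀ w : Ω, Fin (letters w.1).length → P → Prop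
  mem_carrier : ∀ w x, x ∈ carrier w ↔ ∃ i p, guard w i p ∧ point i p = x

namespace Interpretation

variable {Ω : Set (FreeSemigroup B)} (I : Interpretation Ω A X P) {V : Type}

/-- The relation on valuations defined by a formula through an interpretation. -/
def rel [DecidableEq V] (φ : Formula A V) (o : V → P) : Rel Ω V :=
  fun w ν => φ.SatOn (I.label w) (I.carrier w) fun x => I.point (ν x) (o x)

/-- The guard, as a relation on valuations. -/
def guardRel (x : V) (p : P) : Rel Ω V := fun w ν => I.guard w (ν x) p

variable [DecidableEq V]

/-- Choosing an element of the interpreted order amounts to choosing a position of the word and a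
parameter that satisfies the guard. The choice of the parameter becomes a disjunction. -/
theorem rel_ex (φ : Formula A V) (x : V) :
    I.rel (.ex x φ) = fun o => exRel x (⨆ p, I.guardRel x p ⊓ I.rel φ (Function.update o x p)) := by
  have key : ∀ (o : V → P) (w : Ω) (ν : V → Fin (letters w.1).length)
      (i : Fin (letters w.1).length) (p : P),
      (fun y => I.point (Function.update ν x i y) (Function.update o x p y)) =
        Function.update (fun y => I.point (ν y) (o y)) x (I.point i p) := by
    intro o w ν i p
    funext y
    by_cases h : y = x
    · subst h; simp
    · simp [h]
  funext o w ν
  simp only [rel, exRel, guardRel, Formula.SatOn, I.mem_carrier, iSup_apply, iSup_Prop_eq,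
    Pi.inf_apply, inf_Prop_eq, key, Function.update_self, eq_iff_iff]
  constructor
  · rintro ⟨-, ⟨i, p, h, rfl⟩, h'⟩
    exact ⟨i, p, h, h'⟩
  · rintro ⟨i, p, h, h'⟩
    exact ⟨_, ⟨i, p, h, rfl⟩, h'⟩

theorem rel_all (φ : Formula A V) (x : V) :
    I.rel (.all x φ) = fun o => (I.rel (.ex x (.neg φ)) o)ᶜ := by
  funext o w ν
  simp [rel, Formula.SatOn]

theorem finFamily_ex {order en : Bool} {D : Bool → Set (Rel Ω V)} (hD : Logic order en D)
    {x : V} (hG : FinFamily (D true) (I.guardRel x)) {φ : Formula A V}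
    (h : FinFamily (D true) (I.rel φ)) : FinFamily (D true) (I.rel (.ex x φ)) := by
  rw [rel_ex]
  exact FinFamily.ex_iSup hD x
    ((hG.comp Prod.snd).inf hD (h.comp fun i : (V → P) × P =>
      Function.update i.1 x i.2))

theorem finFamily_all {order en : Bool} {D : Bool → Set (Rel Ω V)} (hD : Logic order en D)
    {x : V} (hG : FinFamily (D true) (I.guardRel x)) {φ : Formula A V}
    (h : FinFamily (D false) (I.rel φ)) : FinFamily (D false) (I.rel (.all x φ)) := by
  rw [rel_all]
  exact (I.finFamily_ex hD (φ := .neg φ) hG (h.compl hD)).compl hD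

/-- The atomic formulas of a signature and the guard of the interpretation are finite families in
the given classes. -/
structure Basic (order en : Bool) (D : Bool → Set (Rel Ω V)) : Prop where
  guard : ∀ b x, FinFamily (D b) (I.guardRel x)
  atom : ∀ b (t : Atom A V), t.InSignature order en → FinFamily (D b) (I.rel (.atom t))

variable {I}

/-- A single class can absorb both kinds of quantifiers only if it is closed under complement, that
is, if the dual classes coincide; otherwise the formula must be quantifier-free. -/
theorem Basic.finFamily {order en en' : Bool} {D : Bool → Set (Rel Ω V)}
    (hI : I.Basic order en D) (hD : Logic order en' D) (φ : Formula A V)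
    (hφ : φ.InSignature order en) (h : φ.IsQF ∨ D true = D false) (b : Bool) :
    FinFamily (D b) (I.rel φ) := by
  induction φ generalizing b with
  | falsum => exact FinFamily.const (R := ⊥) (hD.bot b)
  | atom t => exact hI.atom b t hφ
  | neg φ ih => have := (ih hφ h (!b)).compl hD; rwa [Bool.not_not] at this
  | and φ ψ ih ih' =>
    exact (ih hφ.1 (h.imp_left And.left) b).inf hD (ih' hφ.2 (h.imp_left And.right) b)
  | or φ ψ ih ih' =>
    exact (ih hφ.1 (h.imp_left And.left) b).sup hD (ih' hφ.2 (h.imp_left And.right) b)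
  | ex x φ ih =>
    have h' := h.resolve_left id
    have := I.finFamily_ex hD (hI.guard true x) (ih hφ (.inr h') true)
    cases b
    · rwa [← h']
    · exact this
  | all x φ ih =>
    have h' := h.resolve_left id
    have := I.finFamily_all hD (hI.guard true x) (ih hφ (.inr h') false)
    cases b
    · exact this
    · rwa [h']

/-- The quantifier prefix keeps its shape: each quantifier over elements becomes one over positions,
and the finite disjunctions over parameters are absorbed by the class. -/
theorem finFamily_prenex {I : Interpretation Ω A X P} {order en en' : Bool}
    (hI : ∀ n, 1 ≤ n → I.Basic order en fun b => definableRel Ω (prenexClass B order en' b n))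
    {b : Bool} {n : ℕ} (hn : 1 ≤ n) {φ : Formula A ℕ} (hφ : φ.InSignature order en)
    (hφ' : φ.IsPrenex b n) :
    FinFamily (definableRel Ω (prenexClass B order en' b n)) (I.rel φ) := by
  induction hφ' with
  | @qf b n φ h => exact (hI n hn).finFamily (logic_prenex Ω order en' hn) φ hφ (.inl h) b
  | ex _ ih => exact I.finFamily_ex (logic_prenex Ω order en' hn) ((hI _ hn).guard true _) (ih hn hφ)
  | all _ ih =>
    exact I.finFamily_all (logic_prenex Ω order en' hn) ((hI _ hn).guard true _) (ih hn hφ)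
  | @switch b n φ h ih =>
    rcases Nat.eq_zero_or_pos n with rfl | hn'
    -- With no block left after the switch there is no quantifier at all, so the quantifier-free
    -- case at level one applies.
    · have hq : φ.IsQF := by
        generalize hm : 0 = m at h
        generalize (!b) = c at h
        clear ih
        cases h <;> first | assumption | cases hm
      exact (hI 1 le_rfl).finFamily (logic_prenex Ω order en' le_rfl) φ hφ (.inl hq) b
    · exact (ih hn' hφ).mono fun _ => definableRel_prenex_switch

end Interpretation

/-- A sentence that defines the words of `Ω` on which a relation independent of the valuation
holds. -/
theorem exists_sentence {V : Type} [DecidableEq V] {Ω : Set (FreeSemigroup B)}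
    {C : Set (Formula B V)} (hC : ∀ φ ∈ C, ∀ x, Formula.ex x φ ∈ C) {R : Rel Ω V}
    (hR : R ∈ definableRel Ω C) (Q : Ω → Prop) (hQ : ∀ w ν, R w ν ↔ Q w) :
    ∃ ψ ∈ C, ψ.IsSentence ∧ ∀ w : Ω, w.1 ∈ ψ.language ↔ Q w := by
  obtain ⟨φ, hφ, rfl⟩ := hR
  -- The defining formula may have free variables although its truth does not depend on them; they
  -- are removed by quantifying them existentially.
  obtain ⟨ψ, h1, h2, h3⟩ := Formula.exists_closure hC hφ
  refine ⟨ψ, h1, h2, fun w => ?_⟩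
  rw [h2.mem_language fun _ => 0]
  have := h3 w.1
  constructor
  · intro h
    obtain ⟨ν, hν⟩ := this.1 ⟨_, h⟩
    exact (hQ w ν).1 hν
  · intro h
    obtain ⟨ν, hν⟩ := this.2 ⟨fun _ => 0, (hQ w _).2 h⟩
    exact (h2.sat_iff _ _ _).1 hν

/-- Truth of a sentence in the labelled linear orders of an interpretation. -/
def Interpretation.Holds {Ω : Set (FreeSemigroup B)} (I : Interpretation Ω A X P) {V : Type}
    [DecidableEq V] (φ : Formula A V) (w : Ω) : Prop :=
  ∀ ν, φ.SatOn (I.label w) (I.carrier w) ν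

theorem Interpretation.rel_iff_holds {Ω : Set (FreeSemigroup B)} (I : Interpretation Ω A X P)
    {V : Type} [DecidableEq V] {φ : Formula A V} (hφ : φ.IsSentence) (o : V → P) (w : Ω)
    (ν : V → Fin (letters w.1).length) : I.rel φ o w ν ↔ I.Holds φ w :=
  ⟨fun h _ => (hφ.satOn_iff _ _ _ _).1 h, fun h => h _⟩

/-- The interpretation preserves definability in all the fragments. -/
theorem Interpretation.transfer {Ω : Set (FreeSemigroup B)} (I : Interpretation Ω A X P)
    [Nonempty P] {en en' : Bool}
    (hI : ∀ (V : Type) [DecidableEq V] [Nontrivial V] (order : Bool) (D : Bool → Set (Rel Ω V)),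
      Logic order en' D → I.Basic order en D)
    (F : Fragment) {K : Set (FreeSemigroup A)} (hK : K ∈ F.definable en A) :
    ∃ K' ∈ F.definable en' B, ∃ (V : Type) (_ : DecidableEq V) (_ : Nonempty V)
      (φ : Formula A V), φ.IsSentence ∧ K = φ.language ∧ ∀ w : Ω, w.1 ∈ K' ↔ I.Holds φ w := by
  obtain ⟨p⟩ := ‹Nonempty P›
  have fo : ∀ (V : Type) [DecidableEq V] [Nontrivial V] (order : Bool) (φ : Formula A V),
      φ.IsSentence → φ.InSignature order en → ∃ ψ : Formula B V,
        ψ.InSignature order en' ∧ ψ.IsSentence ∧ ∀ w : Ω, w.1 ∈ ψ.language ↔ I.Holds φ w := by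
    intro V _ _ order φ hs hφ
    have hD := logic_fo (V := V) Ω order en'
    have := (hI V order _ hD).finFamily hD φ hφ (.inr rfl) true
    exact exists_sentence (fun φ h x => h) (this.2 fun _ => p) _
      fun w ν => I.rel_iff_holds hs _ w ν
  have pr : ∀ (b : Bool) (n : ℕ) (_ : 1 ≤ n) (φ : Formula A ℕ),
      φ.IsSentence → φ.InSignature true en → φ.IsPrenex b n →
        I.rel φ (fun _ => p) ∈ definableRel Ω (prenexClass B true en' b n) := by
    intro b n hn φ hs hφ hp
    exact (finFamily_prenex (fun n hn => hI ℕ true _ (logic_prenex Ω true en' hn)) hn hφ hp).2 _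
  have closed : ∀ (n : ℕ) (_ : 1 ≤ n), ∀ φ ∈ prenexClass B true en' true n, ∀ x : ℕ,
      Formula.ex x φ ∈ prenexClass B true en' true n := by
    intro n hn φ hφ x
    obtain ⟨n, rfl⟩ : ∃ m, n = m + 1 := ⟨n - 1, by omega⟩
    exact ⟨hφ.1, .ex hφ.2⟩
  cases F with
  | foEq =>
    obtain ⟨φ, hs, hφ, hK⟩ := hK
    obtain ⟨ψ, h1, h2, h3⟩ := fo ℕ false φ hs hφ
    exact ⟨_, ⟨ψ, h2, h1, rfl⟩, ℕ, inferInstance, inferInstance, φ, hs, hK, h3⟩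
  | fo2 =>
    obtain ⟨φ, hs, hφ, hK⟩ := hK
    obtain ⟨ψ, h1, h2, h3⟩ := fo (Fin 2) true φ hs hφ
    exact ⟨_, ⟨ψ, h2, h1, rfl⟩, Fin 2, inferInstance, inferInstance, φ, hs, hK, h3⟩
  | sigma n hn =>
    obtain ⟨φ, hs, hφ, hp, hK⟩ := hK
    obtain ⟨ψ, h1, h2, h3⟩ := exists_sentence (closed n hn) (pr true n hn φ hs hφ hp) _
      fun w ν => I.rel_iff_holds hs _ w ν
    exact ⟨_, ⟨ψ, h2, h1.1, h1.2, rfl⟩, ℕ, inferInstance, inferInstance, φ, hs, hK, h3⟩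
  | bsigma n hn =>
    obtain ⟨φ, hs, hφ, hp, hK⟩ := hK
    -- `BΣₙ` is not described by a prefix, so the Boolean combination is followed sentence by
    -- sentence.
    have key : ∃ ψ : Formula B ℕ, ψ.IsSentence ∧ ψ.InSignature true en' ∧ ψ.IsBSigma n ∧
        ∀ w : Ω, w.1 ∈ ψ.language ↔ I.Holds φ w := by
      clear hK
      have all_iff : ∀ {φ : Formula A ℕ} (_ : φ.IsSentence) (w : Ω) (x : X),
          φ.SatOn (I.label w) (I.carrier w) (fun _ => x) ↔ I.Holds φ w :=
        fun hφ w x => ⟨fun h ν => (hφ.satOn_iff _ _ _ _).1 h, fun h => h _⟩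
      -- `Holds` quantifies over all valuations; it commutes with negation only because there is at
      -- least one.
      have x := I.point 0 p
      induction hp with
      | @sigma φ hp =>
        obtain ⟨ψ, h1, h2, h3⟩ := exists_sentence (closed n hn) (pr true n hn φ hs hφ hp) _
          fun w ν => I.rel_iff_holds hs _ w ν
        exact ⟨ψ, h2, h1.1, .sigma h1.2, h3⟩
      | @pi φ hp =>
        -- Existential closure stays within `Σₙ` only, so a `Πₙ` sentence is treated through its
        -- complement.
        have := (logic_prenex Ω true en' hn).compl (pr false n hn φ hs hφ hp)
        obtain ⟨ψ, h1, h2, h3⟩ := exists_sentence (closed n hn) this (fun w => ¬ I.Holds φ w)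
          fun w ν => not_congr (I.rel_iff_holds hs _ w ν)
        have hn : (Formula.neg ψ).IsSentence := h2
        refine ⟨.neg ψ, h2, h1.1, .neg (.sigma h1.2), fun w => ?_⟩
        rw [← not_iff_not, ← h3, hn.mem_language fun _ => 0, h2.mem_language fun _ => 0]
        exact not_not
      | @neg φ _ ih =>
        obtain ⟨ψ, h1, h2, h3, h4⟩ := ih hs hφ
        refine ⟨.neg ψ, h1, h2, .neg h3, fun w => ?_⟩
        have hn : (Formula.neg ψ).IsSentence := h1
        have hn' : (Formula.neg φ).IsSentence := hs
        rw [hn.mem_language fun _ => 0, ← all_iff hn' w x]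
        refine not_congr ?_
        rw [← h1.mem_language, h4, all_iff (φ := φ) hs]
      | @and φ φ' _ _ ih ih' =>
        have hs' := union_empty_iff.1 hs
        obtain ⟨ψ, h1, h2, h3, h4⟩ := ih hs'.1 hφ.1
        obtain ⟨ψ', h1', h2', h3', h4'⟩ := ih' hs'.2 hφ.2
        have hn : (Formula.and ψ ψ').IsSentence := union_empty_iff.2 ⟨h1, h1'⟩
        refine ⟨.and ψ ψ', hn, ⟨h2, h2'⟩, .and h3 h3', fun w => ?_⟩
        rw [hn.mem_language fun _ => 0, ← all_iff hs w x]
        refine and_congr ?_ ?_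
        · rw [← h1.mem_language, h4, all_iff hs'.1]
        · rw [← h1'.mem_language, h4', all_iff hs'.2]
      | @or φ φ' _ _ ih ih' =>
        have hs' := union_empty_iff.1 hs
        obtain ⟨ψ, h1, h2, h3, h4⟩ := ih hs'.1 hφ.1
        obtain ⟨ψ', h1', h2', h3', h4'⟩ := ih' hs'.2 hφ.2
        have hn : (Formula.or ψ ψ').IsSentence := union_empty_iff.2 ⟨h1, h1'⟩
        refine ⟨.or ψ ψ', hn, ⟨h2, h2'⟩, .or h3 h3', fun w => ?_⟩
        rw [hn.mem_language fun _ => 0, ← all_iff hs w x]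
        refine or_congr ?_ ?_
        · rw [← h1.mem_language, h4, all_iff hs'.1]
        · rw [← h1'.mem_language, h4', all_iff hs'.2]
    obtain ⟨ψ, h1, h2, h3, h4⟩ := key
    exact ⟨_, ⟨ψ, h1, h2, h3, rfl⟩, ℕ, inferInstance, inferInstance, φ, hs, hK, h4⟩

end Interpretation

end PlusOne

/-! ### Ehrenfeucht-Fraïssé games on labelled linear orders. -/

namespace PlusOne

open Set

/-! ## Ehrenfeucht-Fraïssé equivalence of labelled linear orders -/

section Game

universe u v w x

variable {B : Type u} {X : Type v} {Y : Type w} [LinearOrder X] [LinearOrder Y]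

/-- Equivalence of the labelled linear orders induced on `s` and `t` for `k` rounds of the
Ehrenfeucht-Fraïssé game. -/
def Equivalent (l : X → B) (m : Y → B) : ℕ → Set X → Set Y → Prop
  | 0, _, _ => True
  | k + 1, s, t =>
    (∀ x ∈ s, ∃ y ∈ t, l x = m y ∧ Equivalent l m k (s ∩ Iio x) (t ∩ Iio y) ∧
      Equivalent l m k (s ∩ Ioi x) (t ∩ Ioi y)) ∧
    (∀ y ∈ t, ∃ x ∈ s, l x = m y ∧ Equivalent l m k (s ∩ Iio x) (t ∩ Iio y) ∧
      Equivalent l m k (s ∩ Ioi x) (t ∩ Ioi y))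

variable {l : X → B} {m : Y → B}

theorem Equivalent.symm {k : ℕ} {s : Set X} {t : Set Y} (h : Equivalent l m k s t) :
    Equivalent m l k t s := by
  induction k generalizing s t with
  | zero => trivial
  | succ k ih =>
    refine ⟨fun y hy => ?_, fun x hx => ?_⟩
    · obtain ⟨x, hx, h1, h2, h3⟩ := h.2 y hy
      exact ⟨x, hx, h1.symm, ih h2, ih h3⟩
    · obtain ⟨y, hy, h1, h2, h3⟩ := h.1 x hx
      exact ⟨y, hy, h1.symm, ih h2, ih h3⟩

theorem Equivalent.trans {Z : Type x} [LinearOrder Z] {n : Z → B} {k : ℕ} {s : Set X} {t : Set Y}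
    {r : Set Z} (h : Equivalent l m k s t) (h' : Equivalent m n k t r) :
    Equivalent l n k s r := by
  induction k generalizing s t r with
  | zero => trivial
  | succ k ih =>
    refine ⟨fun x hx => ?_, fun z hz => ?_⟩
    · obtain ⟨y, hy, h1, h2, h3⟩ := h.1 x hx
      obtain ⟨z, hz, h1', h2', h3'⟩ := h'.1 y hy
      exact ⟨z, hz, h1.trans h1', ih h2 h2', ih h3 h3'⟩
    · obtain ⟨y, hy, h1', h2', h3'⟩ := h'.2 z hz
      obtain ⟨x, hx, h1, h2, h3⟩ := h.2 y hy
      exact ⟨x, hx, h1.trans h1', ih h2 h2', ih h3 h3'⟩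

theorem Equivalent.of_succ {k : ℕ} {s : Set X} {t : Set Y} (h : Equivalent l m (k + 1) s t) :
    Equivalent l m k s t := by
  induction k generalizing s t with
  | zero => trivial
  | succ k ih =>
    refine ⟨fun x hx => ?_, fun y hy => ?_⟩
    · obtain ⟨y, hy, h1, h2, h3⟩ := h.1 x hx
      exact ⟨y, hy, h1, ih h2, ih h3⟩
    · obtain ⟨x, hx, h1, h2, h3⟩ := h.2 y hy
      exact ⟨x, hx, h1, ih h2, ih h3⟩

theorem Equivalent.mono {k k' : ℕ} (hk : k' ≤ k) {s : Set X} {t : Set Y}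
    (h : Equivalent l m k s t) : Equivalent l m k' s t := by
  induction hk with
  | refl => exact h
  | step _ ih => exact ih h.of_succ

theorem Equivalent.relabel {C : Type x} {k : ℕ} {s : Set X} {t : Set Y}
    (h : Equivalent l m k s t) (g : B → C) {l' : X → C} {m' : Y → C}
    (hl : ∀ x ∈ s, l' x = g (l x)) (hm : ∀ y ∈ t, m' y = g (m y)) : Equivalent l' m' k s t := by
  induction k generalizing s t with
  | zero => trivial
  | succ k ih =>
    have aux : ∀ x ∈ s, ∀ y ∈ t, (l x = m y ∧ Equivalent l m k (s ∩ Iio x) (t ∩ Iio y) ∧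
        Equivalent l m k (s ∩ Ioi x) (t ∩ Ioi y)) →
        (l' x = m' y ∧ Equivalent l' m' k (s ∩ Iio x) (t ∩ Iio y) ∧
        Equivalent l' m' k (s ∩ Ioi x) (t ∩ Ioi y)) := by
      rintro x hx y hy ⟨h1, h2, h3⟩
      exact ⟨by rw [hl x hx, hm y hy, h1], ih h2 (fun z hz => hl z hz.1) fun z hz => hm z hz.1,
        ih h3 (fun z hz => hl z hz.1) fun z hz => hm z hz.1⟩
    refine ⟨fun x hx => ?_, fun y hy => ?_⟩
    · obtain ⟨y, hy, h'⟩ := h.1 x hx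
      exact ⟨y, hy, aux x hx y hy h'⟩
    · obtain ⟨x, hx, h'⟩ := h.2 y hy
      exact ⟨x, hx, aux x hx y hy h'⟩

theorem inter_Iio_union_left {s s' : Set X} (h : ∀ x ∈ s, ∀ y ∈ s', x < y) {x : X} (hx : x ∈ s) :
    (s ∪ s') ∩ Iio x = s ∩ Iio x := by
  ext z
  constructor
  · rintro ⟨h1 | h1, h2⟩
    · exact ⟨h1, h2⟩
    · exact absurd h2 (h x hx z h1).not_gt
  · exact fun hz => ⟨.inl hz.1, hz.2⟩

theorem inter_Ioi_union_left {s s' : Set X} (h : ∀ x ∈ s, ∀ y ∈ s', x < y) {x : X} (hx : x ∈ s) :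
    (s ∪ s') ∩ Ioi x = (s ∩ Ioi x) ∪ s' := by
  ext z
  constructor
  · rintro ⟨h1 | h1, h2⟩
    · exact .inl ⟨h1, h2⟩
    · exact .inr h1
  · rintro (hz | hz)
    · exact ⟨.inl hz.1, hz.2⟩
    · exact ⟨.inr hz, h x hx z hz⟩

theorem inter_Ioi_union_right {s s' : Set X} (h : ∀ x ∈ s, ∀ y ∈ s', x < y) {x : X} (hx : x ∈ s') :
    (s ∪ s') ∩ Ioi x = s' ∩ Ioi x := by
  ext z
  constructor
  · rintro ⟨h1 | h1, h2⟩
    · exact absurd h2 (h z h1 x hx).not_gt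
    · exact ⟨h1, h2⟩
  · exact fun hz => ⟨.inr hz.1, hz.2⟩

theorem inter_Iio_union_right {s s' : Set X} (h : ∀ x ∈ s, ∀ y ∈ s', x < y) {x : X} (hx : x ∈ s') :
    (s ∪ s') ∩ Iio x = s ∪ (s' ∩ Iio x) := by
  ext z
  constructor
  · rintro ⟨h1 | h1, h2⟩
    · exact .inl h1
    · exact .inr ⟨h1, h2⟩
  · rintro (hz | hz)
    · exact ⟨.inl hz, h z hz x hx⟩
    · exact ⟨.inr hz.1, hz.2⟩

/-- Each move is answered in the part where it was made; the untouched part merely loses a round,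
which `of_succ` permits. -/
theorem Equivalent.append {k : ℕ} {s s' : Set X} {t t' : Set Y} (h : Equivalent l m k s t)
    (h' : Equivalent l m k s' t') (hs : ∀ x ∈ s, ∀ y ∈ s', x < y)
    (ht : ∀ x ∈ t, ∀ y ∈ t', x < y) : Equivalent l m k (s ∪ s') (t ∪ t') := by
  induction k generalizing s s' t t' with
  | zero => trivial
  | succ k ih =>
    have left : ∀ x ∈ s, ∀ y ∈ t, (l x = m y ∧ Equivalent l m k (s ∩ Iio x) (t ∩ Iio y) ∧
        Equivalent l m k (s ∩ Ioi x) (t ∩ Ioi y)) →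
        (l x = m y ∧ Equivalent l m k ((s ∪ s') ∩ Iio x) ((t ∪ t') ∩ Iio y) ∧
        Equivalent l m k ((s ∪ s') ∩ Ioi x) ((t ∪ t') ∩ Ioi y)) := by
      rintro x hx y hy ⟨h1, h2, h3⟩
      rw [inter_Iio_union_left hs hx, inter_Iio_union_left ht hy, inter_Ioi_union_left hs hx,
        inter_Ioi_union_left ht hy]
      exact ⟨h1, h2, ih h3 h'.of_succ (fun x hx => hs x hx.1) fun x hx => ht x hx.1⟩
    have right : ∀ x ∈ s', ∀ y ∈ t', (l x = m y ∧ Equivalent l m k (s' ∩ Iio x) (t' ∩ Iio y) ∧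
        Equivalent l m k (s' ∩ Ioi x) (t' ∩ Ioi y)) →
        (l x = m y ∧ Equivalent l m k ((s ∪ s') ∩ Iio x) ((t ∪ t') ∩ Iio y) ∧
        Equivalent l m k ((s ∪ s') ∩ Ioi x) ((t ∪ t') ∩ Ioi y)) := by
      rintro x hx y hy ⟨h1, h2, h3⟩
      rw [inter_Iio_union_right hs hx, inter_Iio_union_right ht hy, inter_Ioi_union_right hs hx,
        inter_Ioi_union_right ht hy]
      exact ⟨h1, ih h.of_succ h2 (fun x hx y hy => hs x hx y hy.1)
        fun x hx y hy => ht x hx y hy.1, h3⟩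
    constructor
    · rintro x (hx | hx)
      · obtain ⟨y, hy, h0⟩ := h.1 x hx
        exact ⟨y, .inl hy, left x hx y hy h0⟩
      · obtain ⟨y, hy, h0⟩ := h'.1 x hx
        exact ⟨y, .inr hy, right x hx y hy h0⟩
    · rintro y (hy | hy)
      · obtain ⟨x, hx, h0⟩ := h.2 y hy
        exact ⟨x, .inl hx, left x hx y hy h0⟩
      · obtain ⟨x, hx, h0⟩ := h'.2 y hy
        exact ⟨x, .inr hx, right x hx y hy h0⟩

theorem Equivalent.empty (k : ℕ) : Equivalent l m k ∅ ∅ := by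
  cases k with
  | zero => trivial
  | succ k => exact ⟨fun x hx => hx.elim, fun x hx => hx.elim⟩

theorem Equivalent.singleton (k : ℕ) {x : X} {y : Y} (h : l x = m y) :
    Equivalent l m k {x} {y} := by
  cases k with
  | zero => trivial
  | succ k =>
    have : l x = m y ∧ Equivalent l m k ({x} ∩ Iio x) ({y} ∩ Iio y) ∧
        Equivalent l m k ({x} ∩ Ioi x) ({y} ∩ Ioi y) := by
      simp only [singleton_inter_eq_empty.2 self_notMem_Iio,
        singleton_inter_eq_empty.2 self_notMem_Ioi]
      exact ⟨h, .empty k, .empty k⟩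
    exact ⟨fun x' hx => ⟨y, rfl, hx ▸ this⟩, fun y' hy => ⟨x, rfl, hy ▸ this⟩⟩

theorem split_at {s : Set X} {x : X} (hx : x ∈ s) : s ∩ Iio x ∪ {x} ∪ s ∩ Ioi x = s := by
  ext z
  simp only [mem_union, mem_inter_iff, mem_Iio, mem_singleton_iff, mem_Ioi]
  rcases lt_trichotomy z x with h | rfl | h
  · simp [h, h.ne, h.not_gt]
  · simp [hx]
  · simp [h, h.ne', h.not_gt]

theorem Equivalent.glue {k : ℕ} {s : Set X} {t : Set Y} {x : X} {y : Y} (hx : x ∈ s) (hy : y ∈ t)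
    (h : l x = m y) (h1 : Equivalent l m k (s ∩ Iio x) (t ∩ Iio y))
    (h2 : Equivalent l m k (s ∩ Ioi x) (t ∩ Ioi y)) : Equivalent l m k s t := by
  rw [← split_at hx, ← split_at hy]
  refine ((h1.append (.singleton k h) ?_ ?_).append h2 ?_ ?_)
  · rintro z hz _ rfl; exact hz.2
  · rintro z hz _ rfl; exact hz.2
  · rintro z (hz | rfl) z' hz'
    · exact lt_trans hz.2 hz'.2
    · exact hz'.2
  · rintro z (hz | rfl) z' hz'
    · exact lt_trans hz.2 hz'.2
    · exact hz'.2

theorem Equivalent.of_bijOn {f : X → Y} {s : Set X} {t : Set Y} (hf : BijOn f s t)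
    (hm : StrictMonoOn f s) (hl : ∀ x ∈ s, l x = m (f x)) (k : ℕ) : Equivalent l m k s t := by
  induction k generalizing s t with
  | zero => trivial
  | succ k ih =>
    have aux : ∀ x ∈ s, l x = m (f x) ∧ Equivalent l m k (s ∩ Iio x) (t ∩ Iio (f x)) ∧
        Equivalent l m k (s ∩ Ioi x) (t ∩ Ioi (f x)) := by
      intro x hx
      refine ⟨hl x hx, ih ⟨?_, hf.injOn.mono inter_subset_left, ?_⟩ (hm.mono inter_subset_left)
        fun z hz => hl z hz.1, ih ⟨?_, hf.injOn.mono inter_subset_left, ?_⟩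
        (hm.mono inter_subset_left) fun z hz => hl z hz.1⟩
      · exact fun z hz => ⟨hf.mapsTo hz.1, hm hz.1 hx hz.2⟩
      · rintro y ⟨hy, hyx⟩
        obtain ⟨z, hz, rfl⟩ := hf.surjOn hy
        exact ⟨z, ⟨hz, (hm.lt_iff_lt hz hx).1 hyx⟩, rfl⟩
      · exact fun z hz => ⟨hf.mapsTo hz.1, hm hx hz.1 hz.2⟩
      · rintro y ⟨hy, hyx⟩
        obtain ⟨z, hz, rfl⟩ := hf.surjOn hy
        exact ⟨z, ⟨hz, (hm.lt_iff_lt hx hz).1 hyx⟩, rfl⟩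
    refine ⟨fun x hx => ⟨f x, hf.mapsTo hx, aux x hx⟩, fun y hy => ?_⟩
    obtain ⟨x, hx, rfl⟩ := hf.surjOn hy
    exact ⟨x, hx, aux x hx⟩

/-! ## Equivalence and satisfaction -/

/-- The label of a position, together with the set of variables that are mapped to it. -/
def mark {V : Type x} (l : X → B) (ν : V → X) (z : X) : B × Set V := (l z, {x | ν x = z})

variable {V : Type x}

theorem mark_eq_iff {Z : Type v} {Z' : Type w} {l : Z → B} {m : Z' → B} {ν : V → Z} {ν' : V → Z'}
    {z : Z} {z' : Z'} :
    mark l ν z = mark m ν' z' ↔ l z = m z' ∧ ∀ x, ν x = z ↔ ν' x = z' := by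
  simp [mark, Set.ext_iff]

variable {ν : V → X} {ν' : V → Y} {s : Set X} {t : Set Y}

/-- Play `ν x` and then `ν y`: as the marks record the variables, the answers can only be `ν' x` and
`ν' y`. Two rounds are spent. -/
theorem Equivalent.exists_lt {k : ℕ} (h : Equivalent (mark l ν) (mark m ν') (k + 2) s t)
    (hs : ∀ x, ν x ∈ s) {x y : V} (hxy : ν x < ν y) :
    ν' x < ν' y ∧ Equivalent (mark l ν) (mark m ν') k (s ∩ Ioo (ν x) (ν y))
      (t ∩ Ioo (ν' x) (ν' y)) := by
  obtain ⟨z, hz, h1, -, h3⟩ := h.1 _ (hs x)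
  obtain rfl := ((mark_eq_iff.1 h1).2 x).1 rfl
  obtain ⟨z', hz', h1', h2', -⟩ := h3.1 _ ⟨hs y, hxy⟩
  obtain rfl := ((mark_eq_iff.1 h1').2 y).1 rfl
  refine ⟨hz'.2, ?_⟩
  rwa [inter_assoc, inter_assoc, Ioi_inter_Iio, Ioi_inter_Iio] at h2'

theorem Equivalent.nonempty {k : ℕ} (h : Equivalent l m (k + 1) s t) (hs : s.Nonempty) :
    t.Nonempty := by
  obtain ⟨x, hx⟩ := hs
  obtain ⟨y, hy, -⟩ := h.1 x hx
  exact ⟨y, hy⟩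

/-- Three rounds suffice: two to locate `x` and `y`, and a third to see that nothing lies strictly
between them. For `isMin` and `isMax`, one round locates `x` and one more detects an element beyond
it. -/
theorem Equivalent.satOn_atom_of (h : Equivalent (mark l ν) (mark m ν') 3 s t)
    (hs : ∀ x, ν x ∈ s) (a : Atom B V) (ha : a.SatOn l s ν) :
    a.SatOn m t ν' := by
  have found : ∀ x, l (ν x) = m (ν' x) ∧ (∀ y, ν y = ν x ↔ ν' y = ν' x) ∧
      Equivalent (mark l ν) (mark m ν') 2 (s ∩ Iio (ν x)) (t ∩ Iio (ν' x)) ∧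
      Equivalent (mark l ν) (mark m ν') 2 (s ∩ Ioi (ν x)) (t ∩ Ioi (ν' x)) := by
    intro x
    obtain ⟨z, hz, h1, h2, h3⟩ := h.1 _ (hs x)
    obtain rfl := ((mark_eq_iff.1 h1).2 x).1 rfl
    exact ⟨(mark_eq_iff.1 h1).1, (mark_eq_iff.1 h1).2, h2, h3⟩
  cases a with
  | label b x => exact (found x).1.symm.trans ha
  | eq x y => exact ((found y).2.1 x).1 ha
  | lt x y => exact (h.exists_lt hs ha).1
  | succ x y =>
    obtain ⟨h1, h2⟩ := h.exists_lt hs ha.1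
    refine ⟨h1, fun z hz hz' => ?_⟩
    obtain ⟨z', hz1, hz2⟩ := h2.symm.nonempty ⟨z, hz, hz'⟩
    exact ha.2 z' hz1 hz2
  | isMin x =>
    intro z hz
    by_contra hlt
    obtain ⟨z', hz1, hz2⟩ := (found x).2.2.1.symm.nonempty ⟨z, hz, not_le.1 hlt⟩
    exact absurd (ha z' hz1) (not_le.2 hz2)
  | isMax x =>
    intro z hz
    by_contra hlt
    obtain ⟨z', hz1, hz2⟩ := (found x).2.2.2.symm.nonempty ⟨z, hz, not_le.1 hlt⟩
    exact absurd (ha z' hz1) (not_le.2 hz2)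

/-- Quantifier depth. -/
def Formula.depth {A : Type u} : Formula A V → ℕ
  | .falsum => 0
  | .atom _ => 0
  | .neg φ => φ.depth
  | .and φ ψ => max φ.depth ψ.depth
  | .or φ ψ => max φ.depth ψ.depth
  | .ex _ φ => φ.depth + 1
  | .all _ φ => φ.depth + 1

theorem mark_update_of_ne {B V Z : Type*} [DecidableEq V] {l : Z → B} {ν : V → Z} {x : V}
    {z y : Z} (hy : y ≠ z) :
    mark l (Function.update ν x z) y = ((mark l ν y).1, (mark l ν y).2 \ {x}) := by
  ext v
  · rfl
  · by_cases hv : v = x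
    · subst hv; simp [mark, hy.symm]
    · simp [mark, hv]

/-- Moving the variable `x` to `z` erases it from all marks on either side of `z`, which is a
uniform relabelling; only the marks at `z` and `z'` are compared directly. -/
theorem Equivalent.update [DecidableEq V] {k : ℕ} {z : X} {z' : Y} (hz : z ∈ s) (hz' : z' ∈ t)
    (x : V) (h : mark l ν z = mark m ν' z' ∧
      Equivalent (mark l ν) (mark m ν') k (s ∩ Iio z) (t ∩ Iio z') ∧
      Equivalent (mark l ν) (mark m ν') k (s ∩ Ioi z) (t ∩ Ioi z')) :
    Equivalent (mark l (Function.update ν x z)) (mark m (Function.update ν' x z')) k s t := by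
  obtain ⟨h1, h2, h3⟩ := h
  have off := fun {y} => mark_update_of_ne (l := l) (ν := ν) (x := x) (z := z) (y := y)
  have off' := fun {y} => mark_update_of_ne (l := m) (ν := ν') (x := x) (z := z') (y := y)
  refine Equivalent.glue hz hz' ?_ (h2.relabel (fun b => (b.1, b.2 \ {x})) ?_ ?_)
    (h3.relabel (fun b => (b.1, b.2 \ {x})) ?_ ?_)
  · rw [mark_eq_iff] at h1 ⊢
    refine ⟨h1.1, fun v => ?_⟩
    by_cases hv : v = x
    · subst hv; simp
    · simp [hv, h1.2]
  · exact fun y hy => off hy.2.ne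
  · exact fun y hy => off' hy.2.ne
  · exact fun y hy => off hy.2.ne'
  · exact fun y hy => off' hy.2.ne'

/-- Each quantifier consumes one round, and three rounds are kept in reserve for the atomic
formulas. -/
theorem Equivalent.satOn_iff_of_mark [DecidableEq V] {φ : Formula B V}
    (h : Equivalent (mark l ν) (mark m ν') (φ.depth + 3) s t)
    (hs : ∀ x, ν x ∈ s) (ht : ∀ x, ν' x ∈ t) : φ.SatOn l s ν ↔ φ.SatOn m t ν' := by
  induction φ generalizing ν ν' with
  | falsum => rfl
  | atom a => exact ⟨h.satOn_atom_of hs a, h.symm.satOn_atom_of ht a⟩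
  | neg φ ih => exact not_congr (ih h hs ht)
  | and φ ψ ih ih' =>
    exact and_congr (ih (h.mono (by simp [Formula.depth])) hs ht)
      (ih' (h.mono (by simp [Formula.depth])) hs ht)
  | or φ ψ ih ih' =>
    exact or_congr (ih (h.mono (by simp [Formula.depth])) hs ht)
      (ih' (h.mono (by simp [Formula.depth])) hs ht)
  | ex x φ ih =>
    rw [Formula.depth, Nat.add_right_comm] at h
    have key : ∀ z ∈ s, ∀ z' ∈ t, (mark l ν z = mark m ν' z' ∧
        Equivalent (mark l ν) (mark m ν') (φ.depth + 3) (s ∩ Iio z) (t ∩ Iio z') ∧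
        Equivalent (mark l ν) (mark m ν') (φ.depth + 3) (s ∩ Ioi z) (t ∩ Ioi z')) →
        (φ.SatOn l s (Function.update ν x z) ↔ φ.SatOn m t (Function.update ν' x z')) := by
      intro z hz z' hz' h'
      refine ih (Equivalent.update hz hz' x h') (fun y => ?_) fun y => ?_
      · by_cases hy : y = x
        · subst hy; simpa
        · simp [hy, hs]
      · by_cases hy : y = x
        · subst hy; simpa
        · simp [hy, ht]
    constructor
    · rintro ⟨z, hz, hφ⟩
      obtain ⟨z', hz', h'⟩ := h.1 z hz
      exact ⟨z', hz', (key z hz z' hz' h').1 hφ⟩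
    · rintro ⟨z', hz', hφ⟩
      obtain ⟨z, hz, h'⟩ := h.2 z' hz'
      exact ⟨z, hz, (key z hz z' hz' h').2 hφ⟩
  | all x φ ih =>
    rw [Formula.depth, Nat.add_right_comm] at h
    have key : ∀ z ∈ s, ∀ z' ∈ t, (mark l ν z = mark m ν' z' ∧
        Equivalent (mark l ν) (mark m ν') (φ.depth + 3) (s ∩ Iio z) (t ∩ Iio z') ∧
        Equivalent (mark l ν) (mark m ν') (φ.depth + 3) (s ∩ Ioi z) (t ∩ Ioi z')) →
        (φ.SatOn l s (Function.update ν x z) ↔ φ.SatOn m t (Function.update ν' x z')) := by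
      intro z hz z' hz' h'
      refine ih (Equivalent.update hz hz' x h') (fun y => ?_) fun y => ?_
      · by_cases hy : y = x
        · subst hy; simpa
        · simp [hy, hs]
      · by_cases hy : y = x
        · subst hy; simpa
        · simp [hy, ht]
    constructor
    · intro hφ z' hz'
      obtain ⟨z, hz, h'⟩ := h.2 z' hz'
      exact (key z hz z' hz' h').1 (hφ z hz)
    · intro hφ z hz
      obtain ⟨z', hz', h'⟩ := h.1 z hz
      exact (key z hz z' hz' h').2 (hφ z' hz')

/-- One additional round produces a pair of corresponding elements, to which all variables are sent;
for a sentence this choice of valuation is immaterial. -/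
theorem Equivalent.sentence_iff [DecidableEq V] {φ : Formula B V} (hφ : φ.IsSentence)
    (hs : s.Nonempty) (h : Equivalent l m (φ.depth + 4) s t) (μ : V → X) (μ' : V → Y) :
    φ.SatOn l s μ ↔ φ.SatOn m t μ' := by
  obtain ⟨x, hx⟩ := hs
  obtain ⟨y, hy, h1, h2, h3⟩ := h.1 x hx
  rw [hφ.satOn_iff l s μ fun _ => x, hφ.satOn_iff m t μ' fun _ => y]
  refine satOn_iff_of_mark (Equivalent.glue hx hy (mark_eq_iff.2 ⟨h1, by simp⟩)
    (h2.relabel (fun b => (b, ∅)) ?_ ?_) (h3.relabel (fun b => (b, ∅)) ?_ ?_))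
    (fun _ => hx) fun _ => hy
  · exact fun z hz => by simp [mark, hz.2.ne']
  · exact fun z hz => by simp [mark, hz.2.ne']
  · exact fun z hz => by simp [mark, hz.2.ne]
  · exact fun z hz => by simp [mark, hz.2.ne]

/-! ## Words as labelled linear orders -/

/-- The labelled linear order induced on `s` is the one of the positions of the word `w`. -/
def Spells (l : X → B) : Set X → List B → Prop
  | s, [] => s = ∅
  | s, b :: w => ∃ x ∈ s, l x = b ∧ s ∩ Iio x = ∅ ∧ Spells l (s ∩ Ioi x) w

theorem Spells.append {s s' : Set X} {w w' : List B} (h : Spells l s w) (h' : Spells l s' w')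
    (hs : ∀ x ∈ s, ∀ y ∈ s', x < y) : Spells l (s ∪ s') (w ++ w') := by
  induction w generalizing s with
  | nil => obtain rfl : s = ∅ := h; simpa
  | cons b w ih =>
    obtain ⟨x, hx, h1, h2, h3⟩ := h
    refine ⟨x, .inl hx, h1, ?_, ?_⟩
    · rw [inter_Iio_union_left hs hx, h2]
    · rw [inter_Ioi_union_left hs hx]
      exact ih h3 fun x hx => hs x hx.1

theorem Spells.singleton (x : X) : Spells l {x} [l x] :=
  ⟨x, rfl, rfl, by simp, by simp [Spells]⟩

theorem Spells.exists_fin {s : Set X} {w : List B} (h : Spells l s w) :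
    ∃ f : Fin w.length → X, StrictMono f ∧ range f = s ∧ ∀ i, w.get i = l (f i) := by
  induction w generalizing s with
  | nil =>
    obtain rfl : s = ∅ := h
    exact ⟨fun i => i.elim0, fun i => i.elim0, by ext; simp, fun i => i.elim0⟩
  | cons b w ih =>
    obtain ⟨x, hx, h1, h2, h3⟩ := h
    obtain ⟨f, hf, hr, hl⟩ := ih h3
    have hmem : ∀ i, f i ∈ s ∩ Ioi x := fun i => hr ▸ mem_range_self i
    refine ⟨Fin.cons x f, ?_, ?_, ?_⟩
    · intro i j hij
      cases i using Fin.cases with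
      | zero =>
        cases j using Fin.cases with
        | zero => exact absurd hij (lt_irrefl _)
        | succ j => simpa using (hmem j).2
      | succ i =>
        cases j using Fin.cases with
        | zero => exact absurd hij (by simp)
        | succ j => simpa using hf (Fin.succ_lt_succ_iff.1 hij)
    · erw [Fin.range_cons]
      rw [hr]
      conv_rhs => rw [← split_at hx, h2]
      rw [empty_union, insert_eq]
    · intro i
      cases i using Fin.cases with
      | zero => exact h1.symm
      | succ i => exact hl i

theorem Spells.equivalent {s : Set X} {w : List B} (h : Spells l s w) (k : ℕ) :
    Equivalent w.get l k univ s := by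
  obtain ⟨f, hf, hr, hl⟩ := h.exists_fin
  refine .of_bijOn (f := f) ⟨fun i _ => hr ▸ mem_range_self i, hf.injective.injOn, fun y hy => ?_⟩
    (hf.strictMonoOn _) (fun i _ => hl i) k
  rw [← hr] at hy
  obtain ⟨i, rfl⟩ := hy
  exact ⟨i, trivial, rfl⟩

end Game

/-- Definability of the inverse image of a definable language through an interpretation, up to
Ehrenfeucht-Fraïssé equivalence. -/
theorem Interpretation.exists_definable {B A X : Type*} [LinearOrder X]
    {Ω : Set (FreeSemigroup B)} {P : Type} (I : Interpretation Ω A X P) [Nonempty P] {en en' : Bool}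
    (hI : ∀ (V : Type) [DecidableEq V] [Nontrivial V] (order : Bool) (D : Bool → Set (Rel Ω V)),
      Logic order en' D → I.Basic order en D)
    (F : Fragment) {K : Set (FreeSemigroup A)} (hK : K ∈ F.definable en A) :
    ∃ K' ∈ F.definable en' B, ∃ k, ∀ (w : Ω) (v : FreeSemigroup A),
      Equivalent (letters v).get (I.label w) k univ (I.carrier w) → (w.1 ∈ K' ↔ v ∈ K) := by
  obtain ⟨K', h1, V, _, _, φ, hφ, rfl, h2⟩ := I.transfer hI F hK
  refine ⟨K', h1, φ.depth + 4, fun w v h => ?_⟩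
  -- From here on `K` is membership of `φ` in a finite word and `K'` is truth of `φ` in the
  -- interpreted order, so the game for `φ` compares the two.
  rw [h2, hφ.mem_language fun _ => 0, φ.sat_iff_satOn]
  have key := fun μ' => h.sentence_iff (φ := φ) hφ univ_nonempty (fun _ => 0) μ'
  obtain ⟨p⟩ := ‹Nonempty P›
  exact ⟨fun h' => (key fun _ => I.point 0 p).2 (h' _), fun h' ν => (key ν).1 h'⟩

end PlusOne

/-! ### Truncation of orders of type `ω + ω*`, and substitution of words for letters. -/

namespace PlusOne

open Set

/-! ## Orders with constant labels -/

section Tame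

universe u v w

variable {B : Type u} {X : Type v} {Y : Type w} [LinearOrder X] [LinearOrder Y]

/-- A family of sets that is closed under cutting at an element, whose nonempty members have
a least and a greatest element, and such that one side of each cut is finite. -/
structure TameFamily (T : Set (Set X)) : Prop where
  left : ∀ s ∈ T, ∀ x ∈ s, s ∩ Iio x ∈ T
  right : ∀ s ∈ T, ∀ x ∈ s, s ∩ Ioi x ∈ T
  finite : ∀ s ∈ T, ∀ x ∈ s, (s ∩ Iio x).Finite ∨ (s ∩ Ioi x).Finite
  least : ∀ s ∈ T, s.Nonempty → ∃ x, IsLeast s x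
  greatest : ∀ s ∈ T, s.Nonempty → ∃ x, IsGreatest s x

theorem encard_split {s : Set X} {x : X} (hx : x ∈ s) :
    (s ∩ Iio x).encard + 1 + (s ∩ Ioi x).encard = s.encard := by
  conv_rhs => rw [← split_at hx]
  rw [encard_union_eq, encard_union_eq, encard_singleton]
  · rw [disjoint_singleton_right]; exact fun h => lt_irrefl _ h.2
  · rw [disjoint_left]
    rintro z (hz | rfl) hz'
    · exact lt_asymm hz.2 hz'.2
    · exact lt_irrefl _ hz'.2

/-- The element is reached by removing the least element `c` times. This needs `c` to be finite, and
`exists_right` counts from the other end when the part on the right is the finite one. -/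
theorem TameFamily.exists_left {T : Set (Set X)} (hT : TameFamily T) (c : ℕ) {d : ℕ∞} {s : Set X}
    (hs : s ∈ T) (h : c + 1 + d = s.encard) :
    ∃ x ∈ s, (s ∩ Iio x).encard = c ∧ (s ∩ Ioi x).encard = d := by
  induction c generalizing s with
  | zero =>
    obtain ⟨x, hx, hx'⟩ := hT.least s hs (by
      rw [← encard_pos, ← h]; simp)
    have h0 : s ∩ Iio x = ∅ := by
      ext z; simp only [mem_inter_iff, mem_Iio, mem_empty_iff_false, iff_false]
      exact fun hz => (hx' hz.1).not_gt hz.2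
    refine ⟨x, hx, by simp [h0], ?_⟩
    have := encard_split hx
    rw [h0, encard_empty, ← h, Nat.cast_zero] at this
    exact ENat.add_right_injective_of_ne_top (by simp) this
  | succ c ih =>
    obtain ⟨x, hx, hx'⟩ := hT.least s hs (by
      rw [← encard_pos, ← h]; simp)
    have h0 : s ∩ Iio x = ∅ := by
      ext z; simp only [mem_inter_iff, mem_Iio, mem_empty_iff_false, iff_false]
      exact fun hz => (hx' hz.1).not_gt hz.2
    have := encard_split hx
    rw [h0, encard_empty, ← h, zero_add] at this
    obtain ⟨y, hy, h1, h2⟩ := ih (hT.right s hs x hx) (by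
      refine ENat.add_right_injective_of_ne_top ENat.one_ne_top ?_
      simp only [this]; push_cast; ring)
    refine ⟨y, hy.1, ?_, ?_⟩
    · have hu : s ∩ Iio y = insert x (s ∩ Ioi x ∩ Iio y) := by
        ext z
        simp only [mem_inter_iff, mem_Iio, mem_insert_iff, mem_Ioi]
        constructor
        · rintro ⟨hz, hzy⟩
          rcases (hx' hz).eq_or_lt with h | h
          · exact .inl h.symm
          · exact .inr ⟨⟨hz, h⟩, hzy⟩
        · rintro (rfl | hz)
          · exact ⟨hx, hy.2⟩
          · exact ⟨hz.1.1, hz.2⟩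
      rw [hu, encard_insert_of_notMem (fun h => lt_irrefl _ h.1.2), h1]
      push_cast; ring
    · rw [← h2, inter_assoc, Ioi_inter_Ioi, sup_eq_right.2 (le_of_lt hy.2)]

theorem TameFamily.exists_right {T : Set (Set X)} (hT : TameFamily T) {c : ℕ∞} (d : ℕ) {s : Set X}
    (hs : s ∈ T) (h : c + 1 + d = s.encard) :
    ∃ x ∈ s, (s ∩ Iio x).encard = c ∧ (s ∩ Ioi x).encard = d := by
  induction d generalizing s with
  | zero =>
    obtain ⟨x, hx, hx'⟩ := hT.greatest s hs (by
      rw [← encard_pos, ← h]; simp)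
    have h0 : s ∩ Ioi x = ∅ := by
      ext z; simp only [mem_inter_iff, mem_Ioi, mem_empty_iff_false, iff_false]
      exact fun hz => (hx' hz.1).not_gt hz.2
    refine ⟨x, hx, ?_, by simp [h0]⟩
    have := encard_split hx
    rw [h0, encard_empty, ← h, Nat.cast_zero, add_zero, add_zero] at this
    exact ENat.add_left_injective_of_ne_top ENat.one_ne_top this
  | succ d ih =>
    obtain ⟨x, hx, hx'⟩ := hT.greatest s hs (by
      rw [← encard_pos, ← h]; simp)
    have h0 : s ∩ Ioi x = ∅ := by
      ext z; simp only [mem_inter_iff, mem_Ioi, mem_empty_iff_false, iff_false]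
      exact fun hz => (hx' hz.1).not_gt hz.2
    have := encard_split hx
    rw [h0, encard_empty, ← h, add_zero] at this
    obtain ⟨y, hy, h1, h2⟩ := ih (hT.left s hs x hx) (by
      refine ENat.add_left_injective_of_ne_top ENat.one_ne_top ?_
      simp only [this]; push_cast; ring)
    refine ⟨y, hy.1, ?_, ?_⟩
    · rw [← h1, inter_assoc, Iio_inter_Iio, inf_eq_right.2 (le_of_lt hy.2)]
    · have hu : s ∩ Ioi y = insert x (s ∩ Iio x ∩ Ioi y) := by
        ext z
        simp only [mem_inter_iff, mem_Iio, mem_insert_iff, mem_Ioi]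
        constructor
        · rintro ⟨hz, hzy⟩
          rcases (hx' hz).eq_or_lt with h | h
          · exact .inl h
          · exact .inr ⟨⟨hz, h⟩, hzy⟩
        · rintro (rfl | hz)
          · exact ⟨hx, hy.2⟩
          · exact ⟨hz.1.1, hz.2⟩
      rw [hu, encard_insert_of_notMem (fun h => lt_irrefl _ h.1.2), h2]
      push_cast; ring

/-- The number of elements above which all orders with constant labels are equivalent. -/
def threshold : ℕ → ℕ
  | 0 => 0
  | k + 1 => 2 * threshold k + 1

/-- Sizes that cannot be distinguished in `k` rounds. -/
def SizeEquiv (k : ℕ) (a b : ℕ∞) : Prop := a = b ∨ (threshold k ≤ a ∧ threshold k ≤ b)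

theorem SizeEquiv.symm {k : ℕ} {a b : ℕ∞} (h : SizeEquiv k a b) : SizeEquiv k b a :=
  h.imp Eq.symm And.symm

theorem ENat.le_of_add_le {t c : ℕ} {d : ℕ∞} (h : ((2 * t + 1 : ℕ) : ℕ∞) ≤ c + 1 + d) (hc : c ≤ t) :
    (t : ℕ∞) ≤ d := by
  induction d with
  | top => exact le_top
  | coe d => norm_cast at h ⊢; omega

/-- Put `t = threshold k`. A side with fewer than `t` elements is reproduced exactly, and the other
one then keeps at least `t` elements because the total is at least `2 * t + 1`. If both sides have
at least `t` elements, exactly `t` are put on the left. One side always stays finite, so that the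
cut can be found by counting from an end. -/
theorem SizeEquiv.split {k : ℕ} {n m c d : ℕ∞} (h : SizeEquiv (k + 1) n m) (hn : c + 1 + d = n)
    (hcd : c ≠ ⊤ ∨ d ≠ ⊤) :
    ∃ c' d', c' + 1 + d' = m ∧ (c' ≠ ⊤ ∨ d' ≠ ⊤) ∧ SizeEquiv k c c' ∧ SizeEquiv k d d' := by
  rcases h with rfl | ⟨h, h'⟩
  · exact ⟨c, d, hn, hcd, .inl rfl, .inl rfl⟩
  rw [threshold] at h h'
  subst hn
  set t := threshold k with ht
  have le_m : ∀ c : ℕ, c ≤ t → ∃ d', (c : ℕ∞) + 1 + d' = m := by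
    intro c hc
    obtain ⟨d, rfl⟩ := exists_add_of_le (a := (c : ℕ∞) + 1) (b := m) (le_trans (by
      norm_cast; omega) h')
    exact ⟨d, rfl⟩
  rcases lt_or_ge c t with hc | hc
  · obtain ⟨c, rfl⟩ := ENat.ne_top_iff_exists.1 (ne_top_of_lt hc)
    have hc' : c ≤ t := by norm_cast at hc; omega
    obtain ⟨d', rfl⟩ := le_m c hc'
    exact ⟨c, d', rfl, .inl (by simp), .inl rfl,
      .inr ⟨ENat.le_of_add_le h hc', ENat.le_of_add_le h' hc'⟩⟩
  rcases lt_or_ge d t with hd | hd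
  · obtain ⟨d, rfl⟩ := ENat.ne_top_iff_exists.1 (ne_top_of_lt hd)
    have hd' : d ≤ t := by norm_cast at hd; omega
    obtain ⟨c', rfl⟩ := le_m d hd'
    refine ⟨c', d, by ring, .inr (by simp), .inr ⟨hc, ENat.le_of_add_le h' hd'⟩, .inl rfl⟩
  · obtain ⟨d', rfl⟩ := le_m t le_rfl
    exact ⟨t, d', rfl, .inl (by simp), .inr ⟨hc, le_rfl⟩, .inr ⟨hd, ENat.le_of_add_le h' le_rfl⟩⟩

theorem TameFamily.exists_cut {T : Set (Set X)} {T' : Set (Set Y)} (hT : TameFamily T)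
    (hT' : TameFamily T') {k : ℕ} {s : Set X} {t : Set Y} (hs : s ∈ T) (ht : t ∈ T')
    (h : SizeEquiv (k + 1) s.encard t.encard) {x : X} (hx : x ∈ s) :
    ∃ y ∈ t, SizeEquiv k (s ∩ Iio x).encard (t ∩ Iio y).encard ∧
      SizeEquiv k (s ∩ Ioi x).encard (t ∩ Ioi y).encard := by
  obtain ⟨c, d, h1, h2, h3, h4⟩ := h.split (encard_split hx) (by
    rw [encard_ne_top_iff, encard_ne_top_iff]; exact hT.finite s hs x hx)
  rcases h2 with h2 | h2
  · obtain ⟨c, rfl⟩ := ENat.ne_top_iff_exists.1 h2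
    obtain ⟨y, hy, h5, rfl⟩ := hT'.exists_left c ht h1
    exact ⟨y, hy, h5 ▸ h3, h4⟩
  · obtain ⟨d, rfl⟩ := ENat.ne_top_iff_exists.1 h2
    obtain ⟨y, hy, rfl, h5⟩ := hT'.exists_right d ht h1
    exact ⟨y, hy, h3, h5 ▸ h4⟩

/-- With a single label only the sizes of the two sides of a cut matter, and `exists_cut` finds a
matching cut for every move. -/
theorem TameFamily.equivalent {T : Set (Set X)} {T' : Set (Set Y)} (hT : TameFamily T)
    (hT' : TameFamily T') {l : X → B} {m : Y → B} {k : ℕ} {s : Set X} {t : Set Y} (hs : s ∈ T)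
    (ht : t ∈ T') (h : SizeEquiv k s.encard t.encard) (hl : ∀ x ∈ s, ∀ y ∈ t, l x = m y) :
    Equivalent l m k s t := by
  induction k generalizing s t with
  | zero => trivial
  | succ k ih =>
    refine ⟨fun x hx => ?_, fun y hy => ?_⟩
    · obtain ⟨y, hy, h1, h2⟩ := hT.exists_cut hT' hs ht h hx
      exact ⟨y, hy, hl x hx y hy,
        ih (hT.left s hs x hx) (hT'.left t ht y hy) h1 fun x hx y hy => hl x hx.1 y hy.1,
        ih (hT.right s hs x hx) (hT'.right t ht y hy) h2 fun x hx y hy => hl x hx.1 y hy.1⟩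
    · obtain ⟨x, hx, h1, h2⟩ := hT'.exists_cut hT ht hs h.symm hy
      exact ⟨x, hx, hl x hx y hy,
        ih (hT.left s hs x hx) (hT'.left t ht y hy) h1.symm fun x hx y hy => hl x hx.1 y hy.1,
        ih (hT.right s hs x hx) (hT'.right t ht y hy) h2.symm fun x hx y hy => hl x hx.1 y hy.1⟩

end Tame

/-! ## The order `ω + ω*` -/

section Gap

theorem lex_lt_iff {i j : ℕ} {c d : ℤ} :
    (toLex (i, c) : ℕ ×ₗ ℤ) < toLex (j, d) ↔ i < j ∨ (i = j ∧ c < d) :=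
  Prod.Lex.toLex_lt_toLex

theorem lex_le_iff {i j : ℕ} {c d : ℤ} :
    (toLex (i, c) : ℕ ×ₗ ℤ) ≤ toLex (j, d) ↔ i < j ∨ (i = j ∧ c ≤ d) :=
  Prod.Lex.toLex_le_toLex

theorem lex_eq_iff {i j : ℕ} {c d : ℤ} :
    (toLex (i, c) : ℕ ×ₗ ℤ) = toLex (j, d) ↔ i = j ∧ c = d := by
  rw [toLex_inj, Prod.mk.injEq]

theorem lex_forall {p : ℕ ×ₗ ℤ → Prop} : (∀ z, p z) ↔ ∀ i c, p (toLex (i, c)) :=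
  ⟨fun h _ _ => h _, fun h z => h (ofLex z).1 (ofLex z).2⟩

theorem exists_eq_toLex (z : ℕ ×ₗ ℤ) : ∃ i c, z = toLex (i, c) := ⟨_, _, rfl⟩

/-- An open interval of order type `ω + ω*`. -/
def gap (i : ℕ) (a b : ℤ) : Set (ℕ ×ₗ ℤ) := Ioo (toLex (i, a)) (toLex (i + 1, b))

theorem mem_gap {i j : ℕ} {a b c : ℤ} :
    toLex (j, c) ∈ gap i a b ↔ (j = i ∧ a < c) ∨ (j = i + 1 ∧ c < b) := by
  rw [gap, mem_Ioo, lex_lt_iff, lex_lt_iff]; omega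

theorem finite_of_forall_mem {s : Set (ℕ ×ₗ ℤ)} {n : ℕ} {a b : ℤ}
    (h : ∀ i c, toLex (i, c) ∈ s → i ≤ n ∧ a ≤ c ∧ c ≤ b) : s.Finite := by
  refine (((finite_Iic n).prod (finite_Icc a b)).image toLex).subset ?_
  refine lex_forall.2 fun i c hz => ⟨(i, c), ?_, rfl⟩
  obtain ⟨h1, h2, h3⟩ := h i c hz
  exact ⟨h1, h2, h3⟩

/-- A cut in the `ω` part of `ω + ω*` has a finite left side and a right side of type `ω + ω*`
again; a cut in the `ω*` part is symmetric. Finite sets are included for the sides of cuts and for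
the truncations. -/
theorem tameFamily_gap :
    TameFamily {s : Set (ℕ ×ₗ ℤ) | s.Finite ∨ ∃ i a b, s = gap i a b} where
  left := by
    rintro s (hs | ⟨i, a, b, rfl⟩) x hx
    · exact .inl (hs.subset inter_subset_left)
    obtain ⟨j, c, rfl⟩ := exists_eq_toLex x
    rcases mem_gap.1 hx with ⟨rfl, h⟩ | ⟨rfl, h⟩
    · refine .inl (finite_of_forall_mem (n := j) (a := a) (b := c) fun j' c' hz => ?_)
      obtain ⟨h1, h2⟩ := hz
      rw [mem_gap] at h1; rw [mem_Iio, lex_lt_iff] at h2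
      omega
    · right
      refine ⟨i, a, c, Set.ext (lex_forall.2 fun j' c' => ?_)⟩
      rw [mem_inter_iff, mem_gap, mem_gap, mem_Iio, lex_lt_iff]; omega
  right := by
    rintro s (hs | ⟨i, a, b, rfl⟩) x hx
    · exact .inl (hs.subset inter_subset_left)
    obtain ⟨j, c, rfl⟩ := exists_eq_toLex x
    rcases mem_gap.1 hx with ⟨rfl, h⟩ | ⟨rfl, h⟩
    · right
      refine ⟨j, c, b, Set.ext (lex_forall.2 fun j' c' => ?_)⟩
      rw [mem_inter_iff, mem_gap, mem_gap, mem_Ioi, lex_lt_iff]; omega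
    · refine .inl (finite_of_forall_mem (n := i + 1) (a := c) (b := b) fun j' c' hz => ?_)
      obtain ⟨h1, h2⟩ := hz
      rw [mem_gap] at h1; rw [mem_Ioi, lex_lt_iff] at h2
      omega
  finite := by
    rintro s (hs | ⟨i, a, b, rfl⟩) x hx
    · exact .inl (hs.subset inter_subset_left)
    obtain ⟨j, c, rfl⟩ := exists_eq_toLex x
    rcases mem_gap.1 hx with ⟨rfl, h⟩ | ⟨rfl, h⟩
    · refine .inl (finite_of_forall_mem (n := j) (a := a) (b := c) fun j' c' hz => ?_)
      obtain ⟨h1, h2⟩ := hz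
      rw [mem_gap] at h1; rw [mem_Iio, lex_lt_iff] at h2
      omega
    · refine .inr (finite_of_forall_mem (n := i + 1) (a := c) (b := b) fun j' c' hz => ?_)
      obtain ⟨h1, h2⟩ := hz
      rw [mem_gap] at h1; rw [mem_Ioi, lex_lt_iff] at h2
      omega
  least := by
    rintro s (hs | ⟨i, a, b, rfl⟩) hne
    · obtain ⟨x, hx, h⟩ := exists_min_image s id hs hne
      exact ⟨x, hx, h⟩
    · refine ⟨toLex (i, a + 1), mem_gap.2 (by omega), lex_forall.2 fun j c hz => ?_⟩
      rw [mem_gap] at hz; rw [lex_le_iff]; omega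
  greatest := by
    rintro s (hs | ⟨i, a, b, rfl⟩) hne
    · obtain ⟨x, hx, h⟩ := exists_max_image s id hs hne
      exact ⟨x, hx, h⟩
    · refine ⟨toLex (i + 1, b - 1), mem_gap.2 (by omega), lex_forall.2 fun j c hz => ?_⟩
      rw [mem_gap] at hz; rw [lex_le_iff]; omega

/-- The pairs with second component bounded by `K` in absolute value. -/
def bounded (K : ℕ) : Set (ℕ ×ₗ ℤ) := {z | -(K : ℤ) ≤ (ofLex z).2 ∧ (ofLex z).2 ≤ K}

theorem mem_bounded {K i : ℕ} {c : ℤ} : toLex (i, c) ∈ bounded K ↔ -(K : ℤ) ≤ c ∧ c ≤ K := Iff.rfl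

theorem le_encard_gap (i K : ℕ) : (K : ℕ∞) ≤ (gap i 0 0 ∩ bounded K).encard := by
  have hinj : Function.Injective fun c : ℤ => (toLex (i, c) : ℕ ×ₗ ℤ) := by
    intro c d h; exact (lex_eq_iff.1 h).2
  have : (fun c : ℤ => (toLex (i, c) : ℕ ×ₗ ℤ)) '' Icc (1 : ℤ) K ⊆ gap i 0 0 ∩ bounded K := by
    rintro - ⟨c, hc, rfl⟩
    rw [mem_Icc] at hc
    exact ⟨mem_gap.2 (by omega), mem_bounded.2 (by omega)⟩
  refine le_trans ?_ (encard_le_encard this)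
  rw [hinj.encard_image, ← Finset.coe_Icc, encard_coe_eq_coe_finsetCard, Int.card_Icc]
  simp

/-- The truncated gap is finite and still has at least `threshold k` elements, all with the same
label. -/
theorem equivalent_gap {S : Type*} {l : ℕ ×ₗ ℤ → S} {i k K : ℕ} (hK : threshold k ≤ K)
    (hl : ∀ x ∈ gap i 0 0, ∀ y ∈ gap i 0 0, l x = l y) :
    Equivalent l l k (gap i 0 0 ∩ bounded K) (gap i 0 0) := by
  refine tameFamily_gap.equivalent tameFamily_gap (.inl ?_) (.inr ⟨i, 0, 0, rfl⟩)
    (.inr ?_) fun x hx y hy => hl x hx.1 y hy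
  · refine finite_of_forall_mem (n := i + 1) (a := -K) (b := K) fun j c hz => ?_
    obtain ⟨h1, h2⟩ := hz
    rw [mem_gap] at h1; rw [mem_bounded] at h2; omega
  · have h := (Nat.cast_le.2 hK).trans (le_encard_gap i K)
    exact ⟨h, h.trans (encard_le_encard inter_subset_left)⟩

end Gap

/-! ## Substitution of words for letters -/

section Substitution

universe u v w

variable {S : Type u} {A : Type v} {X : Type w} [LinearOrder X] (u : S → FreeSemigroup A)
  (l : X → S)

/-- The positions of the order obtained by substituting words for the letters. -/
def substCarrier (s : Set X) : Set (X ×ₗ ℕ) :=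
  {z | (ofLex z).1 ∈ s ∧ (ofLex z).2 < (letters (u (l (ofLex z).1))).length}

/-- The labels of the order obtained by substituting words for the letters. -/
def substLabel (z : X ×ₗ ℕ) : A :=
  (letters (u (l (ofLex z).1))).getD (ofLex z).2 (u (l (ofLex z).1)).head

variable {u l}

theorem substCarrier_union {X : Type w} {l : X → S} (s t : Set X) :
    substCarrier u l (s ∪ t) = substCarrier u l s ∪ substCarrier u l t := by
  ext z; simp [substCarrier, or_and_right]

theorem substCarrier_inter_Iio {s : Set X} {d : X} (hd : d ∈ s) {j : ℕ}
    (hj : j < (letters (u (l d))).length) :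
    substCarrier u l s ∩ Iio (toLex (d, j)) =
      substCarrier u l (s ∩ Iio d) ∪ (fun i => toLex (d, i)) '' Iio j := by
  ext z
  simp only [substCarrier, mem_inter_iff, mem_ofPred_eq, mem_Iio, mem_union, mem_image,
    Prod.Lex.lt_iff]
  constructor
  · rintro ⟨⟨h1, h2⟩, h | ⟨h, h'⟩⟩
    · exact .inl ⟨⟨h1, h⟩, h2⟩
    · exact .inr ⟨(ofLex z).2, h', by rw [show d = (ofLex z).1 from h.symm]; rfl⟩
  · rintro (⟨⟨h1, h⟩, h2⟩ | ⟨i, hi, rfl⟩)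
    · exact ⟨⟨h1, h2⟩, .inl h⟩
    · exact ⟨⟨hd, lt_trans hi hj⟩, .inr ⟨rfl, hi⟩⟩

theorem substCarrier_inter_Ioi {s : Set X} {d : X} (hd : d ∈ s) (j : ℕ) :
    substCarrier u l s ∩ Ioi (toLex (d, j)) =
      (fun i => toLex (d, i)) '' Ioo j (letters (u (l d))).length ∪
        substCarrier u l (s ∩ Ioi d) := by
  ext z
  simp only [substCarrier, mem_inter_iff, mem_ofPred_eq, mem_Ioi, mem_union, mem_image,
    Prod.Lex.lt_iff]
  constructor
  · rintro ⟨⟨h1, h2⟩, h | ⟨h, h'⟩⟩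
    · exact .inr ⟨⟨h1, h⟩, h2⟩
    · replace h : d = (ofLex z).1 := h
      exact .inl ⟨(ofLex z).2, ⟨h', by rw [h]; exact h2⟩, by rw [h]; rfl⟩
  · rintro (⟨i, hi, rfl⟩ | ⟨⟨h1, h⟩, h2⟩)
    · exact ⟨⟨hd, hi.2⟩, .inr ⟨rfl, hi.1⟩⟩
    · exact ⟨⟨h1, h2⟩, .inl h⟩

theorem equivalent_subst_piece {d d' : X} (h : l d = l d') (k : ℕ) (N : Set ℕ) :
    Equivalent (substLabel u l) (substLabel u l) k ((fun i => toLex (d, i)) '' N)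
      ((fun i => toLex (d', i)) '' N) := by
  refine .of_bijOn (f := fun z => toLex (d', (ofLex z).2)) ⟨?_, ?_, ?_⟩ ?_ ?_ k
  · rintro - ⟨i, hi, rfl⟩; exact ⟨i, hi, rfl⟩
  · rintro - ⟨i, hi, rfl⟩ - ⟨j, hj, rfl⟩ hij
    simp only [ofLex_toLex, toLex_inj, Prod.mk.injEq, true_and] at hij
    simp only [hij]
  · rintro - ⟨i, hi, rfl⟩; exact ⟨_, ⟨i, hi, rfl⟩, rfl⟩
  · rintro - ⟨i, hi, rfl⟩ - ⟨j, hj, rfl⟩ hij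
    rw [Prod.Lex.toLex_lt_toLex] at hij ⊢
    simpa using hij
  · rintro - ⟨i, hi, rfl⟩
    simp [substLabel, h]

/-- An element inside the word substituted for `d` is answered by the same place in the word
substituted for the answer `d'` to `d`: equal labels mean equal words. -/
theorem Equivalent.subst {k : ℕ} {s t : Set X} (h : Equivalent l l k s t) :
    Equivalent (substLabel u l) (substLabel u l) k (substCarrier u l s) (substCarrier u l t) := by
  induction k generalizing s t with
  | zero => trivial
  | succ k ih =>
    have lt_image : ∀ (d : X) (N : Set ℕ) (r : Set X), (∀ x ∈ r, x < d) →
        ∀ x ∈ substCarrier u l r, ∀ y ∈ (fun i => (toLex (d, i) : X ×ₗ ℕ)) '' N, x < y := by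
      rintro d N r hr x hx - ⟨i, -, rfl⟩
      exact Prod.Lex.lt_iff.2 (.inl (hr _ hx.1))
    have image_lt : ∀ (d : X) (N : Set ℕ) (r : Set X), (∀ x ∈ r, d < x) →
        ∀ y ∈ (fun i => (toLex (d, i) : X ×ₗ ℕ)) '' N, ∀ x ∈ substCarrier u l r, y < x := by
      rintro d N r hr - ⟨i, -, rfl⟩ x hx
      exact Prod.Lex.lt_iff.2 (.inl (hr _ hx.1))
    have key : ∀ d ∈ s, ∀ d' ∈ t, ∀ j, j < (letters (u (l d))).length →
        (l d = l d' ∧ Equivalent l l k (s ∩ Iio d) (t ∩ Iio d') ∧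
          Equivalent l l k (s ∩ Ioi d) (t ∩ Ioi d')) →
        substLabel u l (toLex (d, j)) = substLabel u l (toLex (d', j)) ∧
        Equivalent (substLabel u l) (substLabel u l) k
          (substCarrier u l s ∩ Iio (toLex (d, j))) (substCarrier u l t ∩ Iio (toLex (d', j))) ∧
        Equivalent (substLabel u l) (substLabel u l) k
          (substCarrier u l s ∩ Ioi (toLex (d, j))) (substCarrier u l t ∩ Ioi (toLex (d', j))) := by
      rintro d hd d' hd' j hj ⟨h1, h2, h3⟩
      rw [substCarrier_inter_Iio hd hj, substCarrier_inter_Iio hd' (h1 ▸ hj),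
        substCarrier_inter_Ioi hd, substCarrier_inter_Ioi hd', ← h1]
      refine ⟨by simp [substLabel, h1], (ih h2).append (equivalent_subst_piece h1 k _) ?_ ?_,
        (equivalent_subst_piece h1 k _).append (ih h3) ?_ ?_⟩
      · exact lt_image _ _ _ fun x hx => hx.2
      · exact lt_image _ _ _ fun x hx => hx.2
      · exact image_lt _ _ _ fun x hx => hx.2
      · exact image_lt _ _ _ fun x hx => hx.2
    refine ⟨fun z hz => ?_, fun z hz => ?_⟩
    · obtain ⟨d', hd', h'⟩ := h.1 _ hz.1
      refine ⟨toLex (d', (ofLex z).2), ⟨hd', ?_⟩, key _ hz.1 _ hd' _ hz.2 h'⟩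
      have := hz.2
      rw [h'.1] at this
      exact this
    · obtain ⟨d, hd, h'⟩ := h.2 _ hz.1
      have hj : (ofLex z).2 < (letters (u (l d))).length := by
        have := hz.2
        rwa [← h'.1] at this
      exact ⟨toLex (d, (ofLex z).2), ⟨hd, hj⟩, key _ hd _ hz.1 _ hj h'⟩

theorem spells_subst_piece (d : X) (v : List A) (j : ℕ) (h : letters (u (l d)) =
    (letters (u (l d))).take j ++ v) (hj : j ≤ (letters (u (l d))).length) :
    Spells (substLabel u l) ((fun i => toLex (d, i)) '' Ico j (letters (u (l d))).length) v := by
  induction v generalizing j with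
  | nil =>
    have : (letters (u (l d))).length ≤ j := by
      have := congrArg List.length h
      simp at this; omega
    simp [Spells, this]
  | cons a v ih =>
    have hlen := congrArg List.length h
    have hjl : j < (letters (u (l d))).length := by simp at hlen; omega
    have hget : (letters (u (l d)))[j]? = some a := by
      rw [h, List.getElem?_append_right (by simp)]
      simp [hj]
    refine ⟨toLex (d, j), ⟨j, ⟨le_rfl, hjl⟩, rfl⟩, ?_, ?_, ?_⟩
    · simp [substLabel, List.getD, hget]
    · ext z
      simp only [mem_inter_iff, mem_image, mem_Iio, mem_empty_iff_false, iff_false, not_and]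
      rintro ⟨i, hi, rfl⟩
      rw [Prod.Lex.toLex_lt_toLex]
      have := hi.1
      simp; omega
    · have := ih (j + 1) (by
        rw [List.take_add_one, hget]
        simpa using h) hjl
      convert this using 1
      ext z
      simp only [mem_inter_iff, mem_image, mem_Ioi, mem_Ico]
      constructor
      · rintro ⟨⟨i, hi, rfl⟩, hz⟩
        rw [Prod.Lex.toLex_lt_toLex] at hz
        simp only [lt_self_iff_false, true_and, false_or] at hz
        exact ⟨i, ⟨hz, hi.2⟩, rfl⟩
      · rintro ⟨i, hi, rfl⟩
        refine ⟨⟨i, ⟨by omega, hi.2⟩, rfl⟩, ?_⟩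
        rw [Prod.Lex.toLex_lt_toLex]
        simp; omega

theorem Spells.subst {s : Set X} {v : List S} (h : Spells l s v) :
    Spells (substLabel u l) (substCarrier u l s) (v.flatMap fun x => letters (u x)) := by
  induction v generalizing s with
  | nil =>
    obtain rfl : s = ∅ := h
    simp [Spells, substCarrier]
  | cons b v ih =>
    obtain ⟨x, hx, rfl, h2, h3⟩ := h
    rw [List.flatMap_cons]
    have : substCarrier u l s = (fun i => toLex (x, i)) '' Ico 0 (letters (u (l x))).length ∪
        substCarrier u l (s ∩ Ioi x) := by
      conv_lhs => rw [← split_at hx, h2, empty_union, substCarrier_union]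
      congr 1
      ext z
      simp only [substCarrier, mem_singleton_iff, mem_ofPred_eq, mem_image, mem_Ico]
      constructor
      · rintro ⟨h, h'⟩
        rw [h] at h'
        exact ⟨(ofLex z).2, ⟨Nat.zero_le _, h'⟩, by rw [← h]; rfl⟩
      · rintro ⟨i, hi, rfl⟩
        exact ⟨rfl, hi.2⟩
    rw [this]
    refine (spells_subst_piece x _ 0 (by simp) (Nat.zero_le _)).append (ih h3) ?_
    rintro - ⟨i, -, rfl⟩ y hy
    exact Prod.Lex.lt_iff.2 (.inl hy.1.2)

end Substitution

end PlusOne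

/-! ### Well-formed words and their infinite expansions. -/

namespace PlusOne

open Set

/-! ## Well-formed words as linked sequences -/

section Linked

universe v

variable {S : Type v} [Semigroup S]

namespace WFLetter

/-- The left idempotent of a letter. -/
def left : WFLetter S → Option (Idem S)
  | first _ _ => none
  | middle e _ _ => some e
  | last e _ => some e
  | single _ => none

/-- The right idempotent of a letter. -/
def right : WFLetter S → Option (Idem S)
  | first _ f => some f
  | middle _ _ f => some f
  | last _ _ => none
  | single _ => none

/-- The central element of a letter. -/
def mid : WFLetter S → S
  | first s _ => s
  | middle _ s _ => s
  | last _ s => s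
  | single s => s

/-- The letter with given idempotents and central element. -/
def mk : Option (Idem S) → S → Option (Idem S) → WFLetter S
  | none, s, none => single s
  | none, s, some f => first s f
  | some e, s, none => last e s
  | some e, s, some f => middle e s f

@[simp] theorem left_mk (o : Option (Idem S)) (s : S) (o' : Option (Idem S)) :
    (mk o s o').left = o := by
  cases o <;> cases o' <;> rfl

@[simp] theorem mid_mk (o : Option (Idem S)) (s : S) (o' : Option (Idem S)) :
    (mk o s o').mid = s := by
  cases o <;> cases o' <;> rfl

@[simp] theorem right_mk (o : Option (Idem S)) (s : S) (o' : Option (Idem S)) :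
    (mk o s o').right = o' := by
  cases o <;> cases o' <;> rfl

@[simp] theorem mk_eta (b : WFLetter S) : mk b.left b.mid b.right = b := by
  cases b <;> rfl

/-- An optional idempotent as an element of the monoid `S¹`. -/
def idemValue (o : Option (Idem S)) : WithOne S := o.elim 1 fun e => (e.1 : WithOne S)

@[simp] theorem idemValue_none : idemValue (none : Option (Idem S)) = 1 := rfl

@[simp] theorem idemValue_some (e : Idem S) : idemValue (some e) = (e.1 : WithOne S) := rfl

theorem coe_value (b : WFLetter S) :
    (b.value : WithOne S) = idemValue b.left * b.mid * idemValue b.right := by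
  cases b <;> simp [value, left, right, mid, idemValue]

theorem idemValue_mul_self (o : Option (Idem S)) : idemValue o * idemValue o = idemValue o := by
  cases o with
  | none => simp [idemValue]
  | some e =>
    have := e.2.eq
    simp only [idemValue, Option.elim, ← WithOne.coe_mul, this]

theorem finite_letters [Finite S] : Finite (WFLetter S) := by
  refine Finite.of_surjective (α := Option (Idem S) × S × Option (Idem S))
    (fun x => mk x.1 x.2.1 x.2.2) fun b => ⟨(b.left, b.mid, b.right), mk_eta b⟩

end WFLetter

/-- Sequences of letters, starting with the given left idempotent, such that the right idempotent
of each letter is the left idempotent of the next one, and such that exactly the last letter has no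
right idempotent. -/
def Linked : Option (Idem S) → List (WFLetter S) → Prop
  | _, [] => False
  | o, b :: l => b.left = o ∧ (b.right = none ↔ l = []) ∧ (l ≠ [] → Linked b.right l)

theorem wfTail_iff_linked (f : Idem S) (l : List (WFLetter S)) :
    WFTail f l ↔ Linked (some f) l := by
  induction l generalizing f with
  | nil => simp [WFTail, Linked]
  | cons b l ih =>
    cases b with
    | first s g => simp [WFTail, Linked, WFLetter.left]
    | middle e s g =>
      simp only [WFTail, Linked, WFLetter.left, WFLetter.right, ih]
      cases l with
      | nil => simp [Linked]
      | cons b' l => simp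
    | last e s =>
      cases l with
      | nil => simp [WFTail, Linked, WFLetter.left, WFLetter.right]
      | cons b' l => simp [WFTail, Linked, WFLetter.left, WFLetter.right]
    | single s => simp [WFTail, Linked, WFLetter.left]

/-- `Linked` treats the four kinds of letters uniformly: a missing idempotent signals an end of the
word. -/
theorem wellFormed_iff_linked (w : FreeSemigroup (WFLetter S)) :
    WellFormed w ↔ Linked none (letters w) := by
  obtain ⟨b, l⟩ := w
  simp only [WellFormed, letters, Linked]
  constructor
  · rintro (⟨s, hs⟩ | ⟨s, f, l', h, hl⟩)
    · obtain ⟨rfl, rfl⟩ : b = .single s ∧ l = [] := by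
        rw [FreeSemigroup.mk.injEq] at hs; exact hs
      simp [WFLetter.left, WFLetter.right]
    · obtain ⟨rfl, rfl⟩ := List.cons_eq_cons.1 h
      rw [wfTail_iff_linked] at hl
      have : l ≠ [] := by rintro rfl; exact hl
      simp [WFLetter.left, WFLetter.right, this, hl]
  · rintro ⟨h1, h2, h3⟩
    cases b with
    | first s f =>
      refine .inr ⟨s, f, l, rfl, (wfTail_iff_linked _ _).2 (h3 fun h => ?_)⟩
      simp [WFLetter.right, h] at h2
    | middle e s f => simp [WFLetter.left] at h1
    | last e s => simp [WFLetter.left] at h1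
    | single s =>
      obtain rfl := h2.1 rfl
      exact .inl ⟨s, rfl⟩

theorem Linked.left_eq {o : Option (Idem S)} {l : List (WFLetter S)} (h : Linked o l)
    {b : WFLetter S} (hb : l[0]? = some b) : b.left = o := by
  cases l with
  | nil => simp at hb
  | cons b' l =>
    obtain rfl : b' = b := by simpa using hb
    exact h.1

theorem Linked.right_eq_none_iff {o : Option (Idem S)} {l : List (WFLetter S)} (h : Linked o l)
    {i : ℕ} {b : WFLetter S} (hb : l[i]? = some b) : b.right = none ↔ i + 1 = l.length := by
  induction l generalizing o i with
  | nil => simp at hb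
  | cons b' l ih =>
    cases i with
    | zero =>
      obtain rfl : b' = b := by simpa using hb
      rw [h.2.1, ← List.length_eq_zero_iff, List.length_cons]; omega
    | succ i =>
      have hb : l[i]? = some b := by simpa using hb
      rw [ih (h.2.2 (by rintro rfl; simp at hb)) hb, List.length_cons]; omega

theorem Linked.right_eq_left {o : Option (Idem S)} {l : List (WFLetter S)} (h : Linked o l)
    {i : ℕ} {b b' : WFLetter S} (hb : l[i]? = some b) (hb' : l[i + 1]? = some b') :
    b.right = b'.left := by
  induction l generalizing o i with
  | nil => simp at hb
  | cons c l ih =>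
    have hb' : l[i]? = some b' := by simpa using hb'
    have hl := h.2.2 (by rintro rfl; simp at hb')
    cases i with
    | zero =>
      obtain rfl : c = b := by simpa using hb
      exact (hl.left_eq hb').symm
    | succ i => exact ih hl (by simpa using hb) hb'

theorem Linked.left_eq_none_iff {l : List (WFLetter S)} (h : Linked none l)
    {i : ℕ} {b : WFLetter S} (hb : l[i]? = some b) : b.left = none ↔ i = 0 := by
  cases i with
  | zero => simpa using h.left_eq hb
  | succ i =>
    obtain ⟨hi, -⟩ := List.getElem?_eq_some_iff.1 hb
    obtain ⟨c, hc⟩ : ∃ c, l[i]? = some c := ⟨_, List.getElem?_eq_getElem (by omega)⟩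
    rw [← h.right_eq_left hc hb, h.right_eq_none_iff hc]
    omega

end Linked

/-! ## Products -/

section Products

universe u v

variable {A : Type u} {S : Type v} [Semigroup S]

/-- The product in `S¹` of the images of the letters of a list. -/
def listValue (α : FreeSemigroup A →ₙ* S) (l : List A) : WithOne S :=
  (l.map fun a => (α (.of a) : WithOne S)).prod

@[simp] theorem listValue_nil (α : FreeSemigroup A →ₙ* S) : listValue α [] = 1 := rfl

@[simp] theorem listValue_cons (α : FreeSemigroup A →ₙ* S) (a : A) (l : List A) :
    listValue α (a :: l) = α (.of a) * listValue α l := by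
  simp [listValue]

@[simp] theorem listValue_append (α : FreeSemigroup A →ₙ* S) (l l' : List A) :
    listValue α (l ++ l') = listValue α l * listValue α l' := by
  simp [listValue]

theorem letters_of_mul (a : A) (w : FreeSemigroup A) :
    letters (FreeSemigroup.of a * w) = a :: letters w := rfl

@[simp] theorem listValue_letters (α : FreeSemigroup A →ₙ* S) (w : FreeSemigroup A) :
    listValue α (letters w) = α w := by
  induction w using FreeSemigroup.recOnMul with
  | ih1 a => simp [letters, FreeSemigroup.of]
  | ih2 a w _ ih => rw [letters_of_mul, listValue_cons, ih, map_mul, WithOne.coe_mul]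

theorem listValue_flatMap {B : Type*} (α : FreeSemigroup A →ₙ* S) (g : B → List A) (l : List B) :
    listValue α (l.flatMap g) = (l.map fun b => listValue α (g b)).prod := by
  induction l with
  | nil => rfl
  | cons b l ih => simp [ih]

theorem beta_of (b : WFLetter S) : beta (.of b) = b.value := FreeSemigroup.lift_of _ _

theorem exists_letters_eq {l : List A} (h : l ≠ []) : ∃ w : FreeSemigroup A, letters w = l := by
  obtain ⟨a, l, rfl⟩ := List.exists_cons_of_ne_nil h
  exact ⟨⟨a, l⟩, rfl⟩

end Products

/-! ## The infinite order of a well-formed word -/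

section Expansion

universe u v

variable {S : Type v} [Semigroup S]

namespace WFLetter

/-- The `c`-th copy in the expansion of a letter: the central element for `c = 0`, copies of the
left idempotent for `c < 0` and of the right idempotent for `c > 0`. -/
def copy (b : WFLetter S) (c : ℤ) : S :=
  if c < 0 then b.left.elim b.mid (fun e => e.1)
  else if 0 < c then b.right.elim b.mid (fun e => e.1) else b.mid

/-- The range of the copies in the expansion of a letter. -/
def HasCopy (b : WFLetter S) (c : ℤ) : Prop :=
  (c < 0 → b.left ≠ none) ∧ (0 < c → b.right ≠ none)

theorem copy_zero (b : WFLetter S) : b.copy 0 = b.mid := by simp [copy]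

theorem copy_of_neg {b : WFLetter S} {c : ℤ} (hc : c < 0) {e : Idem S} (h : b.left = some e) :
    b.copy c = e.1 := by simp [copy, hc, h]

theorem copy_of_pos {b : WFLetter S} {c : ℤ} (hc : 0 < c) {e : Idem S} (h : b.right = some e) :
    b.copy c = e.1 := by simp [copy, hc, h, hc.not_gt]

/-- A finite part of the expansion of a letter, with `K` copies of each idempotent. -/
def expand (K : ℕ) (b : WFLetter S) : List S :=
  b.left.elim [] (fun e => List.replicate K e.1) ++
    ([b.mid] ++ b.right.elim [] fun e => List.replicate K e.1)

theorem prod_replicate_idem {K : ℕ} (hK : 0 < K) (o : Option (Idem S)) :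
    ((o.elim [] fun e => List.replicate K e.1).map fun s : S => (s : WithOne S)).prod = idemValue o := by
  cases o with
  | none => rfl
  | some e =>
    obtain ⟨K, rfl⟩ : ∃ k, K = k + 1 := ⟨K - 1, by omega⟩
    have : IsIdempotentElem (e.1 : WithOne S) := idemValue_mul_self (some e)
    simp only [Option.elim, List.map_replicate, List.prod_replicate, this.pow_succ_eq, idemValue]

theorem prod_expand {K : ℕ} (hK : 0 < K) (b : WFLetter S) :
    ((b.expand K).map fun s : S => (s : WithOne S)).prod = b.value := by
  rw [coe_value, expand, List.map_append, List.map_append, List.prod_append, List.prod_append,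
    prod_replicate_idem hK, prod_replicate_idem hK, mul_assoc]
  simp

end WFLetter

/-- The `i`-th letter of a word. -/
def letterAt {A : Type u} (w : FreeSemigroup A) (i : ℕ) : A := (letters w).getD i w.head

theorem letterAt_fin {A : Type u} (w : FreeSemigroup A) (i : Fin (letters w).length) :
    letterAt w i = (letters w).get i := by
  simp [letterAt, List.getD]

theorem getElem?_letterAt {A : Type u} {w : FreeSemigroup A} {i : ℕ} (h : i < (letters w).length) :
    (letters w)[i]? = some (letterAt w i) := by
  simp [letterAt, List.getD, h]

variable (w : FreeSemigroup (WFLetter S))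

/-- The labelling of the expansion of a word. -/
def copyLabel (z : ℕ ×ₗ ℤ) : S := (letterAt w (ofLex z).1).copy (ofLex z).2

theorem copyLabel_toLex (i : ℕ) (c : ℤ) : copyLabel w (toLex (i, c)) = (letterAt w i).copy c := rfl

/-- The positions of the expansion of a word. -/
def copyCarrier : Set (ℕ ×ₗ ℤ) := Icc (toLex (0, 0)) (toLex ((letters w).length - 1, 0))

variable {w}

/-- The interval between the first and the last central point removes exactly the copies that do not
exist: the first letter alone has no left idempotent, and the last letter alone has no right one. -/
theorem mem_copyCarrier (hw : WellFormed w) {i : ℕ} {c : ℤ} :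
    toLex (i, c) ∈ copyCarrier w ↔ i < (letters w).length ∧ (letterAt w i).HasCopy c := by
  have hl := letters_length_pos w
  rw [copyCarrier, mem_Icc, lex_le_iff, lex_le_iff]
  by_cases hi : i < (letters w).length
  · rw [wellFormed_iff_linked] at hw
    have h1 := hw.left_eq_none_iff (getElem?_letterAt hi)
    have h2 := hw.right_eq_none_iff (getElem?_letterAt hi)
    rw [WFLetter.HasCopy, ne_eq, h1, ne_eq, h2]
    omega
  · omega

theorem right_letterAt (hw : WellFormed w) {i : ℕ} (hi : i + 1 < (letters w).length) :
    ∃ f, (letterAt w i).right = some f ∧ (letterAt w (i + 1)).left = some f := by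
  rw [wellFormed_iff_linked] at hw
  have h := hw.right_eq_left (getElem?_letterAt (by omega)) (getElem?_letterAt hi)
  have h' := hw.left_eq_none_iff (getElem?_letterAt hi)
  obtain ⟨f, hf⟩ := Option.ne_none_iff_exists'.1 (fun h0 => Nat.succ_ne_zero i (h'.1 h0))
  exact ⟨f, h.trans hf, hf⟩

/-- The carrier is a chain of central points `(i, 0)` separated by gaps. A gap bears a single label,
the idempotent shared by the two adjacent letters, so it can be truncated; the pieces are then
concatenated. -/
theorem equivalent_bounded (hw : WellFormed w) {k K : ℕ} (hK : threshold k ≤ K) :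
    Equivalent (copyLabel w) (copyLabel w) k (copyCarrier w ∩ bounded K) (copyCarrier w) := by
  suffices h : ∀ i, i < (letters w).length → Equivalent (copyLabel w) (copyLabel w) k
      (Icc (toLex (0, 0)) (toLex (i, 0)) ∩ bounded K) (Icc (toLex (0, 0)) (toLex (i, 0))) from
    h _ (by have := letters_length_pos w; omega)
  intro i hi
  induction i with
  | zero =>
    rw [Icc_self, inter_eq_left.2]
    · exact .singleton k rfl
    · rintro - rfl
      exact mem_bounded.2 (by omega)
  | succ i ih =>
    obtain ⟨f, hf, hf'⟩ := right_letterAt hw hi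
    have hlab : ∀ x ∈ gap i 0 0, copyLabel w x = f.1 := by
      intro x hx
      obtain ⟨j, c, rfl⟩ := exists_eq_toLex x
      rcases mem_gap.1 hx with ⟨rfl, h⟩ | ⟨rfl, h⟩
      · exact WFLetter.copy_of_pos h hf
      · exact WFLetter.copy_of_neg h hf'
    have h1 := ih (by omega)
    have h2 := equivalent_gap (i := i) hK fun x hx y hy => (hlab x hx).trans (hlab y hy).symm
    have h3 : Equivalent (copyLabel w) (copyLabel w) k {(toLex (i + 1, 0) : ℕ ×ₗ ℤ)}
      {(toLex (i + 1, 0) : ℕ ×ₗ ℤ)} := .singleton k rfl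
    have lt1 : ∀ x ∈ Icc (toLex (0, 0)) (toLex (i, (0 : ℤ))), ∀ y ∈ gap i 0 0, x < y :=
      fun x hx y hy => lt_of_le_of_lt hx.2 hy.1
    have lt2 : ∀ x ∈ Icc (toLex (0, 0)) (toLex (i, (0 : ℤ))) ∪ gap i 0 0,
        ∀ y ∈ ({toLex (i + 1, 0)} : Set (ℕ ×ₗ ℤ)), x < y := by
      rintro x (hx | hx) y rfl
      · exact lt_of_le_of_lt hx.2 (lex_lt_iff.2 (by omega))
      · exact hx.2
    have := (h1.append h2 (fun x hx y hy => lt1 x hx.1 y hy.1) lt1).append h3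
      (fun x hx y hy => lt2 x (hx.imp And.left And.left) y hy) lt2
    convert this using 1
    · refine Set.ext (lex_forall.2 fun j c => ?_)
      simp only [mem_inter_iff, mem_union, mem_gap, mem_bounded, mem_Icc, lex_le_iff,
        mem_singleton_iff, lex_eq_iff]
      omega
    · refine Set.ext (lex_forall.2 fun j c => ?_)
      simp only [mem_union, mem_gap, mem_Icc, lex_le_iff, mem_singleton_iff, lex_eq_iff]
      omega

theorem spells_replicate {T : Type*} {l : ℕ ×ₗ ℤ → T} {s : T} (i : ℕ) (a : ℤ) (n : ℕ)
    (h : ∀ c, a < c → c ≤ a + n → l (toLex (i, c)) = s) :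
    Spells l ((fun c => toLex (i, c)) '' Ioc a (a + n)) (List.replicate n s) := by
  induction n generalizing a with
  | zero => simp [Spells]
  | succ n ih =>
    have := (Spells.singleton (l := l) (toLex (i, a + 1))).append
      (ih (a + 1) fun c hc hc' => h c (by omega) (by push_cast; omega)) (by
        rintro x rfl - ⟨c, hc, rfl⟩
        rw [mem_Ioc] at hc
        exact lex_lt_iff.2 (by omega))
    rw [h (a + 1) (by omega) (by push_cast; omega)] at this
    rw [List.replicate_succ, ← List.singleton_append]
    convert this using 1
    refine Set.ext (lex_forall.2 fun j c => ?_)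
    simp only [mem_image, mem_Ioc, mem_union, mem_singleton_iff, lex_eq_iff]
    constructor
    · rintro ⟨c', hc, rfl, rfl⟩
      rcases eq_or_ne c' (a + 1) with rfl | h
      · exact .inl ⟨rfl, rfl⟩
      · exact .inr ⟨c', by push_cast at hc; omega, rfl, rfl⟩
    · rintro (⟨rfl, rfl⟩ | ⟨c', hc, rfl, rfl⟩)
      · exact ⟨a + 1, by push_cast; omega, rfl, rfl⟩
      · exact ⟨c', by push_cast; omega, rfl, rfl⟩

theorem spells_expand (w : FreeSemigroup (WFLetter S)) (i K : ℕ) :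
    Spells (copyLabel w)
      ((fun c => (toLex (i, c) : ℕ ×ₗ ℤ)) '' {c | (letterAt w i).HasCopy c ∧ -(K : ℤ) ≤ c ∧ c ≤ K})
      ((letterAt w i).expand K) := by
  have h1 : Spells (copyLabel w) ((fun c => (toLex (i, c) : ℕ ×ₗ ℤ)) ''
      {c | (letterAt w i).left ≠ none ∧ -(K : ℤ) ≤ c ∧ c < 0})
      ((letterAt w i).left.elim [] (fun e => List.replicate K e.1)) := by
    cases h : (letterAt w i).left with
    | none => simp [Spells]
    | some e =>
      simp only [Option.elim]
      -- The interval `Ioc (-K - 1) (-1)` consists of the copies `-K, …, -1`.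
      convert spells_replicate (l := copyLabel w) (s := e.1) i (-K - 1) K
        (fun c hc hc' => WFLetter.copy_of_neg (show c < 0 by omega) h) using 2
      ext c; simp only [ne_eq, reduceCtorEq, not_false_eq_true, true_and, mem_ofPred_eq, mem_Ioc]
      omega
  have h2 : Spells (copyLabel w) ((fun c => (toLex (i, c) : ℕ ×ₗ ℤ)) ''
      {c | (letterAt w i).right ≠ none ∧ 0 < c ∧ c ≤ K})
      ((letterAt w i).right.elim [] (fun e => List.replicate K e.1)) := by
    cases h : (letterAt w i).right with
    | none => simp [Spells]
    | some e =>
      simp only [Option.elim]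
      convert spells_replicate (l := copyLabel w) (s := e.1) i 0 K
        (fun c hc hc' => WFLetter.copy_of_pos hc h) using 2
      ext c; simp only [ne_eq, reduceCtorEq, not_false_eq_true, true_and, mem_ofPred_eq, mem_Ioc]
      omega
  have h0 := Spells.singleton (l := copyLabel w) (toLex (i, 0))
  rw [copyLabel_toLex, WFLetter.copy_zero] at h0
  have := h1.append (h0.append h2 ?_) ?_
  · rw [WFLetter.expand]
    convert this using 1
    refine Set.ext (lex_forall.2 fun j c => ?_)
    simp only [mem_image, mem_union, mem_singleton_iff, lex_eq_iff, mem_ofPred_eq,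
      WFLetter.HasCopy]
    constructor
    · rintro ⟨c', ⟨⟨h1, h2⟩, h3⟩, rfl, rfl⟩
      rcases lt_trichotomy c' 0 with h | rfl | h
      · exact .inl ⟨c', ⟨h1 h, by omega⟩, rfl, rfl⟩
      · exact .inr (.inl ⟨rfl, rfl⟩)
      · exact .inr (.inr ⟨c', ⟨h2 h, by omega⟩, rfl, rfl⟩)
    · rintro (⟨c', ⟨h1, h2⟩, rfl, rfl⟩ | ⟨rfl, rfl⟩ | ⟨c', ⟨h1, h2⟩, rfl, rfl⟩)
      · exact ⟨c', ⟨⟨fun _ => h1, fun h => by omega⟩, by omega⟩, rfl, rfl⟩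
      · exact ⟨0, ⟨⟨fun h => by omega, fun h => by omega⟩, by omega⟩, rfl, rfl⟩
      · exact ⟨c', ⟨⟨fun h => by omega, fun _ => h1⟩, by omega⟩, rfl, rfl⟩
  · rintro x rfl - ⟨c, hc, rfl⟩
    exact lex_lt_iff.2 (.inr ⟨rfl, hc.2.1⟩)
  · rintro - ⟨c, hc, rfl⟩ y (rfl | ⟨c', hc', rfl⟩)
    · exact lex_lt_iff.2 (.inr ⟨rfl, hc.2.2⟩)
    · exact lex_lt_iff.2 (.inr ⟨rfl, hc.2.2.trans hc'.2.1⟩)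

theorem spells_bounded (hw : WellFormed w) (K : ℕ) :
    Spells (copyLabel w) (copyCarrier w ∩ bounded K)
      ((letters w).flatMap (WFLetter.expand K)) := by
  suffices h : ∀ n ≤ (letters w).length, Spells (copyLabel w)
      (copyCarrier w ∩ bounded K ∩ {z | (ofLex z).1 < n})
      (((letters w).take n).flatMap (WFLetter.expand K)) by
    have := h _ le_rfl
    rw [List.take_length] at this
    convert this using 1
    refine Set.ext (lex_forall.2 fun i c => ?_)
    simp only [mem_inter_iff, mem_copyCarrier hw, mem_ofPred_eq, ofLex_toLex]
    tauto
  intro n hn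
  induction n with
  | zero => simp [Spells]
  | succ n ih =>
    rw [List.take_add_one, getElem?_letterAt (by omega), List.flatMap_append]
    have := (ih (by omega)).append (spells_expand w n K) (by
      rintro x hx - ⟨c, hc, rfl⟩
      exact Prod.Lex.lt_iff.2 (.inl hx.2))
    simp only [Option.toList, List.flatMap_singleton]
    convert this using 1
    refine Set.ext (lex_forall.2 fun i c => ?_)
    simp only [mem_inter_iff, mem_copyCarrier hw, mem_bounded, mem_ofPred_eq, ofLex_toLex,
      mem_union, mem_image, lex_eq_iff]
    constructor
    · rintro ⟨⟨⟨h1, h2⟩, h3⟩, h4⟩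
      rcases Nat.lt_succ_iff_lt_or_eq.1 h4 with h | rfl
      · exact .inl ⟨⟨⟨h1, h2⟩, h3⟩, h⟩
      · exact .inr ⟨c, ⟨h2, h3⟩, rfl, rfl⟩
    · rintro (⟨⟨⟨h1, h2⟩, h3⟩, h4⟩ | ⟨c', ⟨h2, h3⟩, rfl, rfl⟩)
      · exact ⟨⟨⟨h1, h2⟩, h3⟩, by omega⟩
      · exact ⟨⟨⟨by omega, h2⟩, h3⟩, by omega⟩

end Expansion

end PlusOne

/-! ### From an F⁺-separator to an F-separator: the expansion as an interpretation. -/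

namespace PlusOne

open Set

/-! ## From enriched fragments to fragments over the alphabet of well-formed words -/

section BasicFamilies

universe u

variable {B : Type u} {V : Type} [DecidableEq V] {Ω : Set (FreeSemigroup B)}

/-- The relation stating that the letter at a variable belongs to a given set. -/
def letterRel (Ω : Set (FreeSemigroup B)) (x : V) (Q : Set B) : Rel Ω V :=
  fun w ν => letterAt w.1 (ν x) ∈ Q

/-- A relation that does not depend on the word. -/
def constRel (Ω : Set (FreeSemigroup B)) (V : Type) (p : Prop) : Rel Ω V := fun _ _ => p

variable {order en : Bool} {D : Bool → Set (Rel Ω V)}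

theorem FinFamily.of_finite {V ι : Type*} [Finite ι] {D : Set (Rel Ω V)} {F : ι → Rel Ω V}
    (h : ∀ i, F i ∈ D) : FinFamily D F :=
  ⟨finite_range F, h⟩

theorem Logic.letterRel_mem [Finite B] (hD : Logic order en D) (b : Bool) (x : V) (Q : Set B) :
    letterRel Ω x Q ∈ D b := by
  have : letterRel Ω x Q = ⨆ a : Q, (Formula.atom (.label a.1 x)).rel Ω := by
    ext w ν
    simp only [letterRel, iSup_apply, iSup_Prop_eq, Formula.rel, Formula.Sat, Atom.Sat,
      letterAt_fin]
    exact ⟨fun h => ⟨⟨_, h⟩, rfl⟩, fun ⟨a, h⟩ => h ▸ a.2⟩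
  rw [this]
  exact hD.iSup fun a => hD.atom b _ trivial

theorem Logic.constRel_mem (hD : Logic order en D) (b : Bool) (p : Prop) :
    constRel Ω V p ∈ D b := by
  by_cases hp : p
  · rw [show constRel Ω V p = ⊤ by ext; simp [constRel, hp]]; exact hD.top b
  · rw [show constRel Ω V p = ⊥ by ext; simp [constRel, hp]]; exact hD.bot b

theorem Logic.finFamily_letterRel [Finite B] (hD : Logic order en D) (b : Bool) (x : V)
    {ι : Type*} (Q : ι → Set B) : FinFamily (D b) fun i => letterRel Ω x (Q i) :=
  (FinFamily.of_finite fun Q => hD.letterRel_mem b x Q).comp Q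

theorem Logic.finFamily_constRel (hD : Logic order en D) (b : Bool)
    {ι : Type*} (p : ι → Prop) : FinFamily (D b) fun i => constRel Ω V (p i) :=
  (FinFamily.of_finite fun p => hD.constRel_mem b p).comp p

end BasicFamilies

section Forward

universe u v

variable {A : Type u} {S : Type v} [Semigroup S] (u : S → FreeSemigroup A)

theorem lex_lex_lt_iff {i j : ℕ} {p q : ℤ ×ₗ ℕ} :
    (toLex (toLex (i, (ofLex p).1), (ofLex p).2) : (ℕ ×ₗ ℤ) ×ₗ ℕ) <
      toLex (toLex (j, (ofLex q).1), (ofLex q).2) ↔ i < j ∨ (i = j ∧ p < q) := by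
  rw [Prod.Lex.toLex_lt_toLex, Prod.Lex.lt_iff (x := p), lex_lt_iff, lex_eq_iff]
  tauto

theorem lex_lex_eq_iff {i j : ℕ} {p q : ℤ ×ₗ ℕ} :
    (toLex (toLex (i, (ofLex p).1), (ofLex p).2) : (ℕ ×ₗ ℤ) ×ₗ ℕ) =
      toLex (toLex (j, (ofLex q).1), (ofLex q).2) ↔ i = j ∧ p = q := by
  rw [toLex_inj, Prod.mk.injEq, lex_eq_iff, and_assoc, ← Prod.ext_iff]
  rfl

/-- The offsets of the positions that stem from a letter. -/
def WFLetter.HasOffset (b : WFLetter S) (p : ℤ ×ₗ ℕ) : Prop :=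
  b.HasCopy (ofLex p).1 ∧ (ofLex p).2 < (letters (u (b.copy (ofLex p).1))).length

/-- The interpretation that replaces the letter `(e, s, f)` of a well-formed word by the word
`u e` repeated `ω*` times, the word `u s`, and the word `u f` repeated `ω` times. -/
def expansion : Interpretation {w : FreeSemigroup (WFLetter S) | WellFormed w} A
    ((ℕ ×ₗ ℤ) ×ₗ ℕ) (ℤ ×ₗ ℕ) where
  label w := substLabel u (copyLabel w.1)
  carrier w := substCarrier u (copyLabel w.1) (copyCarrier w.1)
  point i p := toLex (toLex (i, (ofLex p).1), (ofLex p).2)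
  guard w i p := (letterAt w.1 i).HasOffset u p
  mem_carrier := by
    rintro ⟨w, hw⟩ z
    constructor
    · rintro ⟨h1, h2⟩
      obtain ⟨h3, h4⟩ := (mem_copyCarrier hw).1 h1
      exact ⟨⟨_, h3⟩, toLex ((ofLex (ofLex z).1).2, (ofLex z).2), ⟨h4, h2⟩, rfl⟩
    · rintro ⟨i, p, ⟨h1, h2⟩, rfl⟩
      exact ⟨(mem_copyCarrier hw).2 ⟨i.2, h1⟩, h2⟩

variable {u}

theorem point_mem_expansion {w : {w : FreeSemigroup (WFLetter S) | WellFormed w}} {i : ℕ}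
    {p : ℤ ×ₗ ℕ} : (expansion u).point i p ∈ (expansion u).carrier w ↔
      i < (letters w.1).length ∧ (letterAt w.1 i).HasOffset u p := by
  rw [Interpretation.mem_carrier]
  constructor
  · rintro ⟨j, q, h1, h2⟩
    obtain ⟨rfl, rfl⟩ := lex_lex_eq_iff.1 h2
    exact ⟨j.2, h1⟩
  · rintro ⟨h1, h2⟩
    exact ⟨⟨i, h1⟩, p, h2, rfl⟩

theorem exists_point_eq (z : (ℕ ×ₗ ℤ) ×ₗ ℕ) : ∃ i p, (expansion u).point i p = z :=
  ⟨(ofLex (ofLex z).1).1, toLex ((ofLex (ofLex z).1).2, (ofLex z).2), rfl⟩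

theorem expansion_point_lt {i j : ℕ} {p q : ℤ ×ₗ ℕ} :
    (expansion u).point i p < (expansion u).point j q ↔ i < j ∨ (i = j ∧ p < q) :=
  lex_lex_lt_iff

theorem expansion_point_eq {i j : ℕ} {p q : ℤ ×ₗ ℕ} :
    (expansion u).point i p = (expansion u).point j q ↔ i = j ∧ p = q :=
  lex_lex_eq_iff

theorem expansion_point_le {i j : ℕ} {p q : ℤ ×ₗ ℕ} :
    (expansion u).point i p ≤ (expansion u).point j q ↔ i < j ∨ (i = j ∧ p ≤ q) := by
  rw [le_iff_lt_or_eq, expansion_point_lt, expansion_point_eq, le_iff_lt_or_eq]; tauto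

/-- The start of a later copy serves as witness. Its index is made at least `1`, since the copies of
the right idempotent are those with positive index. -/
theorem WFLetter.exists_offset_gt {b : WFLetter S} (hb : b.right ≠ none) (p : ℤ ×ₗ ℕ) :
    ∃ q, p < q ∧ b.HasOffset u q := by
  refine ⟨toLex (max 1 ((ofLex p).1 + 1), 0), Prod.Lex.lt_iff.2 (.inl ?_),
    ⟨fun h => ?_, fun _ => hb⟩, letters_length_pos _⟩
  · exact lt_of_lt_of_le (lt_add_one _) (le_max_right _ _)
  · have := le_max_left 1 ((ofLex p).1 + 1)
    simp only [ofLex_toLex] at h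
    omega

theorem WFLetter.exists_offset_lt {b : WFLetter S} (hb : b.left ≠ none) (p : ℤ ×ₗ ℕ) :
    ∃ q, q < p ∧ b.HasOffset u q := by
  refine ⟨toLex (min (-1) ((ofLex p).1 - 1), 0), Prod.Lex.lt_iff.2 (.inl ?_),
    ⟨fun _ => hb, fun h => ?_⟩, letters_length_pos _⟩
  · exact lt_of_le_of_lt (min_le_right _ _) (sub_one_lt _)
  · have := min_le_left (-1) ((ofLex p).1 - 1)
    simp only [ofLex_toLex] at h
    omega

variable (w : {w : FreeSemigroup (WFLetter S) | WellFormed w})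

theorem right_ne_none {i j : ℕ} (hij : i < j) (hj : j < (letters w.1).length) :
    (letterAt w.1 i).right ≠ none := by
  obtain ⟨f, hf, -⟩ := right_letterAt w.2 (i := i) (by omega)
  simp [hf]

theorem left_eq_none_iff {i : ℕ} (hi : i < (letters w.1).length) :
    (letterAt w.1 i).left = none ↔ i = 0 :=
  ((wellFormed_iff_linked _).1 w.2).left_eq_none_iff (getElem?_letterAt hi)

theorem right_eq_none_iff {i : ℕ} (hi : i < (letters w.1).length) :
    (letterAt w.1 i).right = none ↔ i + 1 = (letters w.1).length :=
  ((wellFormed_iff_linked _).1 w.2).right_eq_none_iff (getElem?_letterAt hi)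

/-- Elements that stem from different letters are never successive: the earlier letter has a right
idempotent, and its `ω` copies leave room in between. So successor becomes equality of positions
together with a condition on one letter. -/
theorem expansion_succ_iff {V : Type} (ν : V → Fin (letters w.1).length) (o : V → ℤ ×ₗ ℕ)
    (x y : V) :
    (Atom.succ x y).SatOn ((expansion u).label w) ((expansion u).carrier w)
      (fun x => (expansion u).point (ν x) (o x)) ↔
    ν x = ν y ∧ o x < o y ∧ ∀ p, (letterAt w.1 (ν x)).HasOffset u p → ¬ (o x < p ∧ p < o y) := by
  simp only [Atom.SatOn, expansion_point_lt]
  constructor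
  · rintro ⟨h | ⟨h, h'⟩, h2⟩
    · obtain ⟨q, hq, hq'⟩ := WFLetter.exists_offset_gt (u := u) (right_ne_none w h (ν y).2) (o x)
      refine absurd ⟨?_, ?_⟩ (h2 _ (point_mem_expansion.2 ⟨(ν x).2, hq'⟩))
      · exact expansion_point_lt.2 (.inr ⟨rfl, hq⟩)
      · exact expansion_point_lt.2 (.inl h)
    · refine ⟨Fin.ext h, h', fun p hp hp' => h2 _ (point_mem_expansion.2 ⟨(ν x).2, hp⟩) ?_⟩
      rw [expansion_point_lt, expansion_point_lt]
      exact ⟨.inr ⟨rfl, hp'.1⟩, .inr ⟨h, hp'.2⟩⟩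
  · rintro ⟨h, h', h2⟩
    refine ⟨.inr ⟨by rw [h], h'⟩, fun z hz hz' => ?_⟩
    obtain ⟨i, p, rfl⟩ := exists_point_eq (u := u) z
    obtain ⟨-, hp⟩ := point_mem_expansion.1 hz
    rw [expansion_point_lt, expansion_point_lt, ← h] at hz'
    obtain ⟨rfl, h3, h4⟩ : (ν x : ℕ) = i ∧ o x < p ∧ p < o y := by
      rcases hz' with ⟨h3 | h3, h4 | h4⟩
      · omega
      · omega
      · omega
      · exact ⟨h3.1, h3.2, h4.2⟩
    exact h2 p hp ⟨h3, h4⟩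

/-- A letter with a left idempotent has no least offset. Hence the minimum lies in a letter without
one, and only the first letter is of this kind. -/
theorem expansion_isMin_iff {V : Type} (ν : V → Fin (letters w.1).length) (o : V → ℤ ×ₗ ℕ)
    (x : V) :
    (Atom.isMin x).SatOn ((expansion u).label w) ((expansion u).carrier w)
      (fun x => (expansion u).point (ν x) (o x)) ↔
    (letterAt w.1 (ν x)).left = none ∧ ∀ p, (letterAt w.1 (ν x)).HasOffset u p → o x ≤ p := by
  simp only [Atom.SatOn]
  constructor
  · intro h
    have h' : ∀ p, (letterAt w.1 (ν x)).HasOffset u p → o x ≤ p := fun p hp => by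
      simpa [expansion_point_le] using h _ (point_mem_expansion.2 ⟨(ν x).2, hp⟩)
    refine ⟨?_, h'⟩
    by_contra hne
    obtain ⟨q, hq, hq'⟩ := WFLetter.exists_offset_lt (u := u) hne (o x)
    exact absurd (h' q hq') (not_le.2 hq)
  · rintro ⟨h1, h2⟩ z hz
    obtain ⟨i, p, rfl⟩ := exists_point_eq (u := u) z
    obtain ⟨-, hp⟩ := point_mem_expansion.1 hz
    rw [left_eq_none_iff w (ν x).2] at h1
    rw [expansion_point_le]
    rcases Nat.eq_zero_or_pos i with rfl | hi
    · exact .inr ⟨h1, h2 p (by rwa [h1])⟩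
    · exact .inl (by omega)

theorem expansion_isMax_iff {V : Type} (ν : V → Fin (letters w.1).length) (o : V → ℤ ×ₗ ℕ)
    (x : V) :
    (Atom.isMax x).SatOn ((expansion u).label w) ((expansion u).carrier w)
      (fun x => (expansion u).point (ν x) (o x)) ↔
    (letterAt w.1 (ν x)).right = none ∧ ∀ p, (letterAt w.1 (ν x)).HasOffset u p → p ≤ o x := by
  simp only [Atom.SatOn]
  constructor
  · intro h
    have h' : ∀ p, (letterAt w.1 (ν x)).HasOffset u p → p ≤ o x := fun p hp => by
      simpa [expansion_point_le] using h _ (point_mem_expansion.2 ⟨(ν x).2, hp⟩)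
    refine ⟨?_, h'⟩
    by_contra hne
    obtain ⟨q, hq, hq'⟩ := WFLetter.exists_offset_gt (u := u) hne (o x)
    exact absurd (h' q hq') (not_le.2 hq)
  · rintro ⟨h1, h2⟩ z hz
    obtain ⟨i, p, rfl⟩ := exists_point_eq (u := u) z
    obtain ⟨hi, hp⟩ := point_mem_expansion.1 hz
    rw [right_eq_none_iff w (ν x).2] at h1
    rw [expansion_point_le]
    rcases eq_or_ne i (ν x) with rfl | hi'
    · exact .inr ⟨rfl, h2 p hp⟩
    · exact .inl (by omega)

/-- Every atomic formula becomes a Boolean combination of equality and order of positions,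
conditions on the letter at one variable, and conditions on the offsets alone. The offsets range
over an infinite set, but there are only finitely many sets of letters, so finitely many relations
occur. -/
theorem expansion_basic [Finite S] (V : Type) [DecidableEq V] (order : Bool)
    (D : Bool → Set (Rel {w : FreeSemigroup (WFLetter S) | WellFormed w} V))
    (hD : Logic order false D) : (expansion u).Basic (order := order) (en := true) D := by
  have := WFLetter.finite_letters (S := S)
  have eqMem : ∀ b x y, (Formula.atom (.eq x y)).rel _ ∈ D b := fun b x y => hD.atom b _ trivial
  refine ⟨fun b x => ?_, fun b t ht => ?_⟩
  · exact hD.finFamily_letterRel b x fun p => {b | b.HasOffset u p}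
  cases t with
  | label a x =>
    exact hD.finFamily_letterRel b x fun o : V → ℤ ×ₗ ℕ => {b | (letters (u (b.copy (ofLex (o x)).1))).getD
      (ofLex (o x)).2 (u (b.copy (ofLex (o x)).1)).head = a}
  | eq x y =>
    convert (FinFamily.const (eqMem b x y)).inf hD (hD.finFamily_constRel b
      fun o : V → ℤ ×ₗ ℕ => o x = o y) using 1
    funext o w ν
    simp [Interpretation.rel, Formula.SatOn, Atom.SatOn, expansion_point_eq, Formula.rel,
      constRel, Formula.Sat, Atom.Sat, Fin.ext_iff]
  | lt x y =>
    have ltMem : (Formula.atom (.lt x y)).rel _ ∈ D b := hD.atom b _ ht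
    convert (FinFamily.const ltMem).sup hD ((FinFamily.const (eqMem b x y)).inf hD
      (hD.finFamily_constRel b fun o : V → ℤ ×ₗ ℕ => o x < o y)) using 1
    funext o w ν
    simp [Interpretation.rel, Formula.SatOn, Atom.SatOn, expansion_point_lt, Formula.rel,
      constRel, Formula.Sat, Atom.Sat, Fin.ext_iff]
  | succ x y =>
    convert (FinFamily.const (eqMem b x y)).inf hD (hD.finFamily_letterRel b x
      fun o : V → ℤ ×ₗ ℕ => {b | o x < o y ∧
        ∀ p, b.HasOffset u p → ¬ (o x < p ∧ p < o y)}) using 1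
    funext o w ν
    exact propext (expansion_succ_iff w ν o x y)
  | isMin x =>
    convert hD.finFamily_letterRel b x
      fun o : V → ℤ ×ₗ ℕ => {b | b.left = none ∧ ∀ p, b.HasOffset u p → o x ≤ p} using 1
    funext o w ν
    exact propext (expansion_isMin_iff w ν o x)
  | isMax x =>
    convert hD.finFamily_letterRel b x
      fun o : V → ℤ ×ₗ ℕ => {b | b.right = none ∧ ∀ p, b.HasOffset u p → p ≤ o x} using 1
    funext o w ν
    exact propext (expansion_isMax_iff w ν o x)

/-- The word is spelled by the truncated expansion. Its value is `beta w` since repeating an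
idempotent does not change the product. -/
theorem exists_expanded_word (α : FreeSemigroup A →ₙ* S) (hu : ∀ s, α (u s) = s) (k : ℕ) :
    ∃ v : FreeSemigroup A, α v = beta w.1 ∧ Equivalent (letters v).get ((expansion u).label w) k
      univ ((expansion u).carrier w) := by
  -- At least one copy of each idempotent is required for the product to be right, even when no
  -- round is played.
  set K := max 1 (threshold k)
  have hK : 0 < K := lt_of_lt_of_le one_pos (le_max_left _ _)
  set l := ((letters w.1).flatMap (WFLetter.expand K)).flatMap fun s => letters (u s) with hl
  have hval : listValue α l = beta w.1 := by
    rw [hl, listValue_flatMap, ← listValue_letters beta, listValue]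
    simp only [listValue_letters, hu]
    induction letters w.1 with
    | nil => rfl
    | cons b l ih =>
      rw [List.flatMap_cons, List.map_append, List.prod_append, ih, List.map_cons, List.prod_cons,
        WFLetter.prod_expand hK, beta_of]
  obtain ⟨v, hv⟩ := exists_letters_eq (l := l) (by
    intro h0
    rw [h0, listValue_nil] at hval
    exact WithOne.one_ne_coe hval)
  refine ⟨v, ?_, ?_⟩
  · rw [← hv, listValue_letters] at hval
    exact WithOne.coe_inj.1 hval
  · have h1 := (spells_bounded w.2 K).subst (u := u)
    rw [← hl, ← hv] at h1
    exact (h1.equivalent k).trans (equivalent_bounded w.2 (le_max_right _ _)).subst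

end Forward

theorem separable_assoc_of_separable {A S : Type*} [Semigroup S] [Finite S]
    (F : Fragment) {α : FreeSemigroup A →ₙ* S} (hα : Function.Surjective α)
    {L L' : Set (FreeSemigroup A)} (hL : Recognizes α L) (hL' : Recognizes α L')
    (h : Separable (F.definable true A) L L') :
    Separable (F.definable false (WFLetter S)) (assoc α L) (assoc α L') := by
  obtain ⟨K, hK, h1, h2⟩ := h
  obtain ⟨P, rfl⟩ := hL
  obtain ⟨P', rfl⟩ := hL'
  choose u hu using hα
  obtain ⟨K', hK', k, h3⟩ := (expansion u).exists_definable
    (fun V _ _ order D hD => expansion_basic V order D hD) F hK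
  refine ⟨K', hK', fun w ⟨hw, hw'⟩ => ?_, ?_⟩
  -- The word `v` is only known to have the same value as some word of the language. Recognizability
  -- by `α` then puts `v` itself into the language.
  · obtain ⟨v, hv, hv'⟩ := exists_expanded_word ⟨w, hw⟩ α hu k
    obtain ⟨v', hv1, hv2⟩ := hw'
    exact (h3 _ v hv').2 (h1 (by rw [mem_preimage, hv, ← hv2]; exact hv1))
  · rw [eq_empty_iff_forall_notMem]
    rintro w ⟨hwK, hw, hw'⟩
    obtain ⟨v, hv, hv'⟩ := exists_expanded_word ⟨w, hw⟩ α hu k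
    obtain ⟨v', hv1, hv2⟩ := hw'
    rw [eq_empty_iff_forall_notMem] at h2
    exact h2 v ⟨(h3 ⟨w, hw⟩ v hv').1 hwK, by rw [mem_preimage, hv, ← hv2]; exact hv1⟩

end PlusOne

/-! ### From an F-separator to an F⁺-separator: cutting a word at stabilizing idempotents. -/

namespace PlusOne

open Set

/-! ## The well-formed word associated with a word -/

section Compress

universe u v

variable {A : Type u} {S : Type v} [Semigroup S] (α : FreeSemigroup A →ₙ* S)

open Classical in
/-- An idempotent that stabilizes an element of `S¹` on the right, if there is one. -/
noncomputable def stabilizer (x : WithOne S) : Option (Idem S) :=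
  if h : ∃ e : Idem S, x * (e.1 : WithOne S) = x then some h.choose else none

theorem stabilizer_spec {x : WithOne S} {e : Idem S} (h : stabilizer x = some e) :
    x * (e.1 : WithOne S) = x := by
  unfold stabilizer at h
  split_ifs at h with h'
  cases h
  exact h'.choose_spec

theorem stabilizer_ne_none {x : WithOne S} {e : Idem S} (h : x * (e.1 : WithOne S) = x) :
    stabilizer x ≠ none := by
  unfold stabilizer
  rw [dif_pos ⟨e, h⟩]
  simp

/-- The length of the windows that determine the cuts. -/
noncomputable def windowLength (S : Type v) : ℕ := Nat.card S + 2

/-- The idempotent at which a word is cut after a prefix, which is given in reversed order. -/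
noncomputable def cutIdem (h : List A) : Option (Idem S) :=
  stabilizer (listValue α (h.take (windowLength S)).reverse)

/-- If an idempotent stabilizes the value of a suffix on the right, it stabilizes the value of the
whole prefix, by multiplication on the left. -/
theorem cutIdem_spec {h : List A} {e : Idem S} (he : cutIdem α h = some e) :
    listValue α h.reverse * (e.1 : WithOne S) = listValue α h.reverse := by
  have := stabilizer_spec he
  conv_lhs => rw [← List.take_append_drop (windowLength S) h]
  conv_rhs => rw [← List.take_append_drop (windowLength S) h]
  rw [List.reverse_append, listValue_append, mul_assoc, this]

theorem cutIdem_take {h : List A} {n : ℕ} (hn : windowLength S ≤ n) :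
    cutIdem α (h.take n) = cutIdem α h := by
  rw [cutIdem, cutIdem, List.take_take, min_eq_left hn]

/-- The value of the segment that follows the last cut of a reversed prefix, and the idempotent at
this cut. -/
noncomputable def lastCut : List A → WithOne S × Option (Idem S)
  | [] => (1, none)
  | a :: h => match cutIdem α (a :: h) with
    | some e => (1, some e)
    | none => ((lastCut h).1 * α (.of a), (lastCut h).2)

theorem lastCut_of_some {a : A} {h : List A} {e : Idem S} (he : cutIdem α (a :: h) = some e) :
    lastCut α (a :: h) = (1, some e) := by
  rw [lastCut, he]

theorem lastCut_of_none {a : A} {h : List A} (he : cutIdem α (a :: h) = none) :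
    lastCut α (a :: h) = ((lastCut α h).1 * α (.of a), (lastCut α h).2) := by
  rw [lastCut, he]

/-- The product of an element of `S¹` and an element of `S`. -/
def mulOne (x : WithOne S) (s : S) : S := WithOne.recOneCoe s (fun t => t * s) x

theorem coe_mulOne (x : WithOne S) (s : S) : ((mulOne x s : S) : WithOne S) = x * s := by
  cases x with
  | one => simp [mulOne]
  | coe x => simp [mulOne]

open Classical in
/-- The letter of the segment that ends with the letter `a` after the reversed prefix `h`. -/
noncomputable def segment (a : A) (h : List A) (p : Prop) : WFLetter S :=
  .mk (lastCut α h).2 (mulOne (lastCut α h).1 (α (.of a))) (if p then none else cutIdem α (a :: h))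

/-- Whether a segment ends with the letter `a` after the reversed prefix `h`. -/
def IsCut (a : A) (h : List A) (p : Prop) : Prop := p ∨ cutIdem α (a :: h) ≠ none

open Classical in
/-- The sequence of the segments that end in the list, the reversed prefix being given. -/
noncomputable def compress : List A → List A → List (WFLetter S)
  | _, [] => []
  | h, a :: l =>
    if IsCut α a h (l = []) then segment α a h (l = []) :: compress (a :: h) l
    else compress (a :: h) l

/-- The right idempotent of a segment is the one remembered by `lastCut` until the next cut, where
it becomes the left idempotent of the following segment. -/
theorem linked_compress (h : List A) {l : List A} (hl : l ≠ []) :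
    Linked (lastCut α h).2 (compress α h l) := by
  induction l generalizing h with
  | nil => exact absurd rfl hl
  | cons a l ih =>
    rcases eq_or_ne l [] with rfl | hl'
    · simp [compress, IsCut, segment, Linked]
    have ih := ih (a :: h) hl'
    cases hc : cutIdem α (a :: h) with
    | none =>
      rw [compress, if_neg (by simp [IsCut, hl', hc])]
      rwa [lastCut_of_none α hc] at ih
    | some e =>
      rw [compress, if_pos (by simp [IsCut, hc])]
      rw [lastCut_of_some α hc] at ih
      have hne : compress α (a :: h) l ≠ [] := by
        intro h0; rw [h0] at ih; exact ih
      simp [segment, Linked, hl', hc, hne, ih]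

/-- Here `x` is the value of the prefix up to the last cut. It absorbs the idempotent of this cut,
so inserting idempotents at the cuts leaves the total product unchanged. -/
theorem listValue_compress (h : List A) {l : List A} (hl : l ≠ []) (x : WithOne S)
    (hx : x * WFLetter.idemValue (lastCut α h).2 = x)
    (hx' : x * (lastCut α h).1 = listValue α h.reverse) :
    x * listValue beta (compress α h l) = listValue α h.reverse * listValue α l := by
  induction l generalizing h x with
  | nil => exact absurd rfl hl
  | cons a l ih =>
    rcases eq_or_ne l [] with rfl | hl'
    · simp [compress, IsCut, segment, beta_of, WFLetter.coe_value, coe_mulOne, ← mul_assoc, hx, hx']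
    have hrev : listValue α (a :: h).reverse = listValue α h.reverse * α (.of a) := by simp
    cases hc : cutIdem α (a :: h) with
    | none =>
      rw [compress, if_neg (by simp [IsCut, hl', hc])]
      have := ih (a :: h) hl' x
      rw [lastCut_of_none α hc] at this
      rw [this hx (by rw [← mul_assoc, hx', hrev]), hrev, listValue_cons, mul_assoc]
    | some e =>
      rw [compress, if_pos (by simp [IsCut, hc])]
      -- At a cut the whole prefix read so far takes over the role of `x`.
      have := ih (a :: h) hl' (listValue α (a :: h).reverse)
      rw [lastCut_of_some α hc] at this
      have he := cutIdem_spec α hc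
      have := this he (mul_one _)
      rw [listValue_cons, beta_of, WFLetter.coe_value]
      simp only [segment, WFLetter.left_mk, WFLetter.mid_mk, WFLetter.right_mk, hl', if_false, hc,
        coe_mulOne, WFLetter.idemValue_some]
      simp only [← mul_assoc]
      rw [hx, hx',
        ← hrev, he, this, hrev, listValue_cons, mul_assoc]

/-- The part of a word before a position, in reversed order. -/
def history (w : FreeSemigroup A) (i : ℕ) : List A := ((letters w).take i).reverse

theorem history_zero (w : FreeSemigroup A) : history w 0 = [] := rfl

theorem history_succ {w : FreeSemigroup A} {i : ℕ} (hi : i < (letters w).length) :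
    history w (i + 1) = letterAt w i :: history w i := by
  rw [history, history, List.take_add_one, getElem?_letterAt hi]
  simp

/-- The segment that ends at a position. -/
noncomputable def segmentAt (w : FreeSemigroup A) (i : ℕ) : WFLetter S :=
  segment α (letterAt w i) (history w i) (i + 1 = (letters w).length)

/-- The positions at which a segment ends. -/
def cuts (w : FreeSemigroup A) : Set ℕ :=
  {i | i < (letters w).length ∧
    IsCut α (letterAt w i) (history w i) (i + 1 = (letters w).length)}

theorem spells_compress (w : FreeSemigroup A) (h l : List A) (hw : letters w = h.reverse ++ l) :
    Spells (segmentAt α w) {i ∈ cuts α w | h.length ≤ i} (compress α h l) := by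
  induction l generalizing h with
  | nil =>
    rw [compress, Spells]
    ext i
    have : (letters w).length = h.length := by rw [hw]; simp
    simp only [cuts, mem_ofPred_eq, mem_empty_iff_false, iff_false]
    omega
  | cons a l ih =>
    have ih := ih (a :: h) (by simp [hw])
    have hlen : (letters w).length = h.length + l.length + 1 := by rw [hw]; simp; omega
    have hlt : h.length < (letters w).length := by omega
    have hget : letterAt w h.length = a := by
      have := getElem?_letterAt hlt
      rw [hw, List.getElem?_append_right (by simp)] at this
      simpa using this.symm
    have hhist : history w h.length = h := by
      rw [history, hw]
      simp
    have hlast : h.length + 1 = (letters w).length ↔ l = [] := by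
      rw [hlen, ← List.length_eq_zero_iff]; omega
    have hcut : h.length ∈ cuts α w ↔ IsCut α a h (l = []) := by
      simp only [cuts, mem_ofPred_eq, hget, hhist, hlast, hlt, true_and]
    rw [compress]
    by_cases hc : IsCut α a h (l = [])
    · rw [if_pos hc]
      refine ⟨h.length, ⟨hcut.2 hc, le_rfl⟩, ?_, ?_, ?_⟩
      · simp only [segmentAt, hget, hhist, hlast]
      · ext i
        simp only [mem_inter_iff, mem_ofPred_eq, mem_Iio, mem_empty_iff_false, iff_false]
        omega
      · convert ih using 1
        ext i
        simp only [mem_inter_iff, mem_ofPred_eq, mem_Ioi, List.length_cons]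
        constructor
        · rintro ⟨⟨h1, h2⟩, h3⟩; exact ⟨h1, h3⟩
        · rintro ⟨h1, h2⟩; exact ⟨⟨h1, by omega⟩, h2⟩
    · rw [if_neg hc]
      convert ih using 1
      ext i
      simp only [mem_ofPred_eq, List.length_cons]
      refine and_congr_right fun hi => ⟨fun h1 => ?_, fun h1 => by omega⟩
      rcases h1.eq_or_lt with rfl | h2
      · exact absurd (hcut.1 hi) hc
      · exact h2

theorem exists_compressed_word (w : FreeSemigroup A) :
    ∃ v : FreeSemigroup (WFLetter S), WellFormed v ∧ beta v = α w ∧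
      ∀ k, Equivalent (letters v).get (segmentAt α w) k univ (cuts α w) := by
  have hne : letters w ≠ [] := List.cons_ne_nil _ _
  have h1 := linked_compress α [] hne
  have h2 := listValue_compress α [] hne 1 (by simp [lastCut, WFLetter.idemValue])
    (by simp [lastCut])
  have h3 := spells_compress α w [] (letters w) rfl
  obtain ⟨v, hv⟩ := exists_letters_eq (l := compress α [] (letters w)) (by
    intro h0; rw [h0] at h1; exact h1)
  rw [← hv] at h1 h2 h3
  refine ⟨v, (wellFormed_iff_linked v).2 h1, ?_, fun k => ?_⟩
  · simpa using h2
  · convert h3.equivalent k using 1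
    ext i; simp

/-! ## Locality of the cuts -/

/-- The elements that stabilize `x` form a nonempty finite subsemigroup, which contains an
idempotent. The existence theorem for compact semigroups is used with the discrete topology. -/
theorem exists_idem_of_mul_eq [Finite S] {x : WithOne S} {s : S} (h : x * (s : WithOne S) = x) :
    ∃ e : Idem S, x * (e.1 : WithOne S) = x := by
  let _ : TopologicalSpace S := ⊥
  have : DiscreteTopology S := ⟨rfl⟩
  obtain ⟨e, he, he'⟩ := exists_idempotent_in_compact_subsemigroup
    (fun _ => continuous_of_discreteTopology) {t : S | x * (t : WithOne S) = x} ⟨s, h⟩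
    (toFinite _).isCompact (fun a ha b hb => by
      change x * ((a * b : S) : WithOne S) = x
      rw [WithOne.coe_mul, ← mul_assoc, show x * (a : WithOne S) = x from ha]
      exact hb)
  exact ⟨⟨e, he'⟩, he⟩

theorem exists_coe_listValue {l : List A} (hl : l ≠ []) :
    ∃ s : S, listValue α l = s := by
  obtain ⟨w, rfl⟩ := exists_letters_eq hl
  exact ⟨α w, listValue_letters α w⟩

/-- Among the nonempty prefixes of a window of `|S| + 2` letters two have the same value `x`,
because `S¹` has only `|S| + 1` elements. The factor between them stabilizes `x`, so some idempotent
does too, and there is a cut after the shorter prefix. -/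
theorem exists_cut [Finite S] {h : List A} (hh : windowLength S ≤ h.length) :
    ∃ t < windowLength S, cutIdem α (h.drop t) ≠ none := by
  set N := windowLength S with hN
  set g := (h.take N).reverse with hg
  have hgl : g.length = N := by simp [hg, hh]
  have hfin : Finite (WithOne S) := inferInstanceAs (Finite (Option S))
  have hcard : Nat.card (WithOne S) = Nat.card S + 1 := Finite.card_option
  obtain ⟨i, j, heq, hij⟩ : ∃ i j : Fin N,
      listValue α (g.take (i + 1)) = listValue α (g.take (j + 1)) ∧ i < j := by
    by_contra! hcon
    have hinj : Function.Injective fun i : Fin N => listValue α (g.take (i + 1)) := by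
      intro i j hij
      rcases lt_trichotomy i j with hlt | heq | hlt
      · exact absurd hlt (hcon i j hij).not_gt
      · exact heq
      · exact absurd hlt (hcon j i hij.symm).not_gt
    have := Nat.card_le_card_of_injective _ hinj
    rw [hcard, Nat.card_fin, hN, windowLength] at this
    omega
  have hiN := i.2
  have hjN := j.2
  have hij' : (i : ℕ) < j := hij
  have hsplit : g.take (j + 1) = g.take (i + 1) ++ (g.drop (i + 1)).take (j - i) := by
    rw [← List.take_add]; congr 1; omega
  obtain ⟨s, hs⟩ := exists_coe_listValue α (l := (g.drop (i + 1)).take (j - i)) (by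
    intro h0
    have := congrArg List.length h0
    simp [hgl] at this
    omega)
  rw [hsplit, listValue_append, hs] at heq
  obtain ⟨e, he⟩ := exists_idem_of_mul_eq heq.symm
  -- Dropping these letters leaves a history that ends with the shorter of the two prefixes.
  refine ⟨N - (i + 1), by omega, stabilizer_ne_none (e := e) ?_⟩
  have hpart : ((h.drop (N - (i + 1))).take (i + 1)).reverse = g.take (i + 1) := by
    rw [hg, List.take_reverse, List.length_take, min_eq_left hh, List.drop_take]
    congr 2
    omega
  -- The window that decides the cut at this place reaches further to the left than `g`; the extra
  -- letters only multiply on the left and preserve the stabilization.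
  have hsuffix : ((h.drop (N - (i + 1))).take N).reverse =
      (((h.drop (N - (i + 1))).take N).drop (i + 1)).reverse ++ g.take (i + 1) := by
    rw [← hpart, ← List.reverse_append, show ((h.drop (N - (i + 1))).take (i + 1 : ℕ)) =
      (((h.drop (N - (i + 1))).take N).take (i + 1)) by rw [List.take_take, min_eq_left hiN],
      List.take_append_drop]
  rw [← hN, hsuffix, listValue_append, mul_assoc, he]

/-- Reading backwards, `lastCut` stops at the latest at the cut at distance `t`. At each place
visited, `windowLength S` more letters decide whether there is a cut. -/
theorem lastCut_take_of_cut {h : List A} {n t : ℕ} (ht : t < n) (hc : cutIdem α (h.drop t) ≠ none) :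
    lastCut α (h.take (n + windowLength S)) = lastCut α h := by
  induction n generalizing h t with
  | zero => omega
  | succ n ih =>
    cases h with
    | nil => simp
    | cons a h =>
      have hcut : cutIdem α (a :: h.take (n + windowLength S)) = cutIdem α (a :: h) := by
        rw [← cutIdem_take α (show windowLength S ≤ n + windowLength S + 1 by omega) (h := a :: h),
          List.take_succ_cons]
      rw [show n + 1 + windowLength S = n + windowLength S + 1 by omega, List.take_succ_cons]
      cases hc' : cutIdem α (a :: h) with
      | some e => rw [lastCut_of_some α hc', lastCut_of_some α (hcut.trans hc')]
      | none =>
        rw [lastCut_of_none α hc', lastCut_of_none α (hcut.trans hc')]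
        cases t with
        | zero => exact absurd hc' hc
        | succ t => rw [ih (t := t) (by omega) (by simpa using hc)]

theorem lastCut_take [Finite S] (h : List A) :
    lastCut α (h.take (windowLength S + windowLength S)) = lastCut α h := by
  rcases le_or_gt (windowLength S) h.length with hh | hh
  · obtain ⟨t, ht, hc⟩ := exists_cut α hh
    exact lastCut_take_of_cut α ht hc
  · rw [List.take_of_length_le (by omega)]

theorem segment_take [Finite S] (a : A) (h : List A) (p : Prop) :
    segment α a (h.take (windowLength S + windowLength S)) p = segment α a h p := by
  have : cutIdem α (a :: h.take (windowLength S + windowLength S)) = cutIdem α (a :: h) := by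
    rw [← cutIdem_take α (show windowLength S ≤ windowLength S + windowLength S + 1 by omega)
      (h := a :: h), List.take_succ_cons]
  rw [segment, segment, lastCut_take, this]

theorem isCut_take [Finite S] (a : A) (h : List A) (p : Prop) :
    IsCut α a (h.take (windowLength S + windowLength S)) p ↔ IsCut α a h p := by
  have : cutIdem α (a :: h.take (windowLength S + windowLength S)) = cutIdem α (a :: h) := by
    rw [← cutIdem_take α (show windowLength S ≤ windowLength S + windowLength S + 1 by omega)
      (h := a :: h), List.take_succ_cons]
  rw [IsCut, IsCut, this]

end Compress

/-! ## Definability of local properties -/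

section Local

universe u

variable {A : Type u} {V : Type} [DecidableEq V] {order : Bool}
  {D : Bool → Set (Rel (univ : Set (FreeSemigroup A)) V)}

/-- A property of a position of a word, as a relation. -/
def posRel (x : V) (U : FreeSemigroup A → ℕ → Prop) : Rel (univ : Set (FreeSemigroup A)) V :=
  fun w ν => U w.1 (ν x)

/-- Properties of positions that are definable in both of the dual classes. -/
def IsLocal (D : Bool → Set (Rel (univ : Set (FreeSemigroup A)) V))
    (U : FreeSemigroup A → ℕ → Prop) : Prop :=
  ∀ b x, posRel x U ∈ D b

theorem IsLocal.congr {V : Type} {D : Bool → Set (Rel (univ : Set (FreeSemigroup A)) V)}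
    {U U' : FreeSemigroup A → ℕ → Prop} (h : IsLocal D U)
    (hU : ∀ w i, i < (letters w).length → (U w i ↔ U' w i)) : IsLocal D U' := by
  intro b x
  convert h b x using 1
  funext w ν
  exact propext (hU w.1 (ν x) (ν x).2).symm

theorem IsLocal.and (hD : Logic order true D) {U U' : FreeSemigroup A → ℕ → Prop}
    (h : IsLocal D U) (h' : IsLocal D U') : IsLocal D fun w i => U w i ∧ U' w i :=
  fun b x => hD.inf (h b x) (h' b x)

theorem IsLocal.or (hD : Logic order true D) {U U' : FreeSemigroup A → ℕ → Prop}
    (h : IsLocal D U) (h' : IsLocal D U') : IsLocal D fun w i => U w i ∨ U' w i :=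
  fun b x => hD.sup (h b x) (h' b x)

theorem IsLocal.not (hD : Logic order true D) {U : FreeSemigroup A → ℕ → Prop}
    (h : IsLocal D U) : IsLocal D fun w i => ¬ U w i :=
  fun b x => hD.compl' (h (!b) x)

theorem IsLocal.exists (hD : Logic order true D) {ι : Type*} [Finite ι]
    {U : ι → FreeSemigroup A → ℕ → Prop} (h : ∀ i, IsLocal D (U i)) :
    IsLocal D fun w n => ∃ i, U i w n := by
  intro b x
  convert hD.iSup fun i => h i b x using 1
  funext w ν
  simp [posRel]

theorem IsLocal.const (hD : Logic order true D) (p : Prop) :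
    IsLocal D fun (_ : FreeSemigroup A) _ => p :=
  fun b _ => hD.constRel_mem b p

theorem isLocal_isMin (hD : Logic order true D) : IsLocal D fun (_ : FreeSemigroup A) i => i = 0 :=
  fun b x => hD.atom b (.isMin x) rfl

theorem isLocal_isMax (hD : Logic order true D) :
    IsLocal D fun (w : FreeSemigroup A) i => i + 1 = (letters w).length :=
  fun b x => hD.atom b (.isMax x) rfl

theorem isLocal_letter (hD : Logic order true D) (a : A) :
    IsLocal D fun w i => letterAt w i = a := by
  intro b x
  convert hD.atom b (.label a x) trivial using 1
  funext w ν
  simp [posRel, Formula.rel, Formula.Sat, Atom.Sat, letterAt_fin]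

/-- Existentially: some predecessor satisfies `U`. Universally: the position is not the first one
and no predecessor violates `U`. Both describe the same property since the predecessor is unique, so
it lies in both dual classes. The quantified variable is any one other than `x`, which makes two
variables suffice. -/
theorem IsLocal.prev [Nontrivial V] (hD : Logic order true D) {U : FreeSemigroup A → ℕ → Prop}
    (h : IsLocal D U) : IsLocal D fun w i => 0 < i ∧ U w (i - 1) := by
  have main : ∀ {U : FreeSemigroup A → ℕ → Prop}, IsLocal D U → ∀ x,
      posRel x (fun w i => 0 < i ∧ U w (i - 1)) ∈ D true := by
    intro U h x
    obtain ⟨y, hy⟩ := exists_ne x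
    convert hD.ex y (hD.inf (hD.atom true (.succ y x) rfl) (h true y)) using 1
    funext w ν
    simp only [posRel, exRel, Pi.inf_apply, Formula.rel, Formula.Sat, Atom.Sat,
      Function.update_self, Function.update_of_ne hy.symm, inf_Prop_eq, eq_iff_iff]
    constructor
    · rintro ⟨h1, h2⟩
      exact ⟨⟨ν x - 1, by have := (ν x).2; omega⟩, by simp only; omega, h2⟩
    · rintro ⟨i, h1, h2⟩
      rw [h1]
      exact ⟨Nat.succ_pos _, h2⟩
  intro b x
  cases b with
  | true => exact main h x
  | false =>
    have h1 := hD.compl' (b := false) (main (h.not hD) x)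
    have h2 := ((isLocal_isMin hD).not hD) false x
    convert hD.inf h1 h2 using 1
    funext w ν
    simp only [posRel, Pi.inf_apply, Pi.compl_apply, inf_Prop_eq, compl_iff_not, eq_iff_iff]
    constructor
    · rintro ⟨h3, h4⟩; exact ⟨fun h => h.2 h4, by omega⟩
    · rintro ⟨h3, h4⟩
      have : 0 < (ν x : ℕ) := by omega
      exact ⟨this, by by_contra h5; exact h3 ⟨this, h5⟩⟩

theorem isLocal_history [Nontrivial V] (hD : Logic order true D) (m : ℕ) (v : List A) :
    IsLocal D fun w i => (history w i).take m = v := by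
  induction m generalizing v with
  | zero => simpa using IsLocal.const hD ([] = v)
  | succ m ih =>
    cases v with
    | nil =>
      refine (isLocal_isMin hD).congr fun w i hi => ?_
      cases i with
      | zero => simp [history_zero]
      | succ i => simp [history_succ (show i < (letters w).length by omega)]
    | cons a v =>
      refine (((isLocal_letter hD a).and hD (ih v)).prev hD).congr fun w i hi => ?_
      cases i with
      | zero => simp [history_zero]
      | succ i => simp [history_succ (show i < (letters w).length by omega)]

/-- Over a finite alphabet a window of bounded length has finitely many possible contents; the
property is the disjunction over those that `f` accepts. The last component records whether the
position is the last one. -/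
theorem isLocal_window [Finite A] [Nontrivial V] (hD : Logic order true D) (m : ℕ)
    (f : A → List A → Prop → Prop) :
    IsLocal D fun w i => f (letterAt w i) ((history w i).take m) (i + 1 = (letters w).length) := by
  have : Finite {v : List A // v.length ≤ m} := (List.finite_length_le A m).to_subtype
  refine (IsLocal.exists hD (ι := A × {v : List A // v.length ≤ m} × Prop) fun p =>
    ((isLocal_letter hD p.1).and hD ((isLocal_history hD m p.2.1.1).and hD
      (((isLocal_isMax hD).and hD (IsLocal.const hD p.2.2)).or hD
        (((isLocal_isMax hD).not hD).and hD (IsLocal.const hD ¬ p.2.2))))).and hD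
      (IsLocal.const hD (f p.1 p.2.1.1 p.2.2))).congr fun w i _ => ?_
  constructor
  · rintro ⟨⟨a, ⟨v, hv⟩, p⟩, ⟨h1, h2, h3⟩, h4⟩
    simp only at h1 h2 h3 h4
    subst h1 h2
    have hp : p = (i + 1 = (letters w).length) := propext (by tauto)
    rwa [hp] at h4
  · intro h
    exact ⟨⟨letterAt w i, ⟨(history w i).take m, by simp⟩, i + 1 = (letters w).length⟩,
      ⟨rfl, rfl, by tauto⟩, h⟩

end Local

/-! ## From fragments over the alphabet of well-formed words to enriched fragments -/

section Backward

universe u v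

variable {A : Type u} {S : Type v} [Semigroup S] (α : FreeSemigroup A →ₙ* S)

/-- The interpretation of the word of segments in the given word. -/
noncomputable def segmentation : Interpretation (univ : Set (FreeSemigroup A)) (WFLetter S) ℕ
    Unit where
  label w := segmentAt α w.1
  carrier w := cuts α w.1
  point i _ := i
  guard w i _ := (i : ℕ) ∈ cuts α w.1
  mem_carrier _ i := ⟨fun h => ⟨⟨i, h.1⟩, (), h, rfl⟩, fun ⟨_, _, h, h'⟩ => h' ▸ h⟩

/-- By `isCut_take` and `segment_take`, being a cut and the letter of a segment depend on at most `2
* windowLength S` preceding letters. The order of the segments is that of the positions where they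
end, so `<` and equality are unchanged. -/
theorem segmentation_basic [Finite A] [Finite S] (V : Type) [DecidableEq V] [Nontrivial V]
    (order : Bool) (D : Bool → Set (Rel (univ : Set (FreeSemigroup A)) V))
    (hD : Logic order true D) : (segmentation α).Basic (order := order) (en := false) D := by
  refine ⟨fun b x => FinFamily.of_finite fun _ => ?_, fun b t ht => ?_⟩
  · have := isLocal_window hD (windowLength S + windowLength S) (IsCut α)
    simp only [isCut_take] at this
    exact (this.congr fun _ i hi => (show i ∈ cuts α _ ↔ _ from
      ⟨fun h => h.2, fun h => ⟨hi, h⟩⟩).symm) b x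
  cases t with
  | label a x =>
    refine FinFamily.const (R := posRel x fun w i => segmentAt α w i = a) ?_
    have := isLocal_window hD (windowLength S + windowLength S) fun a' h p => segment α a' h p = a
    simp only [segment_take] at this
    exact this b x
  | eq x y =>
    convert FinFamily.const (hD.atom b (.eq x y) trivial) using 1
    funext o w ν
    simp [Interpretation.rel, Formula.SatOn, Atom.SatOn, segmentation, Formula.rel, Formula.Sat,
      Atom.Sat, Fin.ext_iff]
  | lt x y => exact FinFamily.const (hD.atom b (.lt x y) ht)
  | succ x y => cases ht
  | isMin x => cases ht
  | isMax x => cases ht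

end Backward

theorem separable_of_separable_assoc {A S : Type*} [Finite A] [Semigroup S] [Finite S]
    (F : Fragment) (α : FreeSemigroup A →ₙ* S) {L L' : Set (FreeSemigroup A)}
    (h : Separable (F.definable false (WFLetter S)) (assoc α L) (assoc α L')) :
    Separable (F.definable true A) L L' := by
  obtain ⟨K, hK, h1, h2⟩ := h
  obtain ⟨K', hK', k, h3⟩ := (segmentation α).exists_definable
    (fun V _ _ order D hD => segmentation_basic α V order D hD) F hK
  refine ⟨K', hK', fun w hw => ?_, ?_⟩
  · obtain ⟨v, hv1, hv2, hv3⟩ := exists_compressed_word α w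
    exact (h3 ⟨w, trivial⟩ v (hv3 k)).2 (h1 ⟨hv1, w, hw, hv2.symm⟩)
  · rw [eq_empty_iff_forall_notMem]
    rintro w ⟨hwK, hw⟩
    obtain ⟨v, hv1, hv2, hv3⟩ := exists_compressed_word α w
    rw [eq_empty_iff_forall_notMem] at h2
    exact h2 v ⟨(h3 ⟨w, trivial⟩ v (hv3 k)).1 hwK, hv1, w, hw, hv2.symm⟩

theorem separable_iff_separable_assoc {A S : Type*} [Finite A] [Semigroup S] [Finite S]
    (F : Fragment) (α : FreeSemigroup A →ₙ* S) (hα : Function.Surjective α)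
    (L L' : Set (FreeSemigroup A)) (hL : Recognizes α L) (hL' : Recognizes α L') :
    Separable (F.definable true A) L L' ↔
      Separable (F.definable false (WFLetter S)) (assoc α L) (assoc α L') :=
  ⟨separable_assoc_of_separable F hα hL hL', separable_of_separable_assoc F α⟩

end PlusOne

/-! ### The effective reduction: coded letters and simulating automata. -/

namespace PlusOne

open Encodable

/-! ## Coding of words and letters by natural numbers -/

/-- The word over `{0, …, k - 1}` with a given code. -/
def codeWord (k c : ℕ) : List ℕ :=
  (c.unpair.1 % k) :: ((decode (α := List ℕ) c.unpair.2).getD []).map (· % k)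

/-- The repetition of a word that is given by the successor of its code; it is empty for `0`. -/
def codePower (k m l : ℕ) : List ℕ :=
  Nat.casesOn l [] fun e => (List.replicate m (codeWord k e)).flatten

/-- The code of the left idempotent of a coded letter. -/
def leftCode (c : ℕ) : ℕ := c.unpair.1

/-- The code of the central element of a coded letter. -/
def midCode (c : ℕ) : ℕ := c.unpair.2.unpair.1

/-- The code of the right idempotent of a coded letter. -/
def rightCode (c : ℕ) : ℕ := c.unpair.2.unpair.2

/-- The word that represents a coded letter. -/
def codeLetter (k m c : ℕ) : List ℕ :=
  codePower k m (leftCode c) ++ (codeWord k (midCode c) ++ codePower k m (rightCode c))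

/-- The idempotent expected after a coded letter: its code plus two, or `0` at the end. -/
def nextMemory (c : ℕ) : ℕ := Nat.casesOn (rightCode c) 0 fun r => r + 2

/-- The states that can be reached from the states of a list by reading a letter. -/
def stepStates (M : NFACode) (Q : List ℕ) (a : ℕ) : List ℕ :=
  Q.flatMap fun p => M.1.flatMap fun t => if t.1 = p ∧ t.2.1 = a then [t.2.2] else []

/-- The states that can be reached from the states of a list by reading a word. -/
def evalStates (M : NFACode) (Q : List ℕ) (v : List ℕ) : List ℕ := v.foldl (stepStates M) Q

/-- The automaton over coded letters that simulates an automaton and checks that idempotents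
match. -/
def simulate (k m k' : ℕ) (M : NFACode) : NFACode :=
  ((List.range k').flatMap fun c => M.1.flatMap fun t =>
    (evalStates M [t.1] (codeLetter k m c)).map fun q =>
      (Nat.pair t.1 (leftCode c + 1), c, Nat.pair q (nextMemory c)),
   M.2.1.map fun p => Nat.pair p 1, M.2.2.map fun q => Nat.pair q 0)

/-- A bound on the codes of the lists of length `n` with entries at most `k`. -/
def listBound (k n : ℕ) : ℕ := Nat.rec 0 (fun _ b => Nat.succ (Nat.pair k b)) n

/-- A bound on the size of the transition semigroup of two automata. -/
def sizeBound (n : ℕ) : ℕ := 2 ^ (n * n) * 2 ^ (n * n) + 1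

/-- A bound on the codes of the words of length at most `n + 1` over `{0, …, k - 1}`. -/
def wordBound (k n : ℕ) : ℕ := Nat.pair k (listBound k n)

/-- The size of the new alphabet, if codes of words up to `b` are needed. -/
def alphabetSize (k b : ℕ) : ℕ := k * (Nat.pair (b + 1) (Nat.pair b (b + 1)) + 1)

/-- The reduction. -/
def reduction (I : SepInstance) : SepInstance :=
  -- All states that occur in transitions are below `encode I + 1`, so `N` bounds the transition
  -- semigroup with a unit adjoined. Therefore `N!`-th powers in it are idempotent.
  let N := sizeBound (encode I + 1)
  let k' := alphabetSize I.1 (wordBound I.1 N)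
  (k', simulate I.1 N.factorial k' I.2.1, simulate I.1 N.factorial k' I.2.2)

/-! ## Computability of the reduction -/

section Computability

open Primrec

theorem primrec_nat_pow : Primrec₂ fun a b : ℕ => a ^ b := Primrec₂.unpaired'.1 Nat.Primrec.pow

theorem primrec_factorial : Primrec Nat.factorial := by
  refine (Primrec.nat_rec₁ (f := fun n b => (n + 1) * b) 1
    (nat_mul.comp (succ.comp .fst) .snd)).of_eq fun n => ?_
  induction n with
  | zero => rfl
  | succ n ih => exact congrArg ((n + 1) * ·) ih

theorem primrec_sizeBound : Primrec sizeBound := by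
  have h : Primrec fun n : ℕ => 2 ^ (n * n) :=
    primrec_nat_pow.comp (.const 2) (nat_mul.comp .id .id)
  exact succ.comp (nat_mul.comp h h)

theorem primrec_listBound : Primrec₂ listBound := by
  refine Primrec.nat_rec (f := fun _ : ℕ => 0)
    (g := fun k (p : ℕ × ℕ) => Nat.succ (Nat.pair k p.2)) (.const 0) ?_
  exact succ.comp (Primrec₂.natPair.comp .fst (snd.comp .snd))

theorem primrec_wordBound : Primrec₂ wordBound :=
  Primrec₂.natPair.comp .fst primrec_listBound

theorem primrec_alphabetSize : Primrec₂ alphabetSize := by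
  have h : Primrec fun p : ℕ × ℕ => p.2 + 1 := succ.comp .snd
  exact nat_mul.comp .fst
    (succ.comp (Primrec₂.natPair.comp h (Primrec₂.natPair.comp .snd h)))

theorem primrec_codeWord : Primrec₂ codeWord := by
  have hu : Primrec fun p : ℕ × ℕ => p.2.unpair := unpair.comp .snd
  refine list_cons.comp (nat_mod.comp (fst.comp hu) .fst) (list_map ?_ ?_)
  · exact option_getD.comp (Primrec.decode.comp (snd.comp hu)) (.const [])
  · exact nat_mod.comp .snd (fst.comp .fst)

theorem primrec_codePower : Primrec fun p : (ℕ × ℕ) × ℕ => codePower p.1.1 p.1.2 p.2 := by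
  refine nat_casesOn .snd (.const []) ?_
  refine list_flatten.comp ?_
  have : Primrec fun q : ((ℕ × ℕ) × ℕ) × ℕ =>
      (List.range q.1.1.2).map fun _ => codeWord q.1.1.1 q.2 :=
    list_map (list_range.comp (snd.comp (fst.comp .fst)))
      (primrec_codeWord.comp (fst.comp (fst.comp (fst.comp .fst))) (snd.comp .fst))
  refine this.of_eq fun q => ?_
  simp

theorem primrec_leftCode : Primrec leftCode := fst.comp unpair

theorem primrec_midCode : Primrec midCode := fst.comp (unpair.comp (snd.comp unpair))

theorem primrec_rightCode : Primrec rightCode := snd.comp (unpair.comp (snd.comp unpair))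

theorem primrec_codeLetter : Primrec fun p : (ℕ × ℕ) × ℕ => codeLetter p.1.1 p.1.2 p.2 := by
  refine list_append.comp (primrec_codePower.comp (.pair .fst (primrec_leftCode.comp .snd)))
    (list_append.comp (primrec_codeWord.comp (fst.comp .fst) (primrec_midCode.comp .snd))
      (primrec_codePower.comp (.pair .fst (primrec_rightCode.comp .snd))))

theorem primrec_nextMemory : Primrec nextMemory :=
  nat_casesOn primrec_rightCode (.const 0) (succ.comp (succ.comp .snd))

theorem primrec_stepStates : Primrec fun p : NFACode × List ℕ × ℕ => stepStates p.1 p.2.1 p.2.2 := by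
  refine list_flatMap (fst.comp .snd) ?_
  have h : Primrec fun q : ((NFACode × List ℕ × ℕ) × ℕ) × (ℕ × ℕ × ℕ) =>
      if q.2.1 = q.1.2 ∧ q.2.2.1 = q.1.1.2.2 then [q.2.2.2] else [] := by
    refine Primrec.ite (PrimrecPred.and ?_ ?_) (list_cons.comp (snd.comp (snd.comp .snd)) (.const []))
      (.const [])
    · exact Primrec.eq.comp (fst.comp .snd) (snd.comp .fst)
    · exact Primrec.eq.comp (fst.comp (snd.comp .snd)) (snd.comp (snd.comp (fst.comp .fst)))
  exact list_flatMap (fst.comp (fst.comp .fst)) h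

theorem primrec_evalStates :
    Primrec fun p : NFACode × List ℕ × List ℕ => evalStates p.1 p.2.1 p.2.2 := by
  refine list_foldl (snd.comp .snd) (fst.comp .snd)
    (h := fun p (q : List ℕ × ℕ) => stepStates p.1 q.1 q.2) ?_
  exact primrec_stepStates.comp (.pair (fst.comp .fst) .snd)

theorem primrec_codeLetter_comp {X : Type*} [Primcodable X] {f g h : X → ℕ} (hf : Primrec f)
    (hg : Primrec g) (hh : Primrec h) : Primrec fun x => codeLetter (f x) (g x) (h x) :=
  primrec_codeLetter.comp (.pair (.pair hf hg) hh)

theorem primrec_evalStates_comp {X : Type*} [Primcodable X] {M : X → NFACode} {f g : X → List ℕ}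
    (hM : Primrec M) (hf : Primrec f) (hg : Primrec g) :
    Primrec fun x => evalStates (M x) (f x) (g x) :=
  primrec_evalStates.comp (.pair hM (.pair hf hg))

theorem primrec_simulate_states :
    Primrec fun q : (((ℕ × ℕ × ℕ) × NFACode) × ℕ) × (ℕ × ℕ × ℕ) =>
      evalStates q.1.1.2 [q.2.1] (codeLetter q.1.1.1.1 q.1.1.1.2.1 q.1.2) := by
  have h1 : Primrec fun q : (((ℕ × ℕ × ℕ) × NFACode) × ℕ) × (ℕ × ℕ × ℕ) => q.1.1.1 :=
    fst.comp (fst.comp .fst)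
  have hM : Primrec fun q : (((ℕ × ℕ × ℕ) × NFACode) × ℕ) × (ℕ × ℕ × ℕ) => q.1.1.2 :=
    snd.comp (fst.comp .fst)
  have hk : Primrec fun q : (((ℕ × ℕ × ℕ) × NFACode) × ℕ) × (ℕ × ℕ × ℕ) => q.1.1.1.1 :=
    fst.comp h1
  have hm : Primrec fun q : (((ℕ × ℕ × ℕ) × NFACode) × ℕ) × (ℕ × ℕ × ℕ) => q.1.1.1.2.1 :=
    fst.comp (snd.comp h1)
  have hc : Primrec fun q : (((ℕ × ℕ × ℕ) × NFACode) × ℕ) × (ℕ × ℕ × ℕ) => q.1.2 :=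
    snd.comp .fst
  have hp : Primrec fun q : (((ℕ × ℕ × ℕ) × NFACode) × ℕ) × (ℕ × ℕ × ℕ) => [q.2.1] :=
    list_cons.comp (fst.comp .snd) (.const [])
  exact primrec_evalStates_comp hM hp (primrec_codeLetter_comp hk hm hc)

theorem primrec_simulate_transition :
    Primrec fun q : ((((ℕ × ℕ × ℕ) × NFACode) × ℕ) × (ℕ × ℕ × ℕ)) × ℕ =>
      (Nat.pair q.1.2.1 (leftCode q.1.1.2 + 1), q.1.1.2, Nat.pair q.2 (nextMemory q.1.1.2)) := by
  have h1 : Primrec fun q : ((((ℕ × ℕ × ℕ) × NFACode) × ℕ) × (ℕ × ℕ × ℕ)) × ℕ => q.1.1.2 :=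
    snd.comp (fst.comp .fst)
  have h2 : Primrec fun q : ((((ℕ × ℕ × ℕ) × NFACode) × ℕ) × (ℕ × ℕ × ℕ)) × ℕ => q.1.2.1 :=
    fst.comp (snd.comp .fst)
  exact .pair (Primrec₂.natPair.comp h2 (succ.comp (primrec_leftCode.comp h1)))
    (.pair h1 (Primrec₂.natPair.comp .snd (primrec_nextMemory.comp h1)))

theorem primrec_simulate :
    Primrec fun p : (ℕ × ℕ × ℕ) × NFACode => simulate p.1.1 p.1.2.1 p.1.2.2 p.2 := by
  have h1 : Primrec fun q : (((ℕ × ℕ × ℕ) × NFACode) × ℕ) => q.1.2.1 :=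
    fst.comp (snd.comp .fst)
  have h2 : Primrec fun p : (ℕ × ℕ × ℕ) × NFACode => List.range p.1.2.2 :=
    list_range.comp (snd.comp (snd.comp .fst))
  have h3 : Primrec fun p : (ℕ × ℕ × ℕ) × NFACode => p.2.2.1.map fun p => Nat.pair p 1 :=
    list_map (fst.comp (snd.comp .snd)) (Primrec₂.natPair.comp .snd (.const 1))
  have h4 : Primrec fun p : (ℕ × ℕ × ℕ) × NFACode => p.2.2.2.map fun p => Nat.pair p 0 :=
    list_map (snd.comp (snd.comp .snd)) (Primrec₂.natPair.comp .snd (.const 0))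
  have h5 := list_map primrec_simulate_states primrec_simulate_transition.to₂
  have h6 := list_flatMap h1 h5.to₂
  have h7 := list_flatMap h2 h6.to₂
  exact .pair h7 (.pair h3 h4)

theorem primrec_simulate_comp {X : Type*} [Primcodable X] {k m k' : X → ℕ} {M : X → NFACode}
    (hk : Primrec k) (hm : Primrec m) (hk' : Primrec k') (hM : Primrec M) :
    Primrec fun x => simulate (k x) (m x) (k' x) (M x) :=
  primrec_simulate.comp (.pair (.pair hk (.pair hm hk')) hM)

theorem computable_reduction : Computable reduction := by
  have hN : Primrec fun I : SepInstance => sizeBound (encode I + 1) :=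
    primrec_sizeBound.comp (succ.comp Primrec.encode)
  have hm : Primrec fun I : SepInstance => (sizeBound (encode I + 1)).factorial :=
    primrec_factorial.comp hN
  have hk : Primrec fun I : SepInstance => I.1 := .fst
  have hk' : Primrec fun I : SepInstance =>
      alphabetSize I.1 (wordBound I.1 (sizeBound (encode I + 1))) :=
    primrec_alphabetSize.comp hk (primrec_wordBound.comp hk hN)
  have hM₁ := primrec_simulate_comp hk hm hk' (fst.comp .snd)
  have hM₂ := primrec_simulate_comp hk hm hk' (snd.comp .snd)
  exact (Primrec.pair hk' (.pair hM₁ hM₂)).to_comp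

end Computability

end PlusOne

namespace PlusOne

open Set Function

/-! ## Inverse images under letter-to-letter morphisms -/

section LetterMap

universe u v w

variable {A : Type u} {B : Type v}

theorem letters_map (g : A → B) (w : FreeSemigroup A) :
    letters (FreeSemigroup.map g w) = (letters w).map g := by
  induction w using FreeSemigroup.recOnMul with
  | ih1 a => rfl
  | ih2 a w _ ih =>
    rw [map_mul, FreeSemigroup.map_of, letters_of_mul, letters_of_mul, ih, List.map_cons]

theorem letters_injective : Injective (letters (A := A)) := fun _ _ h =>
  FreeSemigroup.ext (List.cons.inj h).1 (List.cons.inj h).2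

/-- The interpretation of the image of a word under a letter-to-letter morphism. -/
noncomputable def relabelling (g : A → B) :
    Interpretation (univ : Set (FreeSemigroup A)) B ℕ Unit where
  label w i := g (letterAt w.1 i)
  carrier w := {i | i < (letters w.1).length}
  point i _ := i
  guard _ _ _ := True
  mem_carrier _ i := ⟨fun h => ⟨⟨i, h⟩, (), trivial, rfl⟩, fun ⟨i, _, _, h⟩ => h ▸ i.2⟩

theorem relabelling_basic [Finite A] (g : A → B) (V : Type) [DecidableEq V] (order : Bool)
    (D : Bool → Set (Rel (univ : Set (FreeSemigroup A)) V)) (hD : Logic order false D) :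
    (relabelling g).Basic (order := order) (en := false) D := by
  refine ⟨fun b x => FinFamily.const (hD.top b), fun b t ht => ?_⟩
  cases t with
  | label a x =>
    convert FinFamily.const (hD.letterRel_mem b x (g ⁻¹' {a})) using 1
    funext o w ν
    simp [Interpretation.rel, Formula.SatOn, Atom.SatOn, relabelling, letterRel, letterAt_fin]
  | eq x y =>
    convert FinFamily.const (hD.atom b (.eq x y) trivial) using 1
    funext o w ν
    simp [Interpretation.rel, Formula.SatOn, Atom.SatOn, relabelling, Formula.rel, Formula.Sat,
      Atom.Sat, Fin.ext_iff]
  | lt x y => exact FinFamily.const (hD.atom b (.lt x y) ht)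
  | succ x y => cases ht
  | isMin x => cases ht
  | isMax x => cases ht

theorem preimage_map_definable [Finite A] (g : A → B) (F : Fragment) {K : Set (FreeSemigroup B)}
    (hK : K ∈ F.definable false B) : FreeSemigroup.map g ⁻¹' K ∈ F.definable false A := by
  obtain ⟨K', hK', k, h⟩ := (relabelling g).exists_definable
    (fun V _ _ order D hD => relabelling_basic g V order D hD) F hK
  convert hK' using 1
  ext w
  refine (h ⟨w, trivial⟩ _ ?_).symm
  have hlen : (letters (FreeSemigroup.map g w)).length = (letters w).length := by
    rw [letters_map, List.length_map]
  refine Equivalent.of_bijOn (f := Fin.val) ⟨fun i _ => ?_, fun i _ j _ h => Fin.ext h,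
    fun i hi => ?_⟩ (fun i _ j _ h => h) (fun i _ => ?_) k
  · exact lt_of_lt_of_eq i.2 hlen
  · exact ⟨⟨i, lt_of_lt_of_eq hi hlen.symm⟩, trivial, rfl⟩
  · have hi : (i : ℕ) < (letters w).length := lt_of_lt_of_eq i.2 hlen
    have : letterAt w i = (letters w).get ⟨i, hi⟩ := letterAt_fin w ⟨i, hi⟩
    simp [relabelling, this, letters_map]

/-- Only inclusions between the languages are required, so `g` need not be a bijection. -/
theorem Separable.preimage_map [Finite A] {F : Fragment} (g : A → B)
    {L L' : Set (FreeSemigroup A)} {M M' : Set (FreeSemigroup B)}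
    (hg : MapsTo (FreeSemigroup.map g) L M) (hg' : MapsTo (FreeSemigroup.map g) L' M')
    (h : Separable (F.definable false B) M M') : Separable (F.definable false A) L L' := by
  obtain ⟨K, hK, h1, h2⟩ := h
  refine ⟨_, preimage_map_definable g F hK, fun w hw => h1 (hg hw), ?_⟩
  rw [eq_empty_iff_forall_notMem] at h2 ⊢
  exact fun w hw => h2 _ ⟨hw.1, hg' hw.2⟩

end LetterMap

end PlusOne

namespace PlusOne

open Set Function

/-! ## Runs of automata -/

/-- There is a run of the automaton on a word between two states. -/
def NFACode.Run (M : NFACode) : List ℕ → ℕ → ℕ → Prop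
  | [], p, q => p = q
  | a :: v, p, q => ∃ r, (p, a, r) ∈ M.1 ∧ M.Run v r q

theorem NFACode.run_append (M : NFACode) (u v : List ℕ) (p q : ℕ) :
    M.Run (u ++ v) p q ↔ ∃ r, M.Run u p r ∧ M.Run v r q := by
  induction u generalizing p with
  | nil => simp [Run]
  | cons a u ih =>
    simp only [List.cons_append, Run, ih]
    grind

theorem mem_stepStates {M : NFACode} {Q : List ℕ} {a q : ℕ} :
    q ∈ stepStates M Q a ↔ ∃ p ∈ Q, (p, a, q) ∈ M.1 := by
  simp only [stepStates, List.mem_flatMap]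
  constructor
  · rintro ⟨p, hp, ⟨p', a', q'⟩, ht, h⟩
    split_ifs at h with hc
    · simp only at hc h
      obtain ⟨rfl, rfl⟩ := hc
      rw [List.mem_singleton] at h
      exact ⟨_, hp, h ▸ ht⟩
    · simp at h
  · rintro ⟨p, hp, h⟩
    exact ⟨p, hp, _, h, by simp⟩

theorem mem_evalStates {M : NFACode} {Q : List ℕ} {v : List ℕ} {q : ℕ} :
    q ∈ evalStates M Q v ↔ ∃ p ∈ Q, M.Run v p q := by
  induction v generalizing Q with
  | nil => simp [evalStates, NFACode.Run]
  | cons a v ih =>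
    rw [evalStates, List.foldl_cons, ← evalStates, ih]
    simp only [mem_stepStates, NFACode.Run]
    grind

theorem NFACode.mem_language {k : ℕ} {M : NFACode} {w : FreeSemigroup (Fin k)} :
    w ∈ M.language k ↔ ∃ p ∈ M.2.1, ∃ q ∈ M.2.2, M.Run ((letters w).map Fin.val) p q := by
  have key : ∀ (l : List (Fin k)) (Q : Set ℕ) (q : ℕ),
      q ∈ (M.toNFA k).evalFrom Q l ↔ ∃ p ∈ Q, M.Run (l.map Fin.val) p q := by
    intro l
    induction l with
    | nil => simp [Run]
    | cons a l ih =>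
      intro Q q
      rw [NFA.evalFrom_cons, ih]
      simp only [NFA.mem_stepSet, List.map_cons, Run]
      simp only [toNFA, mem_ofPred_eq]
      grind
  rw [language, mem_ofPred_eq, NFA.mem_accepts]
  simp only [key]
  simp only [toNFA, mem_ofPred_eq]
  grind

/-- Coded letters whose idempotents match, starting with the given memory and ending with `0`. -/
def Matching : ℕ → List ℕ → Prop
  | μ, [] => μ = 0
  | μ, c :: cs => leftCode c + 1 = μ ∧ Matching (nextMemory c) cs

/-- The memory is one more than the code of the left idempotent expected next. From memory `0` no
letter can be read, so it marks the end of the word. -/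
theorem run_simulate {k m k' : ℕ} {M : NFACode} {cs : List ℕ} {p μ q : ℕ} :
    (simulate k m k' M).Run cs (Nat.pair p μ) (Nat.pair q 0) ↔
      (∀ c ∈ cs, c < k') ∧ Matching μ cs ∧ M.Run (cs.flatMap (codeLetter k m)) p q := by
  induction cs generalizing p μ with
  | nil => simp [NFACode.Run, Matching, Nat.pair_eq_pair]; tauto
  | cons c cs ih => 
    have hne : codeLetter k m c ≠ [] := by simp [codeLetter, codeWord]
    have key : ∀ r, (Nat.pair p μ, c, r) ∈ (simulate k m k' M).1 ↔
        c < k' ∧ leftCode c + 1 = μ ∧ ∃ p', M.Run (codeLetter k m c) p p' ∧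
          r = Nat.pair p' (nextMemory c) := by
      intro r
      simp only [simulate, List.mem_flatMap, List.mem_range, List.mem_map, mem_evalStates,
        List.mem_singleton, Prod.mk.injEq, Nat.pair_eq_pair]
      constructor
      · rintro ⟨c, hc, t, ht, q', ⟨_, rfl, h⟩, ⟨h1, h2⟩, rfl, h3⟩
        exact ⟨hc, h2, q', h1 ▸ h, h3.symm⟩
      · rintro ⟨hc, h2, q', h, rfl⟩
        -- The simulation enumerates only states from which some transition of `M` starts. As the
        -- word of a coded letter is nonempty, a run on it does start with such a transition.
        obtain ⟨a, v, hv⟩ := List.exists_cons_of_ne_nil hne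
        have h' := h
        rw [hv] at h'
        obtain ⟨r, hr, -⟩ := h'
        exact ⟨c, hc, _, hr, q', ⟨_, rfl, h⟩, ⟨rfl, h2⟩, rfl, rfl⟩
    simp only [NFACode.Run, key, List.flatMap_cons, NFACode.run_append, Matching,
      List.forall_mem_cons]
    constructor
    · rintro ⟨r, ⟨h1, h2, p', h3, rfl⟩, h4⟩
      obtain ⟨h5, h6, h7⟩ := ih.1 h4
      exact ⟨⟨h1, h5⟩, ⟨h2, h6⟩, p', h3, h7⟩
    · rintro ⟨⟨h1, h5⟩, ⟨h2, h6⟩, p', h3, h7⟩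
      exact ⟨_, ⟨h1, h2, p', h3, rfl⟩, ih.2 ⟨h5, h6, h7⟩⟩

theorem mem_language_simulate {k m k' : ℕ} {M : NFACode} {w : FreeSemigroup (Fin k')} :
    w ∈ (simulate k m k' M).language k' ↔ Matching 1 ((letters w).map Fin.val) ∧
      ∃ p ∈ M.2.1, ∃ q ∈ M.2.2,
        M.Run (((letters w).map Fin.val).flatMap (codeLetter k m)) p q := by
  have h : ∀ c ∈ (letters w).map Fin.val, c < k' := by simp
  rw [NFACode.mem_language]
  constructor
  · rintro ⟨p, hp, q, hq, hr⟩
    simp only [simulate, List.mem_map] at hp hq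
    obtain ⟨p, hp, rfl⟩ := hp
    obtain ⟨q, hq, rfl⟩ := hq
    obtain ⟨-, h1, h2⟩ := run_simulate.1 hr
    exact ⟨h1, p, hp, q, hq, h2⟩
  · rintro ⟨h1, p, hp, q, hq, h2⟩
    exact ⟨_, List.mem_map.2 ⟨p, hp, rfl⟩, _, List.mem_map.2 ⟨q, hq, rfl⟩,
      run_simulate.2 ⟨h, h1, h2⟩⟩

end PlusOne

namespace PlusOne

open Set Function Encodable

/-! ## Bounds on codes -/

theorem natPair_le_natPair {a a' b b' : ℕ} (ha : a ≤ a') (hb : b ≤ b') :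
    Nat.pair a b ≤ Nat.pair a' b' := by
  have h1 : Nat.pair a b ≤ Nat.pair a' b := by
    rcases ha.eq_or_lt with rfl | ha
    · exact le_rfl
    · exact (Nat.pair_lt_pair_left _ ha).le
  have h2 : Nat.pair a' b ≤ Nat.pair a' b' := by
    rcases hb.eq_or_lt with rfl | hb
    · exact le_rfl
    · exact (Nat.pair_lt_pair_right _ hb).le
  exact h1.trans h2

theorem encode_lt_of_mem {X : Type*} [Encodable X] {l : List X} {x : X} (h : x ∈ l) :
    encode x < encode l := by
  induction l with
  | nil => simp at h
  | cons y l ih =>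
    rw [encode_list_cons, Nat.lt_succ_iff]
    rcases List.mem_cons.1 h with rfl | h
    · exact Nat.left_le_pair _ _
    · exact (ih h).le.trans (Nat.right_le_pair _ _)

theorem encode_le_listBound {k n : ℕ} {l : List ℕ} (hl : l.length ≤ n) (h : ∀ x ∈ l, x ≤ k) :
    encode l ≤ listBound k n := by
  induction n generalizing l with
  | zero => rw [List.length_eq_zero_iff.1 (Nat.le_zero.1 hl)]; simp
  | succ n ih =>
    cases l with
    | nil => simp
    | cons x l =>
      rw [encode_list_cons]
      exact Nat.succ_le_succ (natPair_le_natPair (h x (by simp))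
        (ih (Nat.le_of_succ_le_succ hl) fun y hy => h y (by simp [hy])))

theorem lt_alphabetSize {k b l c r : ℕ} (hk : 0 < k) (hl : l ≤ b + 1) (hc : c ≤ b)
    (hr : r ≤ b + 1) : Nat.pair l (Nat.pair c r) < alphabetSize k b :=
  (Nat.lt_succ_of_le (natPair_le_natPair hl (natPair_le_natPair hc hr))).trans_le
    (Nat.le_mul_of_pos_left _ hk)

/-! ## Finite semigroups -/

theorem exists_map_eq_of_card_lt {T : Type*} [Finite T] (f : ℕ → T) {n : ℕ} (hn : Nat.card T ≤ n) :
    ∃ i j, i < j ∧ j ≤ n ∧ f i = f j := by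
  by_contra! h
  have hinj : Injective fun i : Fin (n + 1) => f i := by
    intro i j hij
    by_contra hne
    rcases lt_or_gt_of_ne hne with hlt | hlt
    · exact h i j hlt (Nat.le_of_lt_succ j.2) hij
    · exact h j i hlt (Nat.le_of_lt_succ i.2) hij.symm
  have := Nat.card_le_card_of_injective _ hinj
  rw [Nat.card_fin] at this
  omega

/-- The powers of `x` are periodic from an exponent `i ≤ n` on, with a period `j - i ≤ n`. This
period divides `n!`, and `n!` is at least `i`. -/
theorem isIdempotentElem_pow_factorial {T : Type*} [Monoid T] [Finite T] {n : ℕ}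
    (hn : Nat.card T ≤ n) (x : T) : IsIdempotentElem (x ^ n.factorial) := by
  obtain ⟨i, j, hij, hj, h⟩ := exists_map_eq_of_card_lt (x ^ ·) hn
  have key : ∀ t a, i ≤ a → x ^ (a + (j - i) * t) = x ^ a := by
    intro t
    induction t with
    | zero => simp
    | succ t ih =>
      intro a ha
      rw [show a + (j - i) * (t + 1) = (a - i) + j + (j - i) * t by grind, ih _ (by omega),
        pow_add, ← h, ← pow_add, Nat.sub_add_cancel ha]
  obtain ⟨t, ht⟩ := Nat.dvd_factorial (Nat.sub_pos_of_lt hij) (show j - i ≤ n by omega)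
  rw [IsIdempotentElem, ← pow_add]
  nth_rewrite 2 [ht]
  exact key t _ ((hij.le.trans hj).trans n.self_le_factorial)

theorem exists_idem_eq_pow {S : Type*} [Semigroup S] [Finite S] {n : ℕ}
    (hn : Nat.card (WithOne S) ≤ n) (s : S) :
    ∃ e : Idem S, (e.1 : WithOne S) = (s : WithOne S) ^ n.factorial := by
  have key : ∀ m : ℕ, ∃ t : S, (t : WithOne S) = (s : WithOne S) ^ (m + 1) := by
    intro m
    induction m with
    | zero => exact ⟨s, by simp⟩
    | succ m ih =>
      obtain ⟨t, ht⟩ := ih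
      exact ⟨t * s, by rw [WithOne.coe_mul, ht, ← pow_succ]⟩
  obtain ⟨t, ht⟩ := key (n.factorial - 1)
  rw [Nat.sub_add_cancel n.factorial_pos] at ht
  refine ⟨⟨t, WithOne.coe_injective ?_⟩, ht⟩
  have : Finite (WithOne S) := inferInstanceAs (Finite (Option S))
  rw [WithOne.coe_mul, ht]
  exact isIdempotentElem_pow_factorial hn _

/-- A long list has two prefixes of equal value; the factor between them can be deleted without
changing the value of the list. -/
theorem exists_short_list {A S : Type*} [Semigroup S] [Finite S] (α : FreeSemigroup A →ₙ* S)
    {n : ℕ} (hn : Nat.card (WithOne S) ≤ n) (l : List A) :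
    ∃ l', l'.length < n ∧ listValue α l' = listValue α l := by
  have : Finite (WithOne S) := inferInstanceAs (Finite (Option S))
  induction h : l.length using Nat.strong_induction_on generalizing l with
  | _ m ih =>
    subst h
    by_cases hl : l.length < n
    · exact ⟨l, hl, rfl⟩
    obtain ⟨i, j, hij, hj, hval⟩ := exists_map_eq_of_card_lt (fun i => listValue α (l.take i)) hn
    obtain ⟨l', hl', h⟩ := ih (l.take i ++ l.drop j).length (by simp; omega) _ rfl
    refine ⟨l', hl', h.trans ?_⟩
    rw [listValue_append, hval, ← listValue_append, List.take_append_drop]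

theorem exists_short_word {A S : Type*} [Semigroup S] [Finite S] {α : FreeSemigroup A →ₙ* S}
    (hα : Surjective α) {n : ℕ} (hn : Nat.card (WithOne S) ≤ n) (s : S) :
    ∃ w, (letters w).length < n ∧ α w = s := by
  obtain ⟨v, rfl⟩ := hα s
  obtain ⟨l, hl, h⟩ := exists_short_list α hn (letters v)
  rw [listValue_letters] at h
  have hne : l ≠ [] := by
    rintro rfl
    exact WithOne.coe_ne_one h.symm
  obtain ⟨w, rfl⟩ := exists_letters_eq hne
  exact ⟨w, hl, WithOne.coe_injective (by rw [← h, listValue_letters])⟩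

/-! ## Coded words and letters -/

section Coding

variable (k : ℕ) [NeZero k]

/-- The word with a given code. -/
def wordOfCode (c : ℕ) : FreeSemigroup (Fin k) :=
  ⟨Fin.ofNat k c.unpair.1, ((decode (α := List ℕ) c.unpair.2).getD []).map (Fin.ofNat k)⟩

theorem map_val_letters_wordOfCode (c : ℕ) :
    (letters (wordOfCode k c)).map Fin.val = codeWord k c := by
  simp [wordOfCode, letters, codeWord]

theorem exists_wordOfCode_eq {n : ℕ} {w : FreeSemigroup (Fin k)} (hw : (letters w).length ≤ n) :
    ∃ c ≤ wordBound k n, wordOfCode k c = w := by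
  refine ⟨Nat.pair w.head (encode (w.tail.map Fin.val)), natPair_le_natPair w.head.2.le
    (encode_le_listBound ?_ fun x hx => ?_), ?_⟩
  · simp [letters] at hw ⊢; omega
  · obtain ⟨y, -, rfl⟩ := List.mem_map.1 hx
    exact y.2.le
  · simp only [wordOfCode, Nat.unpair_pair, encodek, Option.getD_some, List.map_map]
    ext
    · simp
    · simp

/-- The list of letters of the repetition of a word that is given by the successor of its code. -/
def powerOfCode (m l : ℕ) : List (Fin k) :=
  Nat.casesOn l [] fun e => (List.replicate m (letters (wordOfCode k e))).flatten

theorem map_val_powerOfCode (m l : ℕ) : (powerOfCode k m l).map Fin.val = codePower k m l := by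
  cases l with
  | zero => rfl
  | succ e =>
    simp [powerOfCode, codePower, List.map_flatten, map_val_letters_wordOfCode]

/-- The list of letters of the word that represents a coded letter. -/
def listOfCode (m c : ℕ) : List (Fin k) :=
  powerOfCode k m (leftCode c) ++ (letters (wordOfCode k (midCode c)) ++
    powerOfCode k m (rightCode c))

theorem map_val_listOfCode (m c : ℕ) : (listOfCode k m c).map Fin.val = codeLetter k m c := by
  simp [listOfCode, codeLetter, map_val_powerOfCode, map_val_letters_wordOfCode]

end Coding

end PlusOne

namespace PlusOne

open Set Function Encodable

/-! ## Correctness of the simulation -/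

section LetterCode

variable {S : Type} [Semigroup S]

/-- The code of an optional idempotent, relative to a coding of elements. -/
def optionCode (γ : S → ℕ) (o : Option (Idem S)) : ℕ := o.elim 0 fun e => γ e.1 + 1

/-- The code of a letter, relative to a coding of elements. -/
def letterCode (γ : S → ℕ) (b : WFLetter S) : ℕ :=
  Nat.pair (optionCode γ b.left) (Nat.pair (γ b.mid) (optionCode γ b.right))

variable {γ : S → ℕ}

theorem optionCode_le {B : ℕ} (hγ : ∀ s, γ s ≤ B) (o : Option (Idem S)) :
    optionCode γ o ≤ B + 1 := by
  cases o with
  | none => exact Nat.zero_le _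
  | some e => exact Nat.succ_le_succ (hγ _)

theorem letterCode_lt {k B : ℕ} (hk : 0 < k) (hγ : ∀ s, γ s ≤ B) (b : WFLetter S) :
    letterCode γ b < alphabetSize k B :=
  lt_alphabetSize hk (optionCode_le hγ _) (hγ _) (optionCode_le hγ _)

theorem Linked.matching {o : Option (Idem S)} {l : List (WFLetter S)} (h : Linked o l) :
    Matching (optionCode γ o + 1) (l.map (letterCode γ)) := by
  induction l generalizing o with
  | nil => cases h
  | cons b l ih =>
    obtain ⟨h1, h2, h3⟩ := h
    refine ⟨by simp [leftCode, letterCode, h1], ?_⟩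
    have hr : rightCode (letterCode γ b) = optionCode γ b.right := by
      simp [rightCode, letterCode]
    rw [nextMemory, hr]
    cases hb : b.right with
    | none => rw [h2.1 hb]; rfl
    | some e =>
      have := ih (h3 fun hl => by simp [h2.2 hl] at hb)
      rwa [hb] at this

end LetterCode

section Correctness

theorem listValue_powerOfCode_succ {k : ℕ} [NeZero k] {S : Type} [Semigroup S]
    (α : FreeSemigroup (Fin k) →ₙ* S) (m c : ℕ) :
    listValue α (powerOfCode k m (c + 1)) = (α (wordOfCode k c) : WithOne S) ^ m := by
  change listValue α (List.replicate m (letters (wordOfCode k c))).flatten = _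
  induction m with
  | zero => rfl
  | succ m ih =>
    rw [List.replicate_succ, List.flatten_cons, listValue_append, ih, listValue_letters, pow_succ']

variable {k : ℕ} [NeZero k] {S : Type} [Semigroup S] [Finite S] (α : FreeSemigroup (Fin k) →ₙ* S)
  {n : ℕ}

/-- Since the `n!`-th power of any element is idempotent, every code of a word denotes an
idempotent, and it never has to be decided which words have idempotent values. -/
theorem exists_idemOfCode (hn : Nat.card (WithOne S) ≤ n) (l : ℕ) :
    ∃ o : Option (Idem S), (o = none ↔ l = 0) ∧
      WFLetter.idemValue o = listValue α (powerOfCode k n.factorial l) := by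
  cases l with
  | zero => exact ⟨none, by simp, rfl⟩
  | succ c =>
    obtain ⟨e, he⟩ := exists_idem_eq_pow hn (α (wordOfCode k c))
    refine ⟨some e, by simp, ?_⟩
    exact he.trans (listValue_powerOfCode_succ α _ c).symm

/-- The optional idempotent with a given code. -/
noncomputable def idemOfCode (hn : Nat.card (WithOne S) ≤ n) (l : ℕ) : Option (Idem S) := (exists_idemOfCode α hn l).choose

theorem idemOfCode_eq_none_iff (hn : Nat.card (WithOne S) ≤ n) {l : ℕ} : idemOfCode α hn l = none ↔ l = 0 :=
  (exists_idemOfCode α hn l).choose_spec.1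

theorem idemValue_idemOfCode (hn : Nat.card (WithOne S) ≤ n) (l : ℕ) :
    WFLetter.idemValue (idemOfCode α hn l) = listValue α (powerOfCode k n.factorial l) :=
  (exists_idemOfCode α hn l).choose_spec.2

/-- The letter with a given code. -/
noncomputable def letterOfCode (hn : Nat.card (WithOne S) ≤ n) (c : ℕ) : WFLetter S :=
  .mk (idemOfCode α hn (leftCode c)) (α (wordOfCode k (midCode c))) (idemOfCode α hn (rightCode c))

theorem coe_value_letterOfCode (hn : Nat.card (WithOne S) ≤ n) (c : ℕ) :
    ((letterOfCode α hn c).value : WithOne S) = listValue α (listOfCode k n.factorial c) := by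
  simp [WFLetter.coe_value, letterOfCode, idemValue_idemOfCode, listOfCode, mul_assoc]

theorem coe_beta {S : Type} [Semigroup S] (w : FreeSemigroup (WFLetter S)) :
    ((beta w : S) : WithOne S) = ((letters w).map fun b => (b.value : WithOne S)).prod := by
  simpa [listValue, beta_of] using (listValue_letters beta w).symm

theorem exists_run_iff (hn : Nat.card (WithOne S) ≤ n) {M : NFACode} (hM : Recognizes α (M.language k)) {k' : ℕ}
    (w : FreeSemigroup (Fin k')) :
    (∃ p ∈ M.2.1, ∃ q ∈ M.2.2,
        M.Run (((letters w).map Fin.val).flatMap (codeLetter k n.factorial)) p q) ↔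
      beta (FreeSemigroup.map (fun c : Fin k' => letterOfCode α hn c) w) ∈ α '' M.language k := by
  obtain ⟨v, hv⟩ := exists_letters_eq
    (l := (letters w).flatMap fun c : Fin k' => listOfCode k n.factorial c)
    (by simp [letters, listOfCode])
  have hval : α v = beta (FreeSemigroup.map (fun c : Fin k' => letterOfCode α hn c) w) := by
    apply WithOne.coe_injective
    rw [← listValue_letters, hv, coe_beta, listValue_flatMap, letters_map, List.map_map]
    congr 1
    exact List.map_congr_left fun c _ => (coe_value_letterOfCode α hn c).symm
  have hrun : ((letters w).map Fin.val).flatMap (codeLetter k n.factorial) =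
      (letters v).map Fin.val := by
    rw [hv, List.map_flatMap, List.flatMap_map]
    simp only [map_val_listOfCode]
  rw [hrun, ← NFACode.mem_language, ← hval]
  obtain ⟨P, hP⟩ := hM
  rw [hP]
  constructor
  · exact fun h => ⟨v, h, rfl⟩
  · rintro ⟨u, hu, h⟩
    rwa [mem_preimage, ← h]

/-- Equal codes denote equal idempotents. An idempotent may have several codes, but the converse is
only needed for one fixed choice of codes, in `Linked.matching`. -/
theorem Matching.linked (hn : Nat.card (WithOne S) ≤ n) {l : ℕ} {cs : List ℕ} (h : Matching (l + 1) cs) :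
    Linked (idemOfCode α hn l) (cs.map (letterOfCode α hn)) := by
  induction cs generalizing l with
  | nil => cases h
  | cons c cs ih =>
    obtain ⟨h1, h2⟩ := h
    obtain rfl : leftCode c = l := by omega
    have hright : (letterOfCode α hn c).right = idemOfCode α hn (rightCode c) :=
      WFLetter.right_mk _ _ _
    rw [List.map_cons, Linked, hright, idemOfCode_eq_none_iff, List.map_eq_nil_iff, Ne,
      List.map_eq_nil_iff]
    refine ⟨WFLetter.left_mk _ _ _, ?_⟩
    rw [nextMemory] at h2
    generalize rightCode c = r at h2
    cases r with
    | zero =>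
      cases cs with
      | nil => simp
      | cons c' cs => exact absurd h2.1 (Nat.succ_ne_zero _)
    | succ r =>
      cases cs with
      | nil => cases h2
      | cons c' cs => exact ⟨by simp, fun _ => ih h2⟩

theorem mapsTo_simulate (hn : Nat.card (WithOne S) ≤ n) {M : NFACode} (hM : Recognizes α (M.language k)) (k' : ℕ) :
    MapsTo (FreeSemigroup.map fun c : Fin k' => letterOfCode α hn c)
      ((simulate k n.factorial k' M).language k') (assoc α (M.language k)) := by
  intro w hw
  obtain ⟨h1, h2⟩ := mem_language_simulate.1 hw
  refine ⟨?_, (exists_run_iff α hn hM w).1 h2⟩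
  rw [wellFormed_iff_linked, letters_map]
  have h := h1.linked α hn
  rwa [(idemOfCode_eq_none_iff α hn).2 rfl, List.map_map] at h

variable {α}

theorem exists_code (hn : Nat.card (WithOne S) ≤ n) (hα : Surjective α) (s : S) : ∃ c ≤ wordBound k n, α (wordOfCode k c) = s := by
  obtain ⟨w, hw, h⟩ := exists_short_word hα hn s
  obtain ⟨c, hc, rfl⟩ := exists_wordOfCode_eq k hw.le
  exact ⟨c, hc, h⟩

variable {γ : S → ℕ}

/-- Each idempotent is recovered from a code of itself, because it equals its own `n!`-th power. -/
theorem idemOfCode_optionCode (hn : Nat.card (WithOne S) ≤ n) (hγ : ∀ s, α (wordOfCode k (γ s)) = s) (o : Option (Idem S)) :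
    idemOfCode α hn (optionCode γ o) = o := by
  cases o with
  | none => exact (idemOfCode_eq_none_iff α hn).2 rfl
  | some e =>
    have h := idemValue_idemOfCode α hn (γ e.1 + 1)
    rw [listValue_powerOfCode_succ, hγ] at h
    have he : IsIdempotentElem (e.1 : WithOne S) := by
      rw [IsIdempotentElem, ← WithOne.coe_mul, e.2]
    rw [← Nat.sub_add_cancel n.factorial_pos, he.pow_succ_eq] at h
    change idemOfCode α hn (γ e.1 + 1) = some e
    cases ho : idemOfCode α hn (γ e.1 + 1) with
    | none => exact absurd ((idemOfCode_eq_none_iff α hn).1 ho) (Nat.succ_ne_zero _)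
    | some e' =>
      rw [ho] at h
      exact congrArg some (Subtype.ext (WithOne.coe_injective h))

theorem letterOfCode_letterCode (hn : Nat.card (WithOne S) ≤ n) (hγ : ∀ s, α (wordOfCode k (γ s)) = s) (b : WFLetter S) :
    letterOfCode α hn (letterCode γ b) = b := by
  simp [letterOfCode, letterCode, leftCode, midCode, rightCode, idemOfCode_optionCode hn hγ, hγ]

/-- Decoding letters, and encoding them by means of a fixed choice `γ` of codes, map the languages
on either side into those on the other. Separators are pulled back along the two maps. -/
theorem separable_simulate_iff (hn : Nat.card (WithOne S) ≤ n) (hα : Surjective α) {M M' : NFACode}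
    (hM : Recognizes α (M.language k)) (hM' : Recognizes α (M'.language k)) (F : Fragment) :
    Separable (F.definable false (WFLetter S)) (assoc α (M.language k))
        (assoc α (M'.language k)) ↔
      SepProblem F false (alphabetSize k (wordBound k n),
        simulate k n.factorial (alphabetSize k (wordBound k n)) M,
        simulate k n.factorial (alphabetSize k (wordBound k n)) M') := by
  choose γ hγ hγ' using exists_code hn hα
  have := WFLetter.finite_letters (S := S)
  constructor
  · exact Separable.preimage_map _ (mapsTo_simulate α hn hM _) (mapsTo_simulate α hn hM' _)
  · have key : ∀ M : NFACode, Recognizes α (M.language k) →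
        MapsTo (FreeSemigroup.map fun b => (⟨letterCode γ b, letterCode_lt (NeZero.pos k) hγ b⟩ : Fin _))
          (assoc α (M.language k))
          ((simulate k n.factorial (alphabetSize k (wordBound k n)) M).language _) := by
      intro M hM w hw
      refine mem_language_simulate.2 ⟨?_, (exists_run_iff α hn hM _).2 ?_⟩
      · rw [letters_map, List.map_map]
        exact ((wellFormed_iff_linked w).1 hw.1).matching
      · have : FreeSemigroup.map (fun c : Fin (alphabetSize k (wordBound k n)) =>
            letterOfCode α hn c) (FreeSemigroup.map (fun b => ⟨letterCode γ b, letterCode_lt (NeZero.pos k) hγ b⟩) w)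
            = w := by
          apply letters_injective
          rw [letters_map, letters_map, List.map_map]
          refine (List.map_congr_left fun b _ => ?_).trans (List.map_id _)
          exact letterOfCode_letterCode hn hγ' b
        rw [this]
        exact hw.2
    exact Separable.preimage_map _ (key M hM) (key M' hM')

end Correctness

end PlusOne

namespace PlusOne

open Set Function Encodable

/-! ## The transition semigroup of two automata -/

/-- The set of states from which a given set of states can be reached by reading a letter. -/
def NFACode.pre (M : NFACode) (a : ℕ) : Function.End (Set ℕ) := fun Q =>
  {p | ∃ q ∈ Q, (p, a, q) ∈ M.1}

theorem NFACode.mem_pre {M : NFACode} {a : ℕ} {Q : Set ℕ} {p : ℕ} :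
    p ∈ M.pre a Q ↔ ∃ q ∈ Q, (p, a, q) ∈ M.1 := Iff.rfl

/-- The action of words on sets of states of two automata, by inverse images. -/
def transitionHom (k : ℕ) (M M' : NFACode) :
    FreeSemigroup (Fin k) →ₙ* Function.End (Set ℕ) × Function.End (Set ℕ) :=
  FreeSemigroup.lift fun a => (M.pre a, M'.pre a)

/-- Inverse images are used because the product of endofunctions is composition: the last letter
acts first, which yields a morphism rather than an anti-morphism. -/
theorem mem_transitionHom {k : ℕ} {M M' : NFACode} (w : FreeSemigroup (Fin k)) (Q : Set ℕ) (p : ℕ) :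
    (p ∈ (transitionHom k M M' w).1 Q ↔ ∃ q ∈ Q, M.Run ((letters w).map Fin.val) p q) ∧
      (p ∈ (transitionHom k M M' w).2 Q ↔ ∃ q ∈ Q, M'.Run ((letters w).map Fin.val) p q) := by
  have hof : ∀ a : Fin k, transitionHom k M M' (.of a) = (M.pre a, M'.pre a) :=
    fun a => FreeSemigroup.lift_of _ _
  induction w using FreeSemigroup.recOnMul generalizing Q p with
  | ih1 a =>
    have h : ∀ N : NFACode, p ∈ N.pre a Q ↔
        ∃ q ∈ Q, N.Run ((letters (FreeSemigroup.of a)).map Fin.val) p q := by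
      simp [NFACode.mem_pre, letters, FreeSemigroup.of, NFACode.Run]
    rw [hof]
    exact ⟨h M, h M'⟩
  | ih2 a w _ ih =>
    have h : ∀ (N : NFACode) (Q' : Set ℕ),
        (∀ r, r ∈ Q' ↔ ∃ q ∈ Q, N.Run ((letters w).map Fin.val) r q) →
        (p ∈ N.pre a Q' ↔
          ∃ q ∈ Q, N.Run ((letters (FreeSemigroup.of a * w)).map Fin.val) p q) := by
      intro N Q' hQ
      rw [letters_of_mul, List.map_cons]
      simp only [NFACode.mem_pre, hQ, NFACode.Run]
      constructor
      · rintro ⟨r, ⟨q, hq, h⟩, hr⟩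
        exact ⟨q, hq, r, hr, h⟩
      · rintro ⟨q, hq, r, hr, h⟩
        exact ⟨r, ⟨q, hq, h⟩, hr⟩
    rw [map_mul, hof]
    exact ⟨h M _ fun r => (ih Q r).1, h M' _ fun r => (ih Q r).2⟩

theorem NFACode.Run.lt {M : NFACode} {n : ℕ} (hM : ∀ t ∈ M.1, t.1 < n ∧ t.2.2 < n) {v : List ℕ}
    (hv : v ≠ []) {p q : ℕ} (h : M.Run v p q) : p < n ∧ q < n := by
  induction v generalizing p with
  | nil => exact absurd rfl hv
  | cons a v ih =>
    obtain ⟨r, hr, h⟩ := h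
    refine ⟨(hM _ hr).1, ?_⟩
    cases v with
    | nil => exact h ▸ (hM _ hr).2
    | cons b v => exact (ih (by simp) h).2

theorem lt_encode_of_mem {M : NFACode} {t : ℕ × ℕ × ℕ} (ht : t ∈ M.1) :
    t.1 < encode M ∧ t.2.2 < encode M := by
  have h : encode t < encode M :=
    (encode_lt_of_mem ht).trans_le (by rw [encode_prod_val]; exact Nat.left_le_pair _ _)
  constructor
  · exact lt_of_le_of_lt (by rw [encode_prod_val]; exact Nat.left_le_pair _ _) h
  · refine lt_of_le_of_lt ?_ h
    rw [encode_prod_val, encode_prod_val]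
    exact (Nat.right_le_pair _ _).trans (Nat.right_le_pair _ _)

/-- The action of a nonempty word is determined by the two relations "there is a run from `p` to
`q`", which only involve states below `n`. There are `2 ^ (n * n)` choices for each relation, and
the adjoined unit contributes one more element. -/
theorem card_transitionHom_range {k : ℕ} {M M' : NFACode} {n : ℕ}
    (hM : ∀ t ∈ M.1, t.1 < n ∧ t.2.2 < n) (hM' : ∀ t ∈ M'.1, t.1 < n ∧ t.2.2 < n) :
    Finite (MulHom.srange (transitionHom k M M')) ∧
      Nat.card (WithOne (MulHom.srange (transitionHom k M M'))) ≤ sizeBound n := by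
  let f : MulHom.srange (transitionHom k M M') → Set (Fin n × Fin n) × Set (Fin n × Fin n) :=
    fun s => ({x | (x.1 : ℕ) ∈ s.1.1 {(x.2 : ℕ)}}, {x | (x.1 : ℕ) ∈ s.1.2 {(x.2 : ℕ)}})
  have hf : Injective f := by
    rintro ⟨_, w, rfl⟩ ⟨_, w', rfl⟩ h
    have key : ∀ {M : NFACode}, (∀ t ∈ M.1, t.1 < n ∧ t.2.2 < n) →
        (∀ i j : Fin n, M.Run ((letters w).map Fin.val) i j ↔
          M.Run ((letters w').map Fin.val) i j) → ∀ p q,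
        M.Run ((letters w).map Fin.val) p q ↔ M.Run ((letters w').map Fin.val) p q := by
      intro M hM h p q
      constructor
      · intro hr
        obtain ⟨hp, hq⟩ := hr.lt hM (by simp [letters])
        exact (h ⟨p, hp⟩ ⟨q, hq⟩).1 hr
      · intro hr
        obtain ⟨hp, hq⟩ := hr.lt hM (by simp [letters])
        exact (h ⟨p, hp⟩ ⟨q, hq⟩).2 hr
    obtain ⟨h1, h2⟩ := Prod.ext_iff.1 h
    have h1 := key hM fun i j => by simpa [f, mem_transitionHom] using Set.ext_iff.1 h1 (i, j)
    have h2 := key hM' fun i j => by simpa [f, mem_transitionHom] using Set.ext_iff.1 h2 (i, j)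
    refine Subtype.ext (Prod.ext ?_ ?_)
    · funext Q
      ext p
      rw [(mem_transitionHom w Q p).1, (mem_transitionHom w' Q p).1]
      simp only [h1]
    · funext Q
      ext p
      rw [(mem_transitionHom w Q p).2, (mem_transitionHom w' Q p).2]
      simp only [h2]
  have hfin : Finite (MulHom.srange (transitionHom k M M')) := Finite.of_injective f hf
  refine ⟨hfin, ?_⟩
  have hcard : Nat.card (WithOne (MulHom.srange (transitionHom k M M'))) = Nat.card _ + 1 :=
    Finite.card_option
  have h := Nat.card_le_card_of_injective f hf
  rw [Nat.card_prod, Nat.card_eq_fintype_card (α := Set _), Fintype.card_set, Fintype.card_prod,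
    Fintype.card_fin] at h
  rw [hcard, sizeBound]
  omega

theorem recognizes_srangeRestrict {A T : Type*} [Semigroup T] (α : FreeSemigroup A →ₙ* T)
    {L : Set (FreeSemigroup A)} (h : Recognizes α L) :
    Recognizes (MulHom.srangeRestrict α) L := by
  obtain ⟨P, rfl⟩ := h
  exact ⟨Subtype.val ⁻¹' P, rfl⟩

theorem Fragment.definable_nonempty (F : Fragment) (en : Bool) (A : Type*) :
    (F.definable en A).Nonempty := by
  have h : ∀ {V : Type}, (Formula.falsum : Formula A V).IsSentence := rfl
  cases F with
  | foEq => exact ⟨_, .falsum, h, trivial, rfl⟩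
  | fo2 => exact ⟨_, .falsum, h, trivial, rfl⟩
  | sigma n hn => exact ⟨_, .falsum, h, trivial, .qf trivial, rfl⟩
  | bsigma n hn => exact ⟨_, .falsum, h, trivial, .sigma (.qf trivial), rfl⟩

/-- There is no nonempty word over the empty alphabet, so any definable language separates. -/
theorem sepProblem_of_zero (F : Fragment) (en : Bool) {I : SepInstance} (h : I.1 = 0) :
    SepProblem F en I := by
  obtain ⟨k, M, M'⟩ := I
  obtain rfl : k = 0 := h
  obtain ⟨K, hK⟩ := F.definable_nonempty en (Fin 0)
  exact ⟨K, hK, fun w => w.head.elim0, Set.eq_empty_of_forall_notMem fun w => w.head.elim0⟩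

theorem sepProblem_reduction_iff (F : Fragment) (I : SepInstance) :
    SepProblem F true I ↔ SepProblem F false (reduction I) := by
  obtain ⟨k, M, M'⟩ := I
  rcases Nat.eq_zero_or_pos k with rfl | hk
  -- The factor `k` in `alphabetSize` makes the new alphabet empty as well.
  · have h : (reduction (0, M, M')).1 = 0 := Nat.zero_mul _
    exact iff_of_true (sepProblem_of_zero F true rfl) (sepProblem_of_zero F false h)
  have : NeZero k := ⟨hk.ne'⟩
  have hlt : encode M < encode (k, M, M') + 1 ∧ encode M' < encode (k, M, M') + 1 := by
    rw [encode_prod_val, encode_prod_val]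
    exact ⟨Nat.lt_succ_of_le ((Nat.left_le_pair _ _).trans (Nat.right_le_pair _ _)),
      Nat.lt_succ_of_le ((Nat.right_le_pair _ _).trans (Nat.right_le_pair _ _))⟩
  obtain ⟨hfin, hcard⟩ := card_transitionHom_range (k := k) (M := M) (M' := M')
    (n := encode (k, M, M') + 1)
    (fun t ht => ⟨(lt_encode_of_mem ht).1.trans hlt.1, (lt_encode_of_mem ht).2.trans hlt.1⟩)
    (fun t ht => ⟨(lt_encode_of_mem ht).1.trans hlt.2, (lt_encode_of_mem ht).2.trans hlt.2⟩)
  have hα := MulHom.srangeRestrict_surjective (transitionHom k M M')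
  have hM : Recognizes (MulHom.srangeRestrict (transitionHom k M M')) (M.language k) := by
    refine recognizes_srangeRestrict _ ⟨{s | ∃ p ∈ M.2.1, p ∈ s.1 {q | q ∈ M.2.2}}, ?_⟩
    ext w
    simp [NFACode.mem_language, mem_transitionHom]
  have hM' : Recognizes (MulHom.srangeRestrict (transitionHom k M M')) (M'.language k) := by
    refine recognizes_srangeRestrict _ ⟨{s | ∃ p ∈ M'.2.1, p ∈ s.2 {q | q ∈ M'.2.2}}, ?_⟩
    ext w
    simp [NFACode.mem_language, mem_transitionHom]
  exact (separable_iff_separable_assoc F _ hα _ _ hM hM').trans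
    (separable_simulate_iff hcard hα hM hM' F)

end PlusOne

theorem theorem2 :
    -- the transfer of separability, for every fragment and every surjective recognizer
    (∀ (F : PlusOne.Fragment) {A : Type*} [Finite A] {S : Type*} [Semigroup S] [Finite S]
        (α : FreeSemigroup A →ₙ* S) (_ : Function.Surjective α)
        (L L' : Set (FreeSemigroup A)) (_ : PlusOne.Recognizes α L) (_ : PlusOne.Recognizes α L'),
        PlusOne.Separable (F.definable true A) L L' ↔
          PlusOne.Separable (F.definable false (PlusOne.WFLetter S))
            (PlusOne.assoc α L) (PlusOne.assoc α L')) ∧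
    -- the effective reduction, by one computable function for all fragments
    (∃ f : PlusOne.SepInstance → PlusOne.SepInstance, Computable f ∧
        ∀ (F : PlusOne.Fragment) (I : PlusOne.SepInstance),
          PlusOne.SepProblem F true I ↔ PlusOne.SepProblem F false (f I)) :=
  ⟨fun F _ _ _ _ _ α hα L L' hL hL' =>
      PlusOne.separable_iff_separable_assoc F α hα L L' hL hL',
    PlusOne.reduction, PlusOne.computable_reduction, PlusOne.sepProblem_reduction_iff⟩
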